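/- Let $n\ge 1$ be an integer and $\alpha\in(0,1)$. For $\varphi\in C_c^\infty(\mathbb R^n)$ let $$\nabla^\alpha\varphi(x)=\mu_{n,\alpha}\int_{\mathbb R^n}\frac{\varphi(y)-\varphi(x)}{|y-x|^{n+\alpha}}\,\frac{y-x}{|y-x|}\,dy,\qquad \mu_{n,\alpha}=2^\alpha\pi^{-n/2}\frac{\Gamma((n+\alpha+1)/2)}{\Gamma((1-\alpha)/2)},$$ be the Riesz fractional gradient. For $p\in[1,\infty]$ and $u\in L^p(\mathbb R^n)$, a function $g\in L^1_{loc}(\mathbb R^n;\mathbb R^n)$ is the weak fractional gradient $\nabla^\alpha u$ of $u$ if $\int_{\mathbb R^n} g\,\varphi\,dx=-\int_{\mathbb R^n}u\,\nabla^\alpha\varphi\,dx$ for all $\varphi\in C_c^\infty(\mathbb R^n)$, and $S^{\alpha,p}(\mathbb R^n)=\{u\in L^p(\mathbb R^n):\nabla^\alpha u\in L^p(\mathbb R^n;\mathbb R^n)\}$. For $v\in W^{1,p}(\mathbb R^n)$ let $$(-\Delta)^{\frac{1-\alpha}{2}}v(x)=\nu\int_{\mathbb R^n}\frac{v(x+h)-v(x)}{|h|^{n+1-\alpha}}\,dh,\qquad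 \nu=2^{1-\alpha}\pi^{-n/2}\frac{\Gamma((n+1-\alpha)/2)}{\Gamma(-(1-\alpha)/2)}.$$ Then the following hold, where $\nabla$ denotes the weak gradient. (i) For every $p\in[1,\infty]$ and every $u\in S^{\alpha,p}(\mathbb R^n)$ there exists $v\in W^{1,p}_{loc}(\mathbb R^n)$ such that $\nabla v=\nabla^\alpha u$ on $\mathbb R^n$. (ii) There is a constant $C=C(n,\alpha)$ such that for every $p\in[1,\infty]$ and every $v\in W^{1,p}(\mathbb R^n)$ the integral defining $u=(-\Delta)^{\frac{1-\alpha}{2}}v$ converges absolutely for a.e. $x\in\mathbb R^n$, and $u\in S^{\alpha,p}(\mathbb R^n)$, $\nabla^\alpha u=\nabla v$ on $\mathbb R^n$, and $$\|u\|_p\le C\,\|v\|_p^{\alpha}\,\|\nabla v\|_p^{1-\alpha}.$$ -/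

import Mathlib

open MeasureTheory
open scoped ENNReal NNReal ContDiff

noncomputable section

/-- `ℝⁿ` with the Euclidean norm and Lebesgue measure. -/
abbrev Rn (n : ℕ) : Type := EuclideanSpace ℝ (Fin n)

/-- Membership in `C_c^∞(ℝⁿ)`. -/
structure IsTestFunction {n : ℕ} (φ : Rn n → ℝ) : Prop where
  smooth : ContDiff ℝ ∞ φ
  compactSupport : HasCompactSupport φ

/-- `g` is a weak gradient of `v` on `ℝⁿ`. -/
structure HasWeakGradient {n : ℕ} (v : Rn n → ℝ) (g : Rn n → Rn n) : Prop where
  locallyIntegrable : LocallyIntegrable v volume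
  locallyIntegrable_grad : LocallyIntegrable g volume
  integral_eq : ∀ φ : Rn n → ℝ, IsTestFunction φ →
    ∫ x, φ x • g x = -∫ x, v x • gradient φ x

/-- Membership in the Sobolev space `W^{1,p}(ℝⁿ)`. -/
def MemSobolev {n : ℕ} (p : ℝ≥0∞) (v : Rn n → ℝ) : Prop :=
  MemLp v p volume ∧ ∃ g : Rn n → Rn n, HasWeakGradient v g ∧ MemLp g p volume

/-- Membership in the local Sobolev space `W^{1,p}_loc(ℝⁿ)`. -/
def MemSobolevLoc {n : ℕ} (p : ℝ≥0∞) (v : Rn n → ℝ) : Prop :=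
  (∀ K : Set (Rn n), IsCompact K → MemLp v p (volume.restrict K)) ∧
    ∃ g : Rn n → Rn n, HasWeakGradient v g ∧
      ∀ K : Set (Rn n), IsCompact K → MemLp g p (volume.restrict K)

/-- The normalizing constant `μ_{n,α}` of the Riesz fractional gradient. -/
def rieszGradientConst (n : ℕ) (α : ℝ) : ℝ :=
  2 ^ α * Real.pi ^ (-(n : ℝ) / 2) * Real.Gamma ((n + α + 1) / 2) / Real.Gamma ((1 - α) / 2)

/-- The Riesz fractional gradient `∇^α φ` of a bounded Lipschitz function, for which the integral
converges absolutely at every point. -/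
def rieszGradient {n : ℕ} (α : ℝ) (φ : Rn n → ℝ) (x : Rn n) : Rn n :=
  rieszGradientConst n α •
    ∫ y, ((φ y - φ x) / ‖y - x‖ ^ ((n : ℝ) + α)) • (‖y - x‖⁻¹ • (y - x))

/-- The normalizing constant `ν_{n,s}` of the fractional Laplacian `(-Δ)^{s/2}`. -/
def fracLaplacianConst (n : ℕ) (s : ℝ) : ℝ :=
  2 ^ s * Real.pi ^ (-(n : ℝ) / 2) * Real.Gamma ((n + s) / 2) / Real.Gamma (-s / 2)

/-- The integrand `h ↦ (v(x+h) - v(x)) / |h|^{n+s}` of the fractional Laplacian at `x`. -/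
def fracLaplacianKernel {n : ℕ} (s : ℝ) (v : Rn n → ℝ) (x h : Rn n) : ℝ :=
  (v (x + h) - v x) / ‖h‖ ^ ((n : ℝ) + s)

/-- The fractional Laplacian `(-Δ)^{s/2} v`, `0 < s < 1`, given at each point where the integral
converges absolutely by the singular integral. Note that `s` is the order of the operator, so
`(-Δ)^{(1-α)/2}` is `fracLaplacian (1 - α)`. -/
def fracLaplacian {n : ℕ} (s : ℝ) (v : Rn n → ℝ) (x : Rn n) : ℝ :=
  fracLaplacianConst n s * ∫ h, fracLaplacianKernel s v x h

/-- `g` is a weak `α`-fractional gradient of `u`. This is used for `u ∈ L^p(ℝⁿ)`, `1 ≤ p ≤ ∞`,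
so that `u ∈ L^1 + L^∞`; as `∇^α φ ∈ L^1 ∩ L^∞`, both integrals converge absolutely. -/
structure HasWeakFracGradient {n : ℕ} (α : ℝ) (u : Rn n → ℝ) (g : Rn n → Rn n) : Prop where
  locallyIntegrable_grad : LocallyIntegrable g volume
  integral_eq : ∀ φ : Rn n → ℝ, IsTestFunction φ →
    ∫ x, φ x • g x = -∫ x, u x • rieszGradient α φ x

/-- Membership in the fractional Sobolev space `S^{α,p}(ℝⁿ)`. -/
def MemFracSobolev {n : ℕ} (α : ℝ) (p : ℝ≥0∞) (u : Rn n → ℝ) : Prop :=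
  MemLp u p volume ∧ ∃ g : Rn n → Rn n, HasWeakFracGradient α u g ∧ MemLp g p volume

end

/-! Formally ∇^α = ∇ I_{1-α}, where I_{1-α} is the Riesz potential and the inverse of
(-Δ)^{(1-α)/2}. Both halves transfer this to L^p by duality, with the analysis carried out on test
functions.

(i) The candidate is v = I_{1-α} u, whose kernel is a multiple of |x-y|^{-m} with m = n+α-1 > 0. For
a general p the integral diverges at infinity. Subtracting |y|^{-m} 1_{|y|>1} from the kernel leaves
decay of order |y|^{-(m+1)} = |y|^{-(n+α)}, uniformly for x in a ball, and such a tail lies in every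
L^q. Hence `fracPrimitive` is locally in L^p (`eLpNorm_absPotential_ball_lt_top`). The subtracted
term does not involve x, so it disappears when tested against ∂φ. What remains is the formula ∇^α φ
= c |·|^{-m} * ∇φ (`IsTestFunction.inner_rieszGradient_eq_potential`) and Fubini
(`integral_fracPrimitive_mul_fderiv`).

(ii) Put s = 1-α. The L^p norm of v(·+h) - v is at most min(‖∇v‖_p |h|, 2‖v‖_p). Minkowski's
inequality and the scaling of ∫ min(A|h|, B) |h|^{-(n+s)} dh = K A^s B^{1-s} give the absolute
convergence and the interpolation bound together, with a constant free of p
(`eLpNorm_diffEnergy_le`). To identify the fractional gradient, (-Δ)^{s/2} is moved from v to ψ =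
⟨∇^α φ, e⟩ by symmetry (`integral_integral_diff_symm`), and (-Δ)^{s/2} ψ = ∂_e φ is used
(`IsTestFunction.fracLaplacian_rieszGradient_ae_eq`). The latter is checked on the Fourier side: the
symbols are (2π|ξ|)^{1-α} and 2πi⟨ξ,e⟩(2π|ξ|)^{α-1}. They are computed, with their exact constants,
by writing powers of |h| as superpositions of Gaussians. -/

noncomputable section

/-! ### Minkowski's integral inequality -/

section Minkowski

variable {X Y : Type*} [MeasurableSpace X] [MeasurableSpace Y] {μ : Measure X} {ν : Measure Y}
  [SFinite μ]

/-- Hölder applied to the splitting F = w^{1/q} · (F w^{-1/q}), with q conjugate to p, followed by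
Tonelli and the slice bounds ∫ F(x,y)^p dx ≤ w(y)^p. Dividing by w is why it must not vanish. For p
= ∞ it suffices to exchange the two almost-everywhere quantifiers. -/
theorem eLpNorm_lintegral_le_of_pos [SFinite ν] {p : ℝ≥0∞} (hp : 1 ≤ p) {F : X → Y → ℝ≥0∞}
    (hF : Measurable (Function.uncurry F)) {w : Y → ℝ≥0∞} (hw : Measurable w)
    (hw0 : ∀ y, w y ≠ 0) (hwtop : ∫⁻ y, w y ∂ν ≠ ⊤)
    (h : ∀ y, eLpNorm (fun x => F x y) p μ ≤ w y) :
    eLpNorm (fun x => ∫⁻ y, F x y ∂ν) p μ ≤ ∫⁻ y, w y ∂ν := by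
  have hFx : ∀ x, Measurable (F x) := fun x => hF.comp measurable_prodMk_left
  have hFy : ∀ y, Measurable (fun x => F x y) := fun y => hF.comp measurable_prodMk_right
  have hw1 : ∀ᵐ y ∂ν, w y < ⊤ := ae_lt_top hw hwtop
  rcases eq_or_ne p ⊤ with rfl | hptop
  · have h1 : ∀ᵐ y ∂ν, ∀ᵐ x ∂μ, F x y ≤ w y := by
      refine Filter.Eventually.of_forall fun y => ?_
      have := ae_le_eLpNormEssSup (f := fun x => F x y) (μ := μ)
      filter_upwards [this] with x hx
      have h2 := h y
      rw [eLpNorm_exponent_top] at h2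
      simpa using hx.trans h2
    have h2 : ∀ᵐ x ∂μ, ∀ᵐ y ∂ν, F x y ≤ w y := by
      refine (Measure.ae_ae_comm (p := fun x y => F x y ≤ w y) ?_).2 h1
      exact measurableSet_le hF (hw.comp measurable_snd)
    rw [eLpNorm_exponent_top]
    refine eLpNormEssSup_le_of_ae_enorm_bound ?_
    filter_upwards [h2] with x hx
    simpa using lintegral_mono_ae hx
  have hp0 : p ≠ 0 := (zero_lt_one.trans_le hp).ne'
  set r := p.toReal with hr
  have hr1 : 1 ≤ r := by
    rw [hr, ← ENNReal.toReal_one]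
    exact ENNReal.toReal_mono hptop hp
  have hr0 : 0 < r := zero_lt_one.trans_le hr1
  have hnorm : ∀ G : X → ℝ≥0∞, eLpNorm G p μ = (∫⁻ x, G x ^ r ∂μ) ^ (1 / r) := by
    intro G
    rw [eLpNorm_eq_lintegral_rpow_enorm_toReal hp0 hptop]
    simp [hr]
  have hle : ∀ y, ∫⁻ x, F x y ^ r ∂μ ≤ w y ^ r := by
    intro y
    have := h y
    rw [hnorm, one_div, ENNReal.rpow_inv_le_iff hr0] at this
    exact this
  set W := ∫⁻ y, w y ∂ν with hW
  rw [hnorm, one_div, ENNReal.rpow_inv_le_iff hr0]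
  have hpoint : ∀ x, (∫⁻ y, F x y ∂ν) ^ r
      ≤ W ^ (r - 1) * ∫⁻ y, F x y ^ r * w y ^ (-(r - 1)) ∂ν := by
    intro x
    -- The exponent 1 has no finite conjugate; there the weights are trivial.
    rcases hr1.eq_or_lt with h1 | h1
    · rw [← h1]; simp
    set q := r / (r - 1) with hq
    have hpq : q.HolderConjugate r := (Real.HolderConjugate.conjExponent h1).symm
    have hq0 : 0 < q := hpq.pos
    have hqi : q⁻¹ = (r - 1) / r := by rw [hq, inv_div]
    have key := ENNReal.lintegral_mul_le_Lp_mul_Lq ν hpq (f := fun y => w y ^ q⁻¹)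
      (g := fun y => F x y * w y ^ (-q⁻¹)) (hw.pow_const _).aemeasurable
      ((hFx x).mul (hw.pow_const _)).aemeasurable
    have e1 : ∫⁻ y, F x y ∂ν
        = ∫⁻ y, ((fun y => w y ^ q⁻¹) * (fun y => F x y * w y ^ (-q⁻¹))) y ∂ν := by
      refine lintegral_congr_ae ?_
      filter_upwards [hw1] with y hy
      simp only [Pi.mul_apply]
      rw [mul_left_comm, ← ENNReal.rpow_add _ _ (hw0 y) hy.ne]
      simp
    have e2 : ∀ y, (w y ^ q⁻¹) ^ q = w y := fun y => by
      rw [← ENNReal.rpow_mul, inv_mul_cancel₀ hq0.ne', ENNReal.rpow_one]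
    have e3 : ∀ y, (F x y * w y ^ (-q⁻¹)) ^ r = F x y ^ r * w y ^ (-(r - 1)) := fun y => by
      rw [ENNReal.mul_rpow_of_nonneg _ _ hr0.le, ← ENNReal.rpow_mul, hqi]
      congr 2
      field_simp
    rw [← e1] at key
    simp only [e2, e3] at key
    refine (ENNReal.rpow_le_rpow key hr0.le).trans_eq ?_
    rw [ENNReal.mul_rpow_of_nonneg _ _ hr0.le, ← ENNReal.rpow_mul, ← ENNReal.rpow_mul,
      one_div_mul_cancel hr0.ne', ENNReal.rpow_one, one_div, hqi]
    congr 2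
    field_simp
  calc ∫⁻ x, (∫⁻ y, F x y ∂ν) ^ r ∂μ
      ≤ ∫⁻ x, W ^ (r - 1) * ∫⁻ y, F x y ^ r * w y ^ (-(r - 1)) ∂ν ∂μ := lintegral_mono hpoint
    _ = W ^ (r - 1) * ∫⁻ y, w y ^ (-(r - 1)) * ∫⁻ x, F x y ^ r ∂μ ∂ν := by
        have hm : Measurable (Function.uncurry fun x y => F x y ^ r * w y ^ (-(r - 1))) :=
          (hF.pow_const _).mul ((hw.comp measurable_snd).pow_const _)
        rw [lintegral_const_mul _ hm.lintegral_prod_right, lintegral_lintegral_swap hm.aemeasurable]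
        congr 1
        refine lintegral_congr fun y => ?_
        rw [lintegral_mul_const _ ((hFy y).pow_const _), mul_comm]
    _ ≤ W ^ (r - 1) * ∫⁻ y, w y ∂ν := by
        gcongr W ^ (r - 1) * ?_
        refine lintegral_mono_ae ?_
        filter_upwards [hw1] with y hy
        calc w y ^ (-(r - 1)) * ∫⁻ x, F x y ^ r ∂μ ≤ w y ^ (-(r - 1)) * w y ^ r := by
              gcongr; exact hle y
          _ = w y := by
              rw [← ENNReal.rpow_add _ _ (hw0 y) hy.ne]
              simp
    _ = W ^ r := by
        rcases eq_or_ne W 0 with h0 | h0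
        · rw [← hW, h0, mul_zero, ENNReal.zero_rpow_of_pos hr0]
        · calc W ^ (r - 1) * W = W ^ (r - 1) * W ^ (1 : ℝ) := by rw [ENNReal.rpow_one]
            _ = W ^ r := by rw [← ENNReal.rpow_add _ _ h0 hwtop, sub_add_cancel]

/-- Minkowski's integral inequality. -/
theorem eLpNorm_lintegral_le [SigmaFinite ν] {p : ℝ≥0∞} (hp : 1 ≤ p) {F : X → Y → ℝ≥0∞}
    (hF : AEMeasurable (Function.uncurry F) (μ.prod ν)) {w : Y → ℝ≥0∞} (hw : Measurable w)
    (h : ∀ y, eLpNorm (fun x => F x y) p μ ≤ w y) :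
    eLpNorm (fun x => ∫⁻ y, F x y ∂ν) p μ ≤ ∫⁻ y, w y ∂ν := by
  rcases eq_or_ne (∫⁻ y, w y ∂ν) ⊤ with hwtop | hwtop
  · rw [hwtop]; exact le_top
  -- N contains every y whose slice of F differs from the measurable representative on a non-null
  -- set. Setting the representative to zero over N makes the slice bounds hold for every y.
  set N := toMeasurable ν {y | ¬ ∀ᵐ x ∂μ, F x y = hF.mk _ (x, y)} with hN
  have hN0 : ν N = 0 := by
    rw [hN, measure_toMeasurable, ← ae_iff]
    have h1 : ∀ᵐ z ∂(ν.prod μ), Function.uncurry F z.swap = hF.mk _ z.swap :=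
      Measure.measurePreserving_swap.quasiMeasurePreserving.ae hF.ae_eq_mk
    exact Measure.ae_ae_of_ae_prod h1
  have hNm : MeasurableSet N := measurableSet_toMeasurable _ _
  set F' : X → Y → ℝ≥0∞ := fun x y => Nᶜ.indicator (fun y => hF.mk _ (x, y)) y with hF'
  have hF'm : Measurable (Function.uncurry F') := by
    have : Function.uncurry F' = (Set.univ ×ˢ Nᶜ).indicator (hF.mk _) := by
      ext ⟨x, y⟩
      by_cases hy : y ∈ N <;> simp [F', hy]
    rw [this]
    exact hF.measurable_mk.indicator (MeasurableSet.univ.prod hNm.compl)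
  have hF'le : ∀ y, eLpNorm (fun x => F' x y) p μ ≤ w y := by
    intro y
    by_cases hy : y ∈ N
    · have : (fun x => F' x y) = fun _ => 0 := by ext x; simp [F', hy]
      rw [this]
      simp
    · have h2 : ∀ᵐ x ∂μ, F x y = hF.mk _ (x, y) := by
        by_contra hcon
        exact hy (subset_toMeasurable _ _ hcon)
      refine le_trans (le_of_eq (eLpNorm_congr_ae ?_)) (h y)
      filter_upwards [h2] with x hx
      simp [F', hy, hx]
  have hFF' : eLpNorm (fun x => ∫⁻ y, F x y ∂ν) p μ = eLpNorm (fun x => ∫⁻ y, F' x y ∂ν) p μ := by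
    refine eLpNorm_congr_ae ?_
    filter_upwards [Measure.ae_ae_of_ae_prod hF.ae_eq_mk] with x hx
    refine lintegral_congr_ae ?_
    have : ∀ᵐ y ∂ν, y ∉ N := by rw [ae_iff]; simpa using hN0
    filter_upwards [hx, this] with y hy hyN
    simpa [F', hyN] using hy
  rw [hFF']
  -- The weight may vanish, so a strictly positive function of integral below ε is added to it.
  refine ENNReal.le_of_forall_pos_le_add fun ε hε _ => ?_
  obtain ⟨g, hg0, hgm, hgε⟩ := exists_pos_lintegral_lt_of_sigmaFinite ν
    (ENNReal.coe_pos.2 hε).ne'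
  have hsum : ∫⁻ y, (w y + g y) ∂ν = ∫⁻ y, w y ∂ν + ∫⁻ y, (g y : ℝ≥0∞) ∂ν :=
    lintegral_add_left hw _
  have := eLpNorm_lintegral_le_of_pos (ν := ν) hp hF'm (w := fun y => w y + g y)
    (hw.add hgm.coe_nnreal_ennreal) (fun y => by simp [(hg0 y).ne'])
    (by rw [hsum]; exact ENNReal.add_ne_top.2 ⟨hwtop, (hgε.trans ENNReal.coe_lt_top).ne⟩)
    (fun y => (hF'le y).trans le_self_add)
  rw [hsum] at this
  exact this.trans (by gcongr)

end Minkowski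

/-! ### Translation increments and singular difference integrals in L^p -/

theorem quasiMeasurePreserving_add_smul {n : ℕ} (h : Rn n) (ν : Measure ℝ) [SFinite ν] :
    Measure.QuasiMeasurePreserving (fun z : Rn n × ℝ => z.1 + z.2 • h) (volume.prod ν) volume := by
  have h1 : MeasurePreserving (fun z : ℝ × Rn n => (z.1, z.2 + z.1 • h)) (ν.prod volume)
      (ν.prod volume) := by
    refine (MeasurePreserving.id ν).skew_product (g := fun t x => x + t • h) ?_ ?_
    · unfold Function.uncurry; fun_prop
    · exact Filter.Eventually.of_forall fun t => map_add_right_eq_self _ _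
  exact (Measure.quasiMeasurePreserving_snd.comp h1.quasiMeasurePreserving).comp
    Measure.measurePreserving_swap.quasiMeasurePreserving

theorem eLpNorm_comp_add_right {n : ℕ} {E : Type*} [NormedAddCommGroup E] {G : Rn n → E}
    (hG : AEStronglyMeasurable G volume) (p : ℝ≥0∞) (h : Rn n) :
    eLpNorm (fun x => G (x + h)) p volume = eLpNorm G p volume :=
  eLpNorm_comp_measurePreserving hG (measurePreserving_add_right volume h)

theorem eLpNorm_segment_average_le {n : ℕ} {E : Type*} [NormedAddCommGroup E] {G : Rn n → E}
    (hG : AEStronglyMeasurable G volume) {p : ℝ≥0∞} (hp : 1 ≤ p) (h : Rn n) :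
    eLpNorm (fun x => ∫⁻ t in Set.Ioc (0 : ℝ) 1, ‖G (x + t • h)‖ₑ) p volume
      ≤ eLpNorm G p volume := by
  have := eLpNorm_lintegral_le (μ := (volume : Measure (Rn n)))
    (ν := volume.restrict (Set.Ioc (0 : ℝ) 1)) hp
    (F := fun x t => ‖G (x + t • h)‖ₑ) (w := fun _ => eLpNorm G p volume)
    (hG.comp_quasiMeasurePreserving (quasiMeasurePreserving_add_smul h _)).enorm
    measurable_const ?_
  · simpa using this
  · intro t
    refine (eLpNorm_enorm _).le.trans (eLpNorm_comp_add_right hG p (t • h)).le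

/-- All translates of G have the same norm, so averaging over the segment costs nothing. This is the
common core of the mean value bounds for weak gradients and for C¹ maps. -/
theorem eLpNorm_translate_sub_le {n : ℕ} {E F : Type*} [NormedAddCommGroup E]
    [NormedAddCommGroup F] {f : Rn n → E} {G : Rn n → F}
    (hG : AEStronglyMeasurable G volume) {p : ℝ≥0∞} (hp : 1 ≤ p) (h : Rn n)
    (hfG : ∀ᵐ x, ‖f (x + h) - f x‖ₑ ≤ ‖h‖ₑ * ∫⁻ t in Set.Ioc (0 : ℝ) 1, ‖G (x + t • h)‖ₑ) :
    eLpNorm (fun x => f (x + h) - f x) p volume ≤ eLpNorm G p volume * ‖h‖ₑ := by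
  have h1 := eLpNorm_le_nnreal_smul_eLpNorm_of_ae_le_mul' (p := p) (c := ‖h‖₊) (μ := volume)
    (f := fun x => f (x + h) - f x)
    (g := fun x => ∫⁻ t in Set.Ioc (0 : ℝ) 1, ‖G (x + t • h)‖ₑ) (by simpa only [enorm_eq_self, enorm_eq_nnnorm] using hfG)
  refine h1.trans ?_
  rw [ENNReal.smul_def, smul_eq_mul, mul_comm]
  exact mul_le_mul_left (eLpNorm_segment_average_le hG hp h) _

/-- The kernel `min(|h|, 1) |h|^{-(n+σ)}`, integrable for `0 < σ < 1`. -/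
def minKernel (n : ℕ) (σ : ℝ) (h : Rn n) : ℝ := min ‖h‖ 1 * ‖h‖ ^ (-((n : ℝ) + σ))

theorem minKernel_nonneg (n : ℕ) (σ : ℝ) (h : Rn n) : 0 ≤ minKernel n σ h := by
  unfold minKernel; positivity

theorem nontrivial_Rn {n : ℕ} (hn : 1 ≤ n) : Nontrivial (Rn n) :=
  Module.nontrivial_of_finrank_pos (R := ℝ) (by rw [finrank_euclideanSpace, Fintype.card_fin]; omega)

/-- In polar coordinates the radial density is y^{-σ} on (0,1] and y^{-1-σ} beyond 1. -/
theorem integrable_minKernel {n : ℕ} (hn : 1 ≤ n) {σ : ℝ} (hσ0 : 0 < σ) (hσ1 : σ < 1) :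
    Integrable (minKernel n σ) volume := by
  have := nontrivial_Rn hn
  have key := integrable_fun_norm_addHaar (μ := (volume : Measure (Rn n)))
    (f := fun y : ℝ => min y 1 * y ^ (-((n : ℝ) + σ)))
  refine key.2 ?_
  rw [← Set.Ioc_union_Ioi_eq_Ioi zero_le_one]
  have hpow : ∀ y : ℝ, 0 < y → y ^ (n - 1) = y ^ ((n : ℝ) - 1) := fun y hy => by
    rw [← Real.rpow_natCast, Nat.cast_sub hn, Nat.cast_one]
  refine IntegrableOn.union ?_ ?_
  · have h1 : IntegrableOn (fun y : ℝ => y ^ (-σ)) (Set.Ioc 0 1) :=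
      (intervalIntegrable_iff_integrableOn_Ioc_of_le zero_le_one).1
        (intervalIntegral.intervalIntegrable_rpow' (by linarith))
    refine h1.congr_fun (fun y hy => ?_) measurableSet_Ioc
    simp only [finrank_euclideanSpace, Fintype.card_fin, smul_eq_mul]
    rw [hpow y hy.1, min_eq_left hy.2]
    nth_rw 3 [← Real.rpow_one y]
    rw [← Real.rpow_add hy.1, ← Real.rpow_add hy.1]
    congr 1; ring
  · have h1 : IntegrableOn (fun y : ℝ => y ^ (-1 - σ)) (Set.Ioi 1) :=
      integrableOn_Ioi_rpow_of_lt (by linarith) zero_lt_one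
    refine h1.congr_fun (fun y hy => ?_) measurableSet_Ioi
    have hy1 : (1 : ℝ) < y := hy
    have hy0 : 0 < y := by linarith
    simp only [finrank_euclideanSpace, Fintype.card_fin, smul_eq_mul]
    rw [hpow y hy0, min_eq_right hy1.le, one_mul, ← Real.rpow_add hy0]
    congr 1; ring

/-- The constant `∫ min(|h|, 1) |h|^{-(n+σ)} dh`. -/
def minKernelIntegral (n : ℕ) (σ : ℝ) : ℝ := ∫ h, minKernel n σ h

theorem minKernelIntegral_nonneg (n : ℕ) (σ : ℝ) : 0 ≤ minKernelIntegral n σ :=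
  integral_nonneg (minKernel_nonneg n σ)

theorem min_mul_rpow_eq_minKernel {n : ℕ} {σ A B : ℝ} (hA : 0 < A) (hB : 0 < B) (h : Rn n) :
    min (A * ‖h‖) B * ‖h‖ ^ (-((n : ℝ) + σ))
      = B * (A / B) ^ ((n : ℝ) + σ) * minKernel n σ ((A / B) • h) := by
  have hR : 0 < A / B := div_pos hA hB
  unfold minKernel
  rw [norm_smul, Real.norm_of_nonneg hR.le, Real.mul_rpow hR.le (norm_nonneg _), Real.rpow_neg hR.le]
  have h1 : min (A * ‖h‖) B = B * min (A / B * ‖h‖) 1 := by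
    rw [mul_min_of_nonneg _ _ hB.le, mul_one]
    congr 1
    field_simp
  rw [h1]
  have : (A / B) ^ ((n : ℝ) + σ) ≠ 0 := (Real.rpow_pos_of_pos hR _).ne'
  field_simp

/-- Dilation by A/B reduces to A = B = 1. The prefactor B(A/B)^{n+σ} and the Jacobian (A/B)^{-n}
combine to A^σ B^{1-σ}; this scaling is the source of the interpolation exponents. -/
theorem lintegral_min_mul_rpow {n : ℕ} (hn : 1 ≤ n) {σ : ℝ} (hσ0 : 0 < σ) (hσ1 : σ < 1) {A B : ℝ}
    (hA : 0 ≤ A) (hB : 0 ≤ B) :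
    ∫⁻ h : Rn n, ENNReal.ofReal (min (A * ‖h‖) B * ‖h‖ ^ (-((n : ℝ) + σ)))
      = ENNReal.ofReal (minKernelIntegral n σ * (A ^ σ * B ^ (1 - σ))) := by
  -- The dilation needs A and B positive; if either is zero, both sides vanish because 0 < σ < 1.
  rcases hA.eq_or_lt with rfl | hA
  · simp [Real.zero_rpow hσ0.ne', min_eq_left hB]
  rcases hB.eq_or_lt with rfl | hB
  · have : ∀ h : Rn n, min (A * ‖h‖) 0 = 0 := fun h => min_eq_right (by positivity)
    simp [Real.zero_rpow (sub_pos.2 hσ1).ne', this]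
  have hR : 0 < A / B := div_pos hA hB
  simp_rw [min_mul_rpow_eq_minKernel (n := n) (σ := σ) hA hB]
  rw [← ofReal_integral_eq_lintegral_ofReal]
  · rw [integral_const_mul, Measure.integral_comp_smul_of_nonneg (μ := volume) (hR := hR.le)]
    congr 1
    rw [finrank_euclideanSpace, Fintype.card_fin, ← minKernelIntegral, smul_eq_mul,
      Real.rpow_add hR, Real.rpow_natCast, Real.div_rpow hA.le hB.le, Real.rpow_sub hB,
      Real.rpow_one]
    have : (A / B) ^ n ≠ 0 := by positivity
    field_simp
  · exact ((integrable_minKernel hn hσ0 hσ1).comp_smul hR.ne').const_mul _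
  · refine Filter.Eventually.of_forall fun h => ?_
    have := minKernel_nonneg n σ ((A / B) • h)
    simp only [Pi.zero_apply]
    positivity

/-- `∫ |f(x+h) - f(x)| |h|^{-(n+σ)} dh`. -/
def diffEnergy {n : ℕ} {E : Type*} [NormedAddCommGroup E] (σ : ℝ) (f : Rn n → E) (x : Rn n) :
    ℝ≥0∞ :=
  ∫⁻ h, ‖f (x + h) - f x‖ₑ * ENNReal.ofReal (‖h‖ ^ (-((n : ℝ) + σ)))

theorem aestronglyMeasurable_translate_sub {n : ℕ} {E : Type*} [NormedAddCommGroup E]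
    {f : Rn n → E} (hf : AEStronglyMeasurable f volume) :
    AEStronglyMeasurable (fun z : Rn n × Rn n => f (z.1 + z.2) - f z.1)
      (volume.prod volume) :=
  (hf.comp_quasiMeasurePreserving (quasiMeasurePreserving_add volume volume)).sub hf.comp_fst

theorem measurable_norm_rpow (n : ℕ) (r : ℝ) : Measurable fun h : Rn n => ‖h‖ ^ r :=
  measurable_norm.pow_const r

theorem aemeasurable_diffEnergy_integrand {n : ℕ} {E : Type*} [NormedAddCommGroup E]
    {f : Rn n → E} (hf : AEStronglyMeasurable f volume) (σ : ℝ) :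
    AEMeasurable (fun z : Rn n × Rn n => ‖f (z.1 + z.2) - f z.1‖ₑ *
      ENNReal.ofReal (‖z.2‖ ^ (-((n : ℝ) + σ)))) (volume.prod volume) :=
  (aestronglyMeasurable_translate_sub hf).enorm.mul
    ((measurable_norm_rpow n _).comp measurable_snd).ennreal_ofReal.aemeasurable

theorem aemeasurable_diffEnergy {n : ℕ} {E : Type*} [NormedAddCommGroup E]
    {f : Rn n → E} (hf : AEStronglyMeasurable f volume) (σ : ℝ) :
    AEMeasurable (diffEnergy σ f) volume :=
  (aemeasurable_diffEnergy_integrand hf σ).lintegral_prod_right'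

/-- Minkowski puts the L^p norm inside the integral over h, where the two increment bounds combine
into their minimum. The constant is independent of p. -/
theorem eLpNorm_diffEnergy_le {n : ℕ} (hn : 1 ≤ n) {E : Type*} [NormedAddCommGroup E] {σ : ℝ}
    (hσ0 : 0 < σ) (hσ1 : σ < 1) {f : Rn n → E} (hf : AEStronglyMeasurable f volume) {p : ℝ≥0∞}
    (hp : 1 ≤ p) {A B : ℝ} (hA : 0 ≤ A) (hB : 0 ≤ B)
    (h1 : ∀ h, eLpNorm (fun x => f (x + h) - f x) p volume ≤ ENNReal.ofReal A * ‖h‖ₑ)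
    (h2 : ∀ h, eLpNorm (fun x => f (x + h) - f x) p volume ≤ ENNReal.ofReal B) :
    eLpNorm (diffEnergy σ f) p volume
      ≤ ENNReal.ofReal (minKernelIntegral n σ * (A ^ σ * B ^ (1 - σ))) := by
  rw [← lintegral_min_mul_rpow hn hσ0 hσ1 hA hB]
  refine eLpNorm_lintegral_le hp (aemeasurable_diffEnergy_integrand hf σ) ?_ fun h => ?_
  · exact (((measurable_norm.const_mul A).min measurable_const).mul
      (measurable_norm_rpow n _)).ennreal_ofReal
  · have hk : 0 ≤ ‖h‖ ^ (-((n : ℝ) + σ)) := by positivity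
    have := eLpNorm_le_nnreal_smul_eLpNorm_of_ae_le_mul' (p := p) (μ := volume)
      (c := (‖h‖ ^ (-((n : ℝ) + σ))).toNNReal)
      (f := fun x => ‖f (x + h) - f x‖ₑ * ENNReal.ofReal (‖h‖ ^ (-((n : ℝ) + σ))))
      (g := fun x => f (x + h) - f x)
      (Filter.Eventually.of_forall fun x => by
        rw [enorm_eq_self, mul_comm]; rfl)
    refine this.trans ?_
    rw [ENNReal.smul_def, smul_eq_mul, mul_comm, ENNReal.ofReal_mul (by positivity)]
    refine mul_le_mul_left ?_ _
    rw [ENNReal.ofReal_min, ENNReal.ofReal_mul hA, ofReal_norm]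
    exact le_min (h1 h) (h2 h)

/-! ### Calculus of test functions -/

section TestFunctions

variable {n : ℕ} {φ : Rn n → ℝ}

theorem inner_gradient_eq_fderiv (φ : Rn n → ℝ) (x e : Rn n) :
    inner ℝ (gradient φ x) e = fderiv ℝ φ x e := by
  simp [gradient, InnerProductSpace.toDual_symm_apply]

theorem IsTestFunction.continuous (hφ : IsTestFunction φ) : Continuous φ := hφ.smooth.continuous

theorem IsTestFunction.differentiable (hφ : IsTestFunction φ) : Differentiable ℝ φ :=
  hφ.smooth.differentiable (by simp)

theorem IsTestFunction.comp_add_right (hφ : IsTestFunction φ) (a : Rn n) :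
    IsTestFunction fun x => φ (x + a) :=
  ⟨hφ.smooth.comp (contDiff_id.add contDiff_const),
    hφ.compactSupport.comp_homeomorph (Homeomorph.addRight a)⟩

theorem IsTestFunction.sub {ψ : Rn n → ℝ} (hφ : IsTestFunction φ) (hψ : IsTestFunction ψ) :
    IsTestFunction fun x => φ x - ψ x :=
  ⟨hφ.smooth.sub hψ.smooth, hφ.compactSupport.sub hψ.compactSupport⟩

theorem IsTestFunction.contDiff_fderiv (hφ : IsTestFunction φ) : ContDiff ℝ ∞ (fderiv ℝ φ) :=
  hφ.smooth.fderiv_right (by simp)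

theorem IsTestFunction.fderiv_apply (hφ : IsTestFunction φ) (e : Rn n) :
    IsTestFunction fun x => fderiv ℝ φ x e :=
  ⟨hφ.contDiff_fderiv.clm_apply contDiff_const, hφ.compactSupport.fderiv_apply ℝ e⟩

theorem IsTestFunction.continuous_gradient (hφ : IsTestFunction φ) : Continuous (gradient φ) :=
  (LinearIsometryEquiv.continuous _).comp hφ.contDiff_fderiv.continuous

theorem IsTestFunction.hasCompactSupport_gradient (hφ : IsTestFunction φ) :
    HasCompactSupport (gradient φ) :=
  (hφ.compactSupport.fderiv ℝ).comp_left (g := (InnerProductSpace.toDual ℝ (Rn n)).symm)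
    (map_zero _)

theorem IsTestFunction.memLp (hφ : IsTestFunction φ) (p : ℝ≥0∞) : MemLp φ p volume :=
  hφ.continuous.memLp_of_hasCompactSupport hφ.compactSupport

theorem gradient_comp_add_right (φ : Rn n → ℝ) (a x : Rn n) :
    gradient (fun x => φ (x + a)) x = gradient φ (x + a) := by
  simp [gradient, fderiv_comp_add_right]

end TestFunctions

/-! ### Increments as integrals of the gradient along segments -/

section Segment

variable {n : ℕ} {E : Type*} [NormedAddCommGroup E] [NormedSpace ℝ E]

/-- For 0 < t ≤ 1 the factor η(x - th) vanishes unless x lies in one fixed ball, so only the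
restriction of g to a compact set matters. -/
theorem integrable_smul_comp_sub_smul {g : Rn n → E} (hg : LocallyIntegrable g volume)
    {η : Rn n → ℝ} (hη : Continuous η) (hηc : HasCompactSupport η) (h : Rn n) :
    Integrable (fun z : Rn n × ℝ => η (z.1 - z.2 • h) • g z.1)
      (volume.prod (volume.restrict (Set.Ioc (0 : ℝ) 1))) := by
  obtain ⟨C, hC⟩ := hηc.exists_bound_of_continuous hη
  obtain ⟨R, hR⟩ := hηc.isCompact.isBounded.exists_norm_le
  set K := Metric.closedBall (0 : Rn n) (R + ‖h‖) with hK
  have hgK : Integrable (K.indicator g) volume :=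
    (integrable_indicator_iff Metric.isClosed_closedBall.measurableSet).2
      (hg.integrableOn_isCompact (isCompact_closedBall _ _))
  have h1 : Integrable (fun z : Rn n × ℝ => η (z.1 - z.2 • h) • K.indicator g z.1)
      (volume.prod (volume.restrict (Set.Ioc (0 : ℝ) 1))) := by
    refine (hgK.comp_fst (volume.restrict (Set.Ioc (0 : ℝ) 1))).bdd_smul (C := C) ?_ ?_
    · exact (hη.comp (by fun_prop)).aestronglyMeasurable
    · exact Filter.Eventually.of_forall fun z => hC _
  refine h1.congr ?_
  have h2 : ∀ᵐ z : Rn n × ℝ ∂(volume.prod (volume.restrict (Set.Ioc (0 : ℝ) 1))),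
      z.2 ∈ Set.Ioc (0 : ℝ) 1 :=
    Measure.quasiMeasurePreserving_snd.ae (ae_restrict_mem measurableSet_Ioc)
  filter_upwards [h2] with z hz
  by_cases hzK : z.1 ∈ K
  · simp [hzK]
  · have : η (z.1 - z.2 • h) = 0 := by
      by_contra hne
      apply hzK
      have h3 := hR _ (subset_tsupport _ hne)
      rw [hK, mem_closedBall_zero_iff]
      calc ‖z.1‖ = ‖(z.1 - z.2 • h) + z.2 • h‖ := by rw [sub_add_cancel]
        _ ≤ ‖z.1 - z.2 • h‖ + ‖z.2 • h‖ := norm_add_le _ _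
        _ ≤ R + ‖h‖ := by
            gcongr
            rw [norm_smul, Real.norm_of_nonneg hz.1.le]
            exact mul_le_of_le_one_left (norm_nonneg _) hz.2
    simp [this]

theorem measurePreserving_shear (h : Rn n) (ν : Measure ℝ) [SFinite ν] :
    MeasurePreserving (fun z : Rn n × ℝ => (z.1 + z.2 • h, z.2)) (volume.prod ν)
      (volume.prod ν) := by
  have h1 : MeasurePreserving (fun z : ℝ × Rn n => (z.1, z.2 + z.1 • h)) (ν.prod volume)
      (ν.prod volume) := by
    refine (MeasurePreserving.id ν).skew_product (g := fun t x => x + t • h) ?_ ?_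
    · unfold Function.uncurry; fun_prop
    · exact Filter.Eventually.of_forall fun t => map_add_right_eq_self _ _
  exact Measure.measurePreserving_swap.comp (h1.comp Measure.measurePreserving_swap)

theorem integrable_smul_comp_add_smul {g : Rn n → E} (hg : LocallyIntegrable g volume)
    {η : Rn n → ℝ} (hη : Continuous η) (hηc : HasCompactSupport η) (h : Rn n) :
    Integrable (fun z : Rn n × ℝ => η z.1 • g (z.1 + z.2 • h))
      (volume.prod (volume.restrict (Set.Ioc (0 : ℝ) 1))) := by
  have := (measurePreserving_shear h (volume.restrict (Set.Ioc (0 : ℝ) 1))).integrable_comp_of_integrable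
    (integrable_smul_comp_sub_smul hg hη hηc h)
  simpa [Function.comp_def] using this

theorem locallyIntegrable_segment_integral {g : Rn n → E} (hg : LocallyIntegrable g volume)
    (h : Rn n) :
    LocallyIntegrable (fun x => ∫ t in Set.Ioc (0 : ℝ) 1, g (x + t • h)) volume := by
  rw [locallyIntegrable_iff]
  intro K hK
  obtain ⟨R, hR0, hR⟩ := hK.isBounded.exists_pos_norm_le
  -- The bump is 1 on a ball containing K, so on K it can be dropped once integrability is known.
  let b : ContDiffBump (0 : Rn n) := ⟨R, R + 1, hR0, by linarith⟩
  have h1 := (integrable_smul_comp_add_smul hg b.continuous b.hasCompactSupport h).integral_prod_left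
  simp only [integral_smul] at h1
  refine (h1.integrableOn (s := K)).congr_fun (fun x hx => ?_) hK.measurableSet
  simp only
  rw [b.one_of_mem_closedBall (by simpa using hR x hx), one_smul]

/-- Tested against φ, the translation moves to φ, where the fundamental theorem of calculus applies
along the segment. For each t the weak gradient identity for φ(· - th) moves the derivative back. No
mollification of v is needed. -/
theorem HasWeakGradient.translate_sub_ae_eq {v : Rn n → ℝ} {g : Rn n → Rn n}
    (hvg : HasWeakGradient v g) (h : Rn n) :
    ∀ᵐ x, v (x + h) - v x = ∫ t in Set.Ioc (0 : ℝ) 1, inner ℝ (g (x + t • h)) h := by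
  have hgi : LocallyIntegrable (fun x => inner ℝ (g x) h) volume := by
    intro x
    obtain ⟨s, hs, hs'⟩ := hvg.locallyIntegrable_grad x
    exact ⟨s, hs, Integrable.inner_const hs' h⟩
  have hvh : LocallyIntegrable (fun x => v (x + h)) volume := by
    rw [locallyIntegrable_iff]
    intro K hK
    have h1 := (hvg.locallyIntegrable.integrableOn_isCompact (hK.image (continuous_add_const h)))
    exact (MeasurePreserving.integrableOn_image (measurePreserving_add_right volume h)
      (measurableEmbedding_addRight h)).1 h1
  refine ae_eq_of_integral_contDiff_smul_eq (hvh.sub hvg.locallyIntegrable)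
    (locallyIntegrable_segment_integral hgi h) fun φ hφ1 hφ2 => ?_
  have hφ : IsTestFunction φ := ⟨hφ1, hφ2⟩
  have hshift : ∀ a : Rn n, Integrable (fun x => φ (x + a) * v x) volume := fun a =>
    hvg.locallyIntegrable.integrable_smul_left_of_hasCompactSupport
      (hφ.comp_add_right a).continuous (hφ.comp_add_right a).compactSupport
  have hleft : ∫ x, φ x • (v (x + h) - v x) = ∫ x, (φ (x + -h) - φ x) * v x := by
    have e1 : Integrable (fun x => φ x * v (x + h)) volume :=
      hvh.integrable_smul_left_of_hasCompactSupport hφ.continuous hφ.compactSupport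
    have e2 : Integrable (fun x => φ x * v x) volume := by simpa using hshift 0
    simp only [smul_eq_mul, mul_sub, sub_mul]
    rw [integral_sub e1 e2, integral_sub (hshift (-h)) e2]
    congr 1
    rw [← integral_add_right_eq_self (μ := volume) (fun x => φ (x + -h) * v x) h]
    simp
  have hftc : ∀ x, φ (x + -h) - φ x
      = -∫ t in Set.Ioc (0 : ℝ) 1, inner ℝ (gradient φ (x - t • h)) h := by
    intro x
    have hd : ∀ t : ℝ, HasDerivAt (fun t : ℝ => φ (x - t • h))
        (-inner ℝ (gradient φ (x - t • h)) h) t := by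
      intro t
      have h1 : HasDerivAt (fun t : ℝ => x - t • h) (-h) t := by
        simpa using ((hasDerivAt_id t).smul_const h).const_sub x
      have h2 := (hφ.differentiable (x - t • h)).hasFDerivAt.comp_hasDerivAt t h1
      rw [inner_gradient_eq_fderiv, ← map_neg]
      exact h2
    have hc : Continuous fun t : ℝ => -inner ℝ (gradient φ (x - t • h)) h :=
      ((hφ.continuous_gradient.comp (by fun_prop)).inner continuous_const).neg
    have := intervalIntegral.integral_eq_sub_of_hasDerivAt (fun t _ => hd t)
      (hc.intervalIntegrable 0 1)
    rw [intervalIntegral.integral_of_le zero_le_one, integral_neg] at this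
    rw [this]
    simp [sub_eq_add_neg]
  set η : Rn n → ℝ := fun x => inner ℝ (gradient φ x) h with hη
  have hηc : Continuous η := hφ.continuous_gradient.inner continuous_const
  have hηs : HasCompactSupport η :=
    hφ.hasCompactSupport_gradient.comp_left (g := fun w => inner ℝ w h) (inner_zero_left h)
  have hI1 := integrable_smul_comp_sub_smul hvg.locallyIntegrable hηc hηs h
  have hI2 := integrable_smul_comp_add_smul hgi hφ.continuous hφ.compactSupport h
  have hslice : ∀ t : ℝ, ∫ x, η (x - t • h) * v x = -∫ x, φ x * inner ℝ (g (x + t • h)) h := by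
    intro t
    have hψ := hφ.comp_add_right (-(t • h))
    have h1 := hvg.integral_eq _ hψ
    have hi1 : Integrable (fun x => v x • gradient (fun x => φ (x + -(t • h))) x) volume :=
      hvg.locallyIntegrable.integrable_smul_right_of_hasCompactSupport hψ.continuous_gradient
        hψ.hasCompactSupport_gradient
    have hi2 : Integrable (fun x => φ (x + -(t • h)) • g x) volume :=
      hvg.locallyIntegrable_grad.integrable_smul_left_of_hasCompactSupport hψ.continuous
        hψ.compactSupport
    have h2 := congrArg (fun w => inner ℝ h w) h1
    simp only [inner_neg_right] at h2
    rw [← integral_inner hi1, ← integral_inner hi2] at h2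
    have h3 : ∫ x, φ x * inner ℝ (g (x + t • h)) h
        = ∫ x, inner ℝ h (φ (x + -(t • h)) • g x) := by
      rw [← integral_add_right_eq_self (μ := volume)
        (fun x => inner ℝ h (φ (x + -(t • h)) • g x)) (t • h)]
      refine integral_congr_ae (Filter.Eventually.of_forall fun x => ?_)
      simp [inner_smul_right, real_inner_comm]
    rw [h3, h2, neg_neg]
    refine integral_congr_ae (Filter.Eventually.of_forall fun x => ?_)
    simp only [hη, gradient_comp_add_right, inner_smul_right, real_inner_comm, sub_eq_add_neg]
    ring
  rw [hleft]
  calc ∫ x, (φ (x + -h) - φ x) * v x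
      = -∫ x, ∫ t in Set.Ioc (0 : ℝ) 1, η (x - t • h) • v x := by
        rw [← integral_neg]
        refine integral_congr_ae (Filter.Eventually.of_forall fun x => ?_)
        simp only [hftc x, smul_eq_mul, integral_mul_const, neg_mul, hη]
    _ = -∫ t in Set.Ioc (0 : ℝ) 1, ∫ x, η (x - t • h) • v x := by
        rw [integral_integral_swap hI1]
    _ = ∫ t in Set.Ioc (0 : ℝ) 1, ∫ x, φ x • inner ℝ (g (x + t • h)) h := by
        rw [← integral_neg]
        simp only [smul_eq_mul, hslice, neg_neg]
    _ = ∫ x, ∫ t in Set.Ioc (0 : ℝ) 1, φ x • inner ℝ (g (x + t • h)) h := by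
        exact (integral_integral_swap hI2).symm
    _ = ∫ x, φ x • ∫ t in Set.Ioc (0 : ℝ) 1, inner ℝ (g (x + t • h)) h := by
        simp only [integral_smul]

theorem HasWeakGradient.eLpNorm_translate_sub_le {v : Rn n → ℝ} {g : Rn n → Rn n}
    (hvg : HasWeakGradient v g) {p : ℝ≥0∞} (hp : 1 ≤ p) (h : Rn n) :
    eLpNorm (fun x => v (x + h) - v x) p volume ≤ eLpNorm g p volume * ‖h‖ₑ := by
  refine _root_.eLpNorm_translate_sub_le hvg.locallyIntegrable_grad.aestronglyMeasurable hp h ?_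
  filter_upwards [hvg.translate_sub_ae_eq h] with x hx
  rw [hx, ← lintegral_const_mul' _ _ enorm_ne_top]
  refine (enorm_integral_le_lintegral_enorm _).trans (lintegral_mono fun t => ?_)
  rw [mul_comm]
  simp only [enorm_eq_nnnorm]
  exact_mod_cast nnnorm_inner_le_nnnorm (𝕜 := ℝ) (g (x + t • h)) h

/-- The values are vectors because this is used both for φ and for its derivative. -/
theorem eLpNorm_translate_sub_le_fderiv [CompleteSpace E] {F : Rn n → E} (hF : ContDiff ℝ 1 F)
    {p : ℝ≥0∞} (hp : 1 ≤ p) (h : Rn n) :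
    eLpNorm (fun x => F (x + h) - F x) p volume ≤ eLpNorm (fderiv ℝ F) p volume * ‖h‖ₑ := by
  have hc : Continuous (fderiv ℝ F) := hF.continuous_fderiv one_ne_zero
  refine eLpNorm_translate_sub_le hc.aestronglyMeasurable hp h
    (Filter.Eventually.of_forall fun x => ?_)
  have hd : ∀ t : ℝ, HasDerivAt (fun t : ℝ => F (x + t • h)) (fderiv ℝ F (x + t • h) h) t := by
    intro t
    have h1 : HasDerivAt (fun t : ℝ => x + t • h) h t := by
      simpa using ((hasDerivAt_id t).smul_const h).const_add x
    exact (hF.differentiable one_ne_zero (x + t • h)).hasFDerivAt.comp_hasDerivAt t h1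
  have hc' : Continuous fun t : ℝ => fderiv ℝ F (x + t • h) h :=
    (hc.comp (by fun_prop)).clm_apply continuous_const
  have h2 := intervalIntegral.integral_eq_sub_of_hasDerivAt (fun t _ => hd t)
    (hc'.intervalIntegrable 0 1)
  rw [intervalIntegral.integral_of_le zero_le_one] at h2
  simp only [one_smul, zero_smul, add_zero] at h2
  rw [← h2, ← lintegral_const_mul' _ _ enorm_ne_top]
  refine (enorm_integral_le_lintegral_enorm _).trans (lintegral_mono fun t => ?_)
  rw [mul_comm]
  simp only [enorm_eq_nnnorm]
  exact_mod_cast (fderiv ℝ F (x + t • h)).le_opNNNorm h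

end Segment

/-! ### One-dimensional Gamma integrals -/

section GammaIntegrals

open Set Filter Topology

/-- The substitution r ↦ 1/r turns this into Euler's integral. -/
theorem integral_Ioi_rpow_mul_exp_neg_div {β b : ℝ} (hβ : 0 < β) (hb : 0 < b) :
    ∫ r in Ioi (0 : ℝ), r ^ (-β - 1) * Real.exp (-(b / r)) = Real.Gamma β * b ^ (-β) := by
  have h1 := integral_comp_rpow_Ioi (fun t : ℝ => t ^ (β - 1) * Real.exp (-(b * t)))
    (p := -1) (by norm_num)
  rw [Real.integral_rpow_mul_exp_neg_mul_Ioi hβ hb] at h1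
  rw [Real.rpow_neg hb.le, ← Real.inv_rpow hb.le, mul_comm, ← one_div, ← h1]
  refine setIntegral_congr_fun measurableSet_Ioi fun r hr => ?_
  have hr0 : (0 : ℝ) < r := hr
  simp only [smul_eq_mul, abs_neg, abs_one, one_mul]
  rw [← Real.rpow_mul hr0.le, ← mul_assoc, ← Real.rpow_add hr0, Real.rpow_neg_one, div_eq_mul_inv]
  congr 2
  ring

/-- A non-integrable function has Bochner integral zero, while the value computed for this one is
positive. -/
theorem integrableOn_Ioi_rpow_mul_exp_neg_div {β b : ℝ} (hβ : 0 < β) (hb : 0 < b) :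
    IntegrableOn (fun r : ℝ => r ^ (-β - 1) * Real.exp (-(b / r))) (Ioi 0) := by
  by_contra hcon
  have h1 := integral_Ioi_rpow_mul_exp_neg_div hβ hb
  rw [integral_undef hcon] at h1
  have : 0 < Real.Gamma β * b ^ (-β) := mul_pos (Real.Gamma_pos_of_pos hβ) (Real.rpow_pos_of_pos hb _)
  exact this.ne h1

theorem integrableOn_Ioi_rpow_mul_exp_neg_mul {s a : ℝ} (hs : 0 < s) (ha : 0 < a) :
    IntegrableOn (fun r : ℝ => r ^ (s - 1) * Real.exp (-(a * r))) (Ioi 0) := by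
  by_contra hcon
  have h1 := Real.integral_rpow_mul_exp_neg_mul_Ioi hs ha
  rw [integral_undef hcon] at h1
  have : 0 < (1 / a) ^ s * Real.Gamma s :=
    mul_pos (Real.rpow_pos_of_pos (by positivity) _) (Real.Gamma_pos_of_pos hs)
  exact this.ne h1

theorem abs_exp_neg_sub_one_le {x : ℝ} (hx : 0 ≤ x) : |Real.exp (-x) - 1| ≤ min x 1 := by
  have h1 : Real.exp (-x) ≤ 1 := Real.exp_le_one_iff.2 (by linarith)
  have h2 := Real.add_one_le_exp (-x)
  have h3 := Real.exp_pos (-x)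
  rw [abs_of_nonpos (by linarith)]
  exact le_min (by linarith) (by linarith)

theorem integrableOn_Ioi_exp_sub_one_mul_rpow {σ a : ℝ} (h0 : 0 < σ) (h1 : σ < 1) (ha : 0 ≤ a) :
    IntegrableOn (fun r : ℝ => (Real.exp (-(a * r)) - 1) * r ^ (-σ - 1)) (Ioi 0) := by
  have hm : Measurable fun r : ℝ => (Real.exp (-(a * r)) - 1) * r ^ (-σ - 1) := by fun_prop
  rw [← Ioc_union_Ioi_eq_Ioi zero_le_one]
  refine IntegrableOn.union ?_ ?_
  · have hi : IntegrableOn (fun y : ℝ => a * y ^ (-σ)) (Ioc 0 1) :=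
      ((intervalIntegrable_iff_integrableOn_Ioc_of_le zero_le_one).1
        (intervalIntegral.intervalIntegrable_rpow' (by linarith))).const_mul a
    refine hi.mono' hm.aestronglyMeasurable ?_
    filter_upwards [ae_restrict_mem measurableSet_Ioc] with r hr
    rw [norm_mul, Real.norm_eq_abs, Real.norm_of_nonneg (Real.rpow_nonneg hr.1.le _)]
    calc |Real.exp (-(a * r)) - 1| * r ^ (-σ - 1) ≤ (a * r) * r ^ (-σ - 1) := by
          have := (abs_exp_neg_sub_one_le (mul_nonneg ha hr.1.le)).trans (min_le_left _ _)
          have h2 := Real.rpow_nonneg hr.1.le (-σ - 1)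
          gcongr
      _ = a * r ^ (-σ) := by
          rw [mul_assoc, Real.rpow_sub_one hr.1.ne', mul_div_cancel₀ _ hr.1.ne']
  · have hi : IntegrableOn (fun y : ℝ => y ^ (-σ - 1)) (Ioi 1) :=
      integrableOn_Ioi_rpow_of_lt (by linarith) zero_lt_one
    refine hi.mono' hm.aestronglyMeasurable ?_
    filter_upwards [ae_restrict_mem measurableSet_Ioi] with r hr
    have hr0 : (0 : ℝ) < r := zero_lt_one.trans hr
    rw [norm_mul, Real.norm_eq_abs, Real.norm_of_nonneg (Real.rpow_nonneg hr0.le _)]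
    exact mul_le_of_le_one_left (Real.rpow_nonneg hr0.le _)
      ((abs_exp_neg_sub_one_le (mul_nonneg ha hr0.le)).trans (min_le_right _ _))

/-- Integration by parts against -r^{-σ}/σ gives Γ(1-σ) = -σ Γ(-σ). The boundary terms vanish
because |e^{-ar} - 1| ≤ min(ar, 1), with σ < 1 used at the origin and σ > 0 at infinity. -/
theorem integral_Ioi_exp_sub_one_mul_rpow {σ a : ℝ} (h0 : 0 < σ) (h1 : σ < 1) (ha : 0 ≤ a) :
    ∫ r in Ioi (0 : ℝ), (Real.exp (-(a * r)) - 1) * r ^ (-σ - 1) = Real.Gamma (-σ) * a ^ σ := by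
  rcases ha.eq_or_lt with rfl | ha
  · simp [Real.zero_rpow h0.ne']
  have hu : ∀ r ∈ Ioi (0 : ℝ), HasDerivAt (fun r : ℝ => Real.exp (-(a * r)) - 1)
      (-a * Real.exp (-(a * r))) r := fun r _ => by
    have := (((hasDerivAt_id r).const_mul a).neg.exp).sub_const 1
    refine this.congr_deriv ?_
    simp; ring
  have hv : ∀ r ∈ Ioi (0 : ℝ), HasDerivAt (fun r : ℝ => -σ⁻¹ * r ^ (-σ)) (r ^ (-σ - 1)) r :=
    fun r hr => by
    have := (Real.hasDerivAt_rpow_const (p := -σ) (Or.inl (ne_of_gt (mem_Ioi.1 hr)))).const_mul (-σ⁻¹)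
    refine this.congr_deriv ?_
    field_simp
  have hbd : ∀ r ∈ Ioi (0 : ℝ), ‖(Real.exp (-(a * r)) - 1) * (-σ⁻¹ * r ^ (-σ))‖
      ≤ σ⁻¹ * (min (a * r) 1 * r ^ (-σ)) := fun r hr => by
    have hr0 : (0 : ℝ) < r := hr
    have h2 := Real.rpow_nonneg hr0.le (-σ)
    rw [norm_mul, norm_mul, norm_neg, Real.norm_of_nonneg h2, Real.norm_of_nonneg (inv_nonneg.2 h0.le),
      Real.norm_eq_abs, mul_left_comm]
    gcongr
    exact abs_exp_neg_sub_one_le (by positivity)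
  have key := integral_Ioi_mul_deriv_eq_deriv_mul hu hv (a' := 0) (b' := 0)
    (integrableOn_Ioi_exp_sub_one_mul_rpow h0 h1 ha.le) ?_ ?_ ?_
  · rw [key]
    have h2 := Real.integral_rpow_mul_exp_neg_mul_Ioi (a := 1 - σ) (by linarith) ha
    have h3 : ∀ r ∈ Ioi (0 : ℝ), -a * Real.exp (-(a * r)) * (-σ⁻¹ * r ^ (-σ))
        = (a * σ⁻¹) * (r ^ ((1 - σ) - 1) * Real.exp (-(a * r))) := fun r _ => by
      rw [show (1 - σ) - 1 = -σ by ring]; ring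
    rw [setIntegral_congr_fun measurableSet_Ioi h3, integral_const_mul, h2,
      show 1 - σ = -σ + 1 by ring, Real.Gamma_add_one (by linarith), one_div,
      Real.rpow_add (by positivity), Real.inv_rpow ha.le, Real.rpow_neg ha.le, inv_inv, Real.rpow_one]
    field_simp
    ring
  · refine IntegrableOn.congr_fun
      ((integrableOn_Ioi_rpow_mul_exp_neg_mul (s := 1 - σ) (by linarith) ha).const_mul (a * σ⁻¹))
      (fun r _ => ?_) measurableSet_Ioi
    simp only [Pi.mul_apply]
    rw [show (1 - σ) - 1 = -σ by ring]; ring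
  · have h4 : Tendsto (fun r : ℝ => σ⁻¹ * (a * r ^ (1 - σ))) (𝓝[>] 0) (𝓝 0) := by
      have : Tendsto (fun r : ℝ => r ^ (1 - σ)) (𝓝[>] 0) (𝓝 0) := by
        have := (Real.continuousAt_rpow_const 0 (1 - σ) (Or.inr (by linarith))).tendsto
        rw [Real.zero_rpow (by linarith)] at this
        exact this.mono_left nhdsWithin_le_nhds
      simpa using (this.const_mul a).const_mul σ⁻¹
    refine squeeze_zero_norm' ?_ h4
    filter_upwards [self_mem_nhdsWithin] with r hr
    refine (hbd r hr).trans ?_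
    have hr0 : (0 : ℝ) < r := hr
    have h2 := Real.rpow_nonneg hr0.le (-σ)
    calc σ⁻¹ * (min (a * r) 1 * r ^ (-σ)) ≤ σ⁻¹ * ((a * r) * r ^ (-σ)) := by
          gcongr; exact min_le_left _ _
      _ = _ := by
          rw [mul_assoc a, sub_eq_add_neg, Real.rpow_add hr0, Real.rpow_one]
  · have h4 : Tendsto (fun r : ℝ => σ⁻¹ * r ^ (-σ)) atTop (𝓝 0) := by
      simpa using (tendsto_rpow_neg_atTop h0).const_mul σ⁻¹
    refine squeeze_zero_norm' ?_ h4
    filter_upwards [eventually_gt_atTop 0] with r hr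
    refine (hbd r hr).trans ?_
    have h2 := Real.rpow_nonneg hr.le (-σ)
    gcongr
    exact mul_le_of_le_one_left h2 (min_le_right _ _)

end GammaIntegrals

/-! ### Powers of the norm as Gaussian superpositions -/

section Subordination

open Set Filter

variable {n : ℕ}

theorem ae_ne_zero_Rn (hn : 1 ≤ n) : ∀ᵐ h : Rn n, h ≠ 0 := by
  have := nontrivial_Rn hn
  simp [ae_iff]

/-- Negative powers of the norm as superpositions of Gaussians. -/
theorem Gamma_mul_integral_mul_norm_rpow (hn : 1 ≤ n) {β : ℝ} (hβ : 0 < β) {F : Rn n → ℂ}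
    (hF : AEStronglyMeasurable F volume)
    (hFi : Integrable (fun h => F h * ((‖h‖ ^ (-(2 * β)) : ℝ) : ℂ)) volume) :
    (Real.Gamma β : ℂ) * ∫ h, F h * ((‖h‖ ^ (-(2 * β)) : ℝ) : ℂ)
      = ∫ r in Ioi (0 : ℝ), ((r ^ (-β - 1) : ℝ) : ℂ) *
          ∫ h : Rn n, F h * (Real.exp (-(‖h‖ ^ 2 / r)) : ℂ) := by
  have hpow : ∀ h : Rn n, ‖h‖ ^ (-(2 * β)) = (‖h‖ ^ 2) ^ (-β) := fun h => by
    rw [← Real.rpow_natCast, ← Real.rpow_mul (norm_nonneg _)]; norm_num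
  have hprod : Integrable (fun z : Rn n × ℝ => F z.1 *
      ((z.2 ^ (-β - 1) * Real.exp (-(‖z.1‖ ^ 2 / z.2)) : ℝ) : ℂ))
      (volume.prod (volume.restrict (Ioi (0 : ℝ)))) := by
    have hm : AEStronglyMeasurable (fun z : Rn n × ℝ => F z.1 *
        ((z.2 ^ (-β - 1) * Real.exp (-(‖z.1‖ ^ 2 / z.2)) : ℝ) : ℂ))
        (volume.prod (volume.restrict (Ioi (0 : ℝ)))) := by
      refine hF.comp_fst.mul (Measurable.aestronglyMeasurable ?_)
      fun_prop
    -- Integrating the absolute value over r returns Γ(β)|F(h)||h|^{-2β}, so Fubini needs only the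
    -- integrability hypothesis on F.
    refine (integrable_prod_iff hm).2 ⟨?_, ?_⟩
    · filter_upwards [ae_ne_zero_Rn hn] with h hh
      exact ((integrableOn_Ioi_rpow_mul_exp_neg_div hβ (by positivity)).ofReal).const_mul _
    · refine (hFi.norm.const_mul (Real.Gamma β)).congr ?_
      filter_upwards [ae_ne_zero_Rn hn] with h hh
      have h1 : ∀ r ∈ Ioi (0 : ℝ), ‖F h * ((r ^ (-β - 1) * Real.exp (-(‖h‖ ^ 2 / r)) : ℝ) : ℂ)‖
          = ‖F h‖ * (r ^ (-β - 1) * Real.exp (-(‖h‖ ^ 2 / r))) := fun r hr => by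
        have := Real.rpow_nonneg (le_of_lt (mem_Ioi.1 hr)) (-β - 1)
        rw [norm_mul, Complex.norm_real, Real.norm_of_nonneg (by positivity)]
      rw [setIntegral_congr_fun measurableSet_Ioi h1, integral_const_mul,
        integral_Ioi_rpow_mul_exp_neg_div hβ (by positivity), norm_mul, Complex.norm_real, hpow,
        Real.norm_of_nonneg (by positivity)]
      ring
  calc (Real.Gamma β : ℂ) * ∫ h, F h * ((‖h‖ ^ (-(2 * β)) : ℝ) : ℂ)
      = ∫ h, ∫ r in Ioi (0 : ℝ), F h *
          ((r ^ (-β - 1) * Real.exp (-(‖h‖ ^ 2 / r)) : ℝ) : ℂ) := by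
        rw [← integral_const_mul]
        refine integral_congr_ae ?_
        filter_upwards [ae_ne_zero_Rn hn] with h hh
        rw [integral_const_mul, integral_complex_ofReal,
          integral_Ioi_rpow_mul_exp_neg_div hβ (by positivity), hpow]
        push_cast
        ring
    _ = ∫ r in Ioi (0 : ℝ), ∫ h, F h *
          ((r ^ (-β - 1) * Real.exp (-(‖h‖ ^ 2 / r)) : ℝ) : ℂ) := integral_integral_swap hprod
    _ = _ := by
        refine integral_congr_ae (Eventually.of_forall fun r => ?_)
        simp only
        rw [← integral_const_mul]
        refine integral_congr_ae (Eventually.of_forall fun h => ?_)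
        push_cast
        ring

end Subordination

/-! ### Fourier integrals of Gaussians and their first moments -/

section Gaussians

open Set Filter

variable {n : ℕ}

/-- The plane wave `h ↦ e^{2πi⟨ξ, h⟩}`. -/
def planeWave (ξ h : Rn n) : ℂ := Complex.exp (2 * Real.pi * Complex.I * (inner ℝ ξ h : ℝ))

theorem continuous_planeWave (ξ : Rn n) : Continuous (planeWave ξ) := by
  unfold planeWave; fun_prop

theorem planeWave_zero (h : Rn n) : planeWave 0 h = 1 := by simp [planeWave]

theorem norm_planeWave (ξ h : Rn n) : ‖planeWave ξ h‖ = 1 := by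
  rw [planeWave, show 2 * (Real.pi : ℂ) * Complex.I * (inner ℝ ξ h : ℝ)
    = ((2 * Real.pi * inner ℝ ξ h : ℝ) : ℂ) * Complex.I by push_cast; ring]
  exact Complex.norm_exp_ofReal_mul_I _

theorem norm_planeWave_sub_one_le (ξ h : Rn n) :
    ‖planeWave ξ h - 1‖ ≤ (2 * Real.pi * ‖ξ‖ + 2) * min ‖h‖ 1 := by
  have h1 : ‖planeWave ξ h - 1‖ ≤ 2 * Real.pi * ‖ξ‖ * ‖h‖ := by
    rw [planeWave, show 2 * (Real.pi : ℂ) * Complex.I * (inner ℝ ξ h : ℝ)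
      = Complex.I * ((2 * Real.pi * inner ℝ ξ h : ℝ) : ℂ) by push_cast; ring]
    refine Real.norm_exp_I_mul_ofReal_sub_one_le.trans ?_
    rw [norm_mul, Real.norm_of_nonneg (by positivity), mul_assoc (2 * Real.pi)]
    gcongr
    exact norm_inner_le_norm ξ h
  have h2 : ‖planeWave ξ h - 1‖ ≤ 2 := by
    refine (norm_sub_le _ _).trans ?_
    rw [norm_planeWave, norm_one]; norm_num
  have hπ := Real.pi_pos
  rcases le_total ‖h‖ 1 with hh | hh
  · rw [min_eq_left hh]
    nlinarith [norm_nonneg h, norm_nonneg ξ]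
  · rw [min_eq_right hh, mul_one]
    have : 0 ≤ 2 * Real.pi * ‖ξ‖ := by positivity
    linarith

theorem planeWave_mul_gaussian (ξ h : Rn n) (r : ℝ) :
    planeWave ξ h * (Real.exp (-(‖h‖ ^ 2 / r)) : ℂ)
      = Complex.exp (-((r⁻¹ : ℝ) : ℂ) * (‖h‖ : ℂ) ^ 2
          + 2 * Real.pi * Complex.I * (inner ℝ ξ h : ℝ)) := by
  rw [planeWave, Complex.ofReal_exp, ← Complex.exp_add]
  congr 1
  push_cast
  ring

theorem integrable_planeWave_mul_gaussian (ξ : Rn n) {r : ℝ} (hr : 0 < r) :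
    Integrable (fun h : Rn n => planeWave ξ h * (Real.exp (-(‖h‖ ^ 2 / r)) : ℂ)) volume := by
  simp_rw [planeWave_mul_gaussian]
  exact GaussianFourier.integrable_cexp_neg_mul_sq_norm_add (by simpa using hr) _ _

theorem integral_planeWave_mul_gaussian (ξ : Rn n) {r : ℝ} (hr : 0 < r) :
    ∫ h : Rn n, planeWave ξ h * (Real.exp (-(‖h‖ ^ 2 / r)) : ℂ)
      = (((Real.pi * r) ^ ((n : ℝ) / 2) * Real.exp (-(Real.pi ^ 2 * ‖ξ‖ ^ 2 * r)) : ℝ) : ℂ) := by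
  simp_rw [planeWave_mul_gaussian]
  rw [GaussianFourier.integral_cexp_neg_mul_sq_norm_add (by simpa using hr)]
  rw [Complex.ofReal_mul, Complex.ofReal_cpow (by positivity), Complex.ofReal_exp,
    finrank_euclideanSpace, Fintype.card_fin]
  have hr' : (r : ℂ) ≠ 0 := by exact_mod_cast hr.ne'
  congr 1
  · push_cast
    rw [div_inv_eq_mul]
  · congr 1
    push_cast
    rw [mul_pow, mul_pow, Complex.I_sq]
    field_simp
    ring

theorem integrable_norm_mul_gaussian {r : ℝ} (hr : 0 < r) :
    Integrable (fun h : Rn n => ‖h‖ * Real.exp (-(‖h‖ ^ 2 / r))) volume := by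
  have h1 : Integrable (fun h : Rn n => Real.exp (-(‖h‖ ^ 2 / (2 * r)))) volume := by
    have := (integrable_planeWave_mul_gaussian (0 : Rn n) (r := 2 * r) (by positivity)).norm
    refine this.congr (Eventually.of_forall fun h => ?_)
    simp only
    rw [norm_mul, norm_planeWave, one_mul, Complex.norm_real, Real.norm_of_nonneg (Real.exp_pos _).le]
  refine (h1.const_mul (1 + r)).mono' (by fun_prop) (Eventually.of_forall fun h => ?_)
  rw [Real.norm_of_nonneg (by positivity)]
  -- The Gaussian is split into two equal factors: one absorbs ‖h‖ through 1 + x ≤ e^x, the other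
  -- remains as an integrable majorant.
  have e1 : Real.exp (-(‖h‖ ^ 2 / r))
      = Real.exp (-(‖h‖ ^ 2 / (2 * r))) * Real.exp (-(‖h‖ ^ 2 / (2 * r))) := by
    rw [← Real.exp_add]; congr 1; field_simp; ring
  rw [e1, ← mul_assoc]
  gcongr
  rw [Real.exp_neg, ← div_eq_mul_inv, div_le_iff₀ (Real.exp_pos _)]
  have h2 := Real.add_one_le_exp (‖h‖ ^ 2 / (2 * r))
  have h3 : ‖h‖ ≤ (1 + r) * (‖h‖ ^ 2 / (2 * r) + 1) := by
    have : (1 + r) * (‖h‖ ^ 2 / (2 * r) + 1) - ‖h‖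
        = ((1 + r) * ‖h‖ ^ 2 + 2 * r * (1 + r) - 2 * r * ‖h‖) / (2 * r) := by field_simp
    have h4 : 0 ≤ (1 + r) * ‖h‖ ^ 2 + 2 * r * (1 + r) - 2 * r * ‖h‖ := by
      nlinarith [sq_nonneg (‖h‖ - 1), sq_nonneg ‖h‖]
    have h5 : 0 ≤ (1 + r) * (‖h‖ ^ 2 / (2 * r) + 1) - ‖h‖ := by rw [this]; positivity
    linarith
  refine h3.trans ?_
  gcongr

theorem integrable_planeWave_mul_inner_mul_gaussian (ξ e : Rn n) {r : ℝ} (hr : 0 < r) :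
    Integrable (fun h : Rn n => planeWave ξ h * (inner ℝ h e : ℝ) *
      (Real.exp (-(‖h‖ ^ 2 / r)) : ℂ)) volume := by
  refine ((integrable_norm_mul_gaussian hr).const_mul ‖e‖).mono' ?_ (Eventually.of_forall fun h => ?_)
  · have := continuous_planeWave ξ
    exact Continuous.aestronglyMeasurable (by fun_prop)
  · rw [norm_mul, norm_mul, norm_planeWave, one_mul, Complex.norm_real, Complex.norm_real,
      Real.norm_of_nonneg (Real.exp_pos _).le, ← mul_assoc, mul_comm ‖e‖]
    gcongr
    exact norm_inner_le_norm h e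

theorem hasFDerivAt_planeWave (ξ h e : Rn n) :
    DifferentiableAt ℝ (planeWave ξ) h ∧
    fderiv ℝ (planeWave ξ) h e = 2 * Real.pi * Complex.I * (inner ℝ ξ e : ℝ) * planeWave ξ h := by
  have h1 : HasFDerivAt (fun h : Rn n => ((inner ℝ ξ h : ℝ) : ℂ))
      (Complex.ofRealCLM.comp (innerSL ℝ ξ)) h :=
    Complex.ofRealCLM.hasFDerivAt.comp h (innerSL ℝ ξ).hasFDerivAt
  have h2 : HasFDerivAt (planeWave ξ) _ h := (h1.const_mul (2 * Real.pi * Complex.I)).cexp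
  refine ⟨h2.differentiableAt, ?_⟩
  rw [h2.fderiv]
  simp [planeWave]
  ring

theorem hasFDerivAt_gaussian (r : ℝ) (h e : Rn n) :
    DifferentiableAt ℝ (fun h : Rn n => (Real.exp (-(‖h‖ ^ 2 / r)) : ℂ)) h ∧
    fderiv ℝ (fun h : Rn n => (Real.exp (-(‖h‖ ^ 2 / r)) : ℂ)) h e
      = -(2 / r : ℂ) * ((inner ℝ h e : ℝ) * (Real.exp (-(‖h‖ ^ 2 / r)) : ℂ)) := by
  have h1 : HasFDerivAt (fun h : Rn n => ‖h‖ ^ 2) (2 • (innerSL ℝ h)) h :=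
    (hasStrictFDerivAt_norm_sq h).hasFDerivAt
  have h2 : HasFDerivAt (fun h : Rn n => Real.exp (-(r⁻¹ * ‖h‖ ^ 2))) _ h :=
    ((h1.const_mul r⁻¹).neg).exp
  have h3 := Complex.ofRealCLM.hasFDerivAt.comp h h2
  have h4 : (fun h : Rn n => (Real.exp (-(‖h‖ ^ 2 / r)) : ℂ))
      = Complex.ofRealCLM ∘ (fun h : Rn n => Real.exp (-(r⁻¹ * ‖h‖ ^ 2))) := by
    ext h; simp [div_eq_inv_mul]
  rw [h4]
  refine ⟨h3.differentiableAt, ?_⟩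
  rw [h3.fderiv]
  simp [div_eq_inv_mul]
  ring

/-- Differentiating the Gaussian produces the factor ⟨h,e⟩, so integration by parts reduces the
first moment to the Fourier integral of the Gaussian itself. -/
theorem integral_planeWave_mul_inner_mul_gaussian (ξ e : Rn n) {r : ℝ} (hr : 0 < r) :
    ∫ h : Rn n, planeWave ξ h * (inner ℝ h e : ℝ) * (Real.exp (-(‖h‖ ^ 2 / r)) : ℂ)
      = Real.pi * Complex.I * (inner ℝ ξ e : ℝ) *
        ((r * ((Real.pi * r) ^ ((n : ℝ) / 2) * Real.exp (-(Real.pi ^ 2 * ‖ξ‖ ^ 2 * r))) : ℝ) : ℂ) := by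
  have hr' : (r : ℂ) ≠ 0 := by exact_mod_cast hr.ne'
  have key := integral_mul_fderiv_eq_neg_fderiv_mul_of_integrable (μ := (volume : Measure (Rn n)))
    (f := planeWave ξ) (g := fun h : Rn n => (Real.exp (-(‖h‖ ^ 2 / r)) : ℂ)) (v := e) ?_ ?_
    (integrable_planeWave_mul_gaussian ξ hr) (fun x _ => (hasFDerivAt_planeWave ξ x e).1)
    (fun x _ => (hasFDerivAt_gaussian r x e).1)
  · simp only [(hasFDerivAt_planeWave ξ _ e).2, (hasFDerivAt_gaussian r _ e).2] at key
    have e1 : ∀ h : Rn n, planeWave ξ h * (-(2 / r : ℂ) * ((inner ℝ h e : ℝ) *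
        (Real.exp (-(‖h‖ ^ 2 / r)) : ℂ))) = -(2 / r : ℂ) * (planeWave ξ h * (inner ℝ h e : ℝ) *
        (Real.exp (-(‖h‖ ^ 2 / r)) : ℂ)) := fun h => by ring
    have e2 : ∀ h : Rn n, 2 * Real.pi * Complex.I * (inner ℝ ξ e : ℝ) * planeWave ξ h *
        (Real.exp (-(‖h‖ ^ 2 / r)) : ℂ) = (2 * Real.pi * Complex.I * (inner ℝ ξ e : ℝ)) *
        (planeWave ξ h * (Real.exp (-(‖h‖ ^ 2 / r)) : ℂ)) := fun h => by ring
    simp_rw [e1, e2] at key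
    rw [integral_const_mul, integral_const_mul, integral_planeWave_mul_gaussian ξ hr] at key
    rw [Complex.ofReal_mul]
    generalize (Real.pi * r) ^ ((n : ℝ) / 2) * Real.exp (-(Real.pi ^ 2 * ‖ξ‖ ^ 2 * r)) = c at key ⊢
    field_simp at key
    linear_combination (-1 : ℂ) * key
  · simp only [(hasFDerivAt_planeWave ξ _ e).2, mul_assoc]
    have := (integrable_planeWave_mul_gaussian ξ hr).const_mul
      (2 * (Real.pi * (Complex.I * ((inner ℝ ξ e : ℝ) : ℂ))))
    simpa only [mul_assoc] using this
  · simp only [(hasFDerivAt_gaussian r _ e).2]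
    refine ((integrable_planeWave_mul_inner_mul_gaussian ξ e hr).const_mul (-(2 / r : ℂ))).congr
      (Eventually.of_forall fun h => ?_)
    simp only
    ring

end Gaussians

/-! ### Fourier symbols of the two singular integrals -/

section Symbols

open Set Filter

variable {n : ℕ}

theorem integrable_of_norm_le_minKernel {E : Type*} [NormedAddCommGroup E] (hn : 1 ≤ n) {σ C : ℝ}
    (h0 : 0 < σ) (h1 : σ < 1) {F : Rn n → E} (hF : AEStronglyMeasurable F volume)
    (hle : ∀ h, ‖F h‖ ≤ C * minKernel n σ h) : Integrable F volume :=
  ((integrable_minKernel hn h0 h1).const_mul C).mono' hF (Eventually.of_forall hle)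

theorem integrable_planeWave_sub_one_mul (hn : 1 ≤ n) {s : ℝ} (h0 : 0 < s) (h1 : s < 1)
    (ξ : Rn n) :
    Integrable (fun h => (planeWave ξ h - 1) * ((‖h‖ ^ (-((n : ℝ) + s)) : ℝ) : ℂ)) volume := by
  refine integrable_of_norm_le_minKernel hn h0 h1 (C := 2 * Real.pi * ‖ξ‖ + 2) ?_ fun h => ?_
  · have := (continuous_planeWave ξ).measurable
    exact Measurable.aestronglyMeasurable (by fun_prop)
  · rw [norm_mul, Complex.norm_real, Real.norm_of_nonneg (by positivity), minKernel, ← mul_assoc]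
    gcongr
    exact norm_planeWave_sub_one_le ξ h

theorem norm_mul_norm_rpow_le (σ : ℝ) (h : Rn n) :
    ‖h‖ * ‖h‖ ^ (-((n : ℝ) + 1 + σ)) ≤ ‖h‖ ^ (-((n : ℝ) + σ)) := by
  rcases (norm_nonneg h).eq_or_lt with h0 | h0
  · rw [← h0, zero_mul]; positivity
  · nth_rw 1 [← Real.rpow_one ‖h‖]
    rw [← Real.rpow_add h0]
    apply le_of_eq; congr 1; ring

theorem abs_inner_mul_norm_rpow_le (σ : ℝ) (h e : Rn n) :
    |inner ℝ h e * ‖h‖ ^ (-((n : ℝ) + 1 + σ))| ≤ ‖e‖ * ‖h‖ ^ (-((n : ℝ) + σ)) := by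
  rw [abs_mul, abs_of_nonneg (a := ‖h‖ ^ (-((n : ℝ) + 1 + σ))) (by positivity)]
  calc |inner ℝ h e| * ‖h‖ ^ (-((n : ℝ) + 1 + σ))
      ≤ (‖h‖ * ‖e‖) * ‖h‖ ^ (-((n : ℝ) + 1 + σ)) := by gcongr; exact abs_real_inner_le_norm h e
    _ = ‖e‖ * (‖h‖ * ‖h‖ ^ (-((n : ℝ) + 1 + σ))) := by ring
    _ ≤ _ := by gcongr; exact norm_mul_norm_rpow_le σ h

theorem integrable_planeWave_sub_one_mul_inner (hn : 1 ≤ n) {α : ℝ} (h0 : 0 < α) (h1 : α < 1)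
    (ξ e : Rn n) :
    Integrable (fun h => (planeWave ξ h - 1) *
      ((inner ℝ h e * ‖h‖ ^ (-((n : ℝ) + 1 + α)) : ℝ) : ℂ)) volume := by
  refine integrable_of_norm_le_minKernel hn h0 h1 (C := (2 * Real.pi * ‖ξ‖ + 2) * ‖e‖) ?_ fun h => ?_
  · have := (continuous_planeWave ξ).measurable
    exact Measurable.aestronglyMeasurable (by fun_prop)
  · rw [norm_mul, Complex.norm_real, Real.norm_eq_abs, minKernel]
    calc _ ≤ ((2 * Real.pi * ‖ξ‖ + 2) * min ‖h‖ 1) * (‖e‖ * ‖h‖ ^ (-((n : ℝ) + α))) :=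
          mul_le_mul (norm_planeWave_sub_one_le ξ h) (abs_inner_mul_norm_rpow_le α h e)
            (abs_nonneg _) (by positivity)
      _ = _ := by ring

/-- The Fourier symbol of the fractional Laplacian. -/
theorem fracLaplacian_symbol (hn : 1 ≤ n) {s : ℝ} (h0 : 0 < s) (h1 : s < 1) (ξ : Rn n) :
    (fracLaplacianConst n s : ℂ) *
      ∫ h, (planeWave ξ h - 1) * ((‖h‖ ^ (-((n : ℝ) + s)) : ℝ) : ℂ)
      = (((2 * Real.pi * ‖ξ‖) ^ s : ℝ) : ℂ) := by
  have hn' : (0 : ℝ) < n := by exact_mod_cast hn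
  set β : ℝ := ((n : ℝ) + s) / 2 with hβ
  have hβ0 : 0 < β := by positivity
  have h2β : (n : ℝ) + s = 2 * β := by rw [hβ]; ring
  have hΓβ : Real.Gamma β ≠ 0 := (Real.Gamma_pos_of_pos hβ0).ne'
  -- The argument lies strictly between -1 and 0, hence is not a pole; this factor of the
  -- normalizing constant has to cancel.
  have hΓs : Real.Gamma (-s / 2) ≠ 0 := by
    refine Real.Gamma_ne_zero fun m => ?_
    rcases Nat.eq_zero_or_pos m with rfl | hm
    · simp [h0.ne']
    · have : (1 : ℝ) ≤ m := by exact_mod_cast hm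
      intro h; linarith
  have hF : AEStronglyMeasurable (fun h => planeWave ξ h - 1) volume :=
    ((continuous_planeWave ξ).sub continuous_const).aestronglyMeasurable
  have hint := integrable_planeWave_sub_one_mul hn h0 h1 ξ
  rw [h2β] at hint ⊢
  have key := Gamma_mul_integral_mul_norm_rpow hn hβ0 hF hint
  -- The term -1 is the plane wave of frequency zero, so the inner integral is a difference of two
  -- Gaussian transforms. Its factor r^{n/2} leaves r^{-s/2-1}.
  have hinner : ∀ r ∈ Ioi (0 : ℝ), ((r ^ (-β - 1) : ℝ) : ℂ) *
      ∫ h : Rn n, (planeWave ξ h - 1) * (Real.exp (-(‖h‖ ^ 2 / r)) : ℂ)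
      = ((Real.pi ^ ((n : ℝ) / 2) * ((Real.exp (-(Real.pi ^ 2 * ‖ξ‖ ^ 2 * r)) - 1) *
          r ^ (-(s / 2) - 1)) : ℝ) : ℂ) := by
    intro r hr
    have hr0 : (0 : ℝ) < r := hr
    have e1 : ∀ h : Rn n, (planeWave ξ h - 1) * (Real.exp (-(‖h‖ ^ 2 / r)) : ℂ)
        = planeWave ξ h * (Real.exp (-(‖h‖ ^ 2 / r)) : ℂ)
          - planeWave 0 h * (Real.exp (-(‖h‖ ^ 2 / r)) : ℂ) := fun h => by
      rw [planeWave_zero]; ring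
    simp_rw [e1]
    rw [integral_sub (integrable_planeWave_mul_gaussian ξ hr0)
      (integrable_planeWave_mul_gaussian 0 hr0), integral_planeWave_mul_gaussian ξ hr0,
      integral_planeWave_mul_gaussian 0 hr0, ← Complex.ofReal_sub, ← Complex.ofReal_mul]
    congr 1
    rw [Real.mul_rpow Real.pi_pos.le hr0.le]
    have e2 : r ^ (-(s / 2) - 1) = r ^ (-β - 1) * r ^ ((n : ℝ) / 2) := by
      rw [← Real.rpow_add hr0]; congr 1; rw [hβ]; ring
    rw [e2]
    simp
    ring
  rw [setIntegral_congr_fun measurableSet_Ioi hinner, integral_complex_ofReal, integral_const_mul,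
    integral_Ioi_exp_sub_one_mul_rpow (by positivity) (by linarith) (by positivity)] at key
  have hΓβ' : (Real.Gamma β : ℂ) ≠ 0 := by exact_mod_cast hΓβ
  rw [mul_comm, ← eq_div_iff hΓβ'] at key
  rw [key, ← Complex.ofReal_div, ← Complex.ofReal_mul]
  congr 1
  have e3 : (Real.pi ^ 2 * ‖ξ‖ ^ 2) ^ (s / 2) = (Real.pi * ‖ξ‖) ^ s := by
    rw [← mul_pow, ← Real.rpow_natCast, ← Real.rpow_mul (by positivity)]
    congr 1; push_cast; ring
  rw [e3, fracLaplacianConst, mul_assoc 2, Real.mul_rpow (x := 2) zero_le_two (by positivity),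
    ← hβ, show -(n : ℝ) / 2 = -((n : ℝ) / 2) by ring, Real.rpow_neg Real.pi_pos.le,
    show -s / 2 = -(s / 2) by ring]
  rw [show -s / 2 = -(s / 2) by ring] at hΓs
  have : Real.pi ^ ((n : ℝ) / 2) ≠ 0 := by positivity
  field_simp

/-- The Fourier symbol of the Riesz fractional gradient. -/
theorem rieszGradient_symbol (hn : 1 ≤ n) {α : ℝ} (h0 : 0 < α) (h1 : α < 1) (ξ e : Rn n) :
    (rieszGradientConst n α : ℂ) *
      ∫ h, (planeWave ξ h - 1) * ((inner ℝ h e * ‖h‖ ^ (-((n : ℝ) + 1 + α)) : ℝ) : ℂ)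
      = 2 * Real.pi * Complex.I * (inner ℝ ξ e : ℝ) * (((2 * Real.pi * ‖ξ‖) ^ (α - 1) : ℝ) : ℂ) := by
  -- At ξ = 0 both sides vanish; the Gamma integral used otherwise needs a positive decay rate.
  rcases eq_or_ne ξ 0 with rfl | hξ
  · simp [planeWave_zero]
  have hξ0 : 0 < ‖ξ‖ := norm_pos_iff.2 hξ
  have hn' : (0 : ℝ) < n := by exact_mod_cast hn
  set β : ℝ := ((n : ℝ) + α + 1) / 2 with hβ
  have hβ0 : 0 < β := by positivity
  have h2β : (n : ℝ) + 1 + α = 2 * β := by rw [hβ]; ring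
  have hΓβ : Real.Gamma β ≠ 0 := (Real.Gamma_pos_of_pos hβ0).ne'
  have hΓs : Real.Gamma ((1 - α) / 2) ≠ 0 := (Real.Gamma_pos_of_pos (by linarith)).ne'
  have hF : AEStronglyMeasurable (fun h : Rn n => (planeWave ξ h - 1) * ((inner ℝ h e : ℝ) : ℂ))
      volume := by
    have := continuous_planeWave ξ
    exact Continuous.aestronglyMeasurable (by fun_prop)
  have hint := integrable_planeWave_sub_one_mul_inner hn h0 h1 ξ e
  rw [h2β] at hint ⊢
  simp_rw [Complex.ofReal_mul, ← mul_assoc] at hint ⊢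
  have key := Gamma_mul_integral_mul_norm_rpow hn hβ0 hF hint
  have hinner : ∀ r ∈ Ioi (0 : ℝ), ((r ^ (-β - 1) : ℝ) : ℂ) *
      ∫ h : Rn n, (planeWave ξ h - 1) * ((inner ℝ h e : ℝ) : ℂ) * (Real.exp (-(‖h‖ ^ 2 / r)) : ℂ)
      = Real.pi * Complex.I * (inner ℝ ξ e : ℝ) * ((Real.pi ^ ((n : ℝ) / 2) *
        (r ^ ((1 - α) / 2 - 1) * Real.exp (-(Real.pi ^ 2 * ‖ξ‖ ^ 2 * r))) : ℝ) : ℂ) := by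
    intro r hr
    have hr0 : (0 : ℝ) < r := hr
    have e1 : ∀ h : Rn n, (planeWave ξ h - 1) * ((inner ℝ h e : ℝ) : ℂ) *
        (Real.exp (-(‖h‖ ^ 2 / r)) : ℂ)
        = planeWave ξ h * ((inner ℝ h e : ℝ) : ℂ) * (Real.exp (-(‖h‖ ^ 2 / r)) : ℂ)
          - planeWave 0 h * ((inner ℝ h e : ℝ) : ℂ) * (Real.exp (-(‖h‖ ^ 2 / r)) : ℂ) := fun h => by
      rw [planeWave_zero]; ring
    simp_rw [e1]
    rw [integral_sub (integrable_planeWave_mul_inner_mul_gaussian ξ e hr0)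
      (integrable_planeWave_mul_inner_mul_gaussian 0 e hr0),
      integral_planeWave_mul_inner_mul_gaussian ξ e hr0,
      integral_planeWave_mul_inner_mul_gaussian 0 e hr0, inner_zero_left, Complex.ofReal_zero,
      mul_zero, zero_mul, sub_zero, mul_left_comm, ← Complex.ofReal_mul]
    congr 2
    rw [Real.mul_rpow Real.pi_pos.le hr0.le]
    have e2 : r ^ ((1 - α) / 2 - 1) = r ^ (-β - 1) * (r * r ^ ((n : ℝ) / 2)) := by
      nth_rw 3 [← Real.rpow_one r]
      rw [← Real.rpow_add hr0, ← Real.rpow_add hr0]; congr 1; rw [hβ]; ring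
    rw [e2]
    ring
  rw [setIntegral_congr_fun measurableSet_Ioi hinner, integral_const_mul, integral_complex_ofReal,
    integral_const_mul, Real.integral_rpow_mul_exp_neg_mul_Ioi (by linarith) (by positivity)] at key
  have hΓβ' : (Real.Gamma β : ℂ) ≠ 0 := by exact_mod_cast hΓβ
  rw [mul_comm, ← eq_div_iff hΓβ'] at key
  have e3 : (1 / (Real.pi ^ 2 * ‖ξ‖ ^ 2)) ^ ((1 - α) / 2) = (Real.pi * ‖ξ‖) ^ (α - 1) := by
    rw [one_div, Real.inv_rpow (by positivity), ← Real.rpow_neg (by positivity), ← mul_pow,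
      ← Real.rpow_natCast, ← Real.rpow_mul (by positivity)]
    congr 1; push_cast; ring
  have e4 : rieszGradientConst n α * (Real.pi ^ ((n : ℝ) / 2) *
      ((1 / (Real.pi ^ 2 * ‖ξ‖ ^ 2)) ^ ((1 - α) / 2) * Real.Gamma ((1 - α) / 2))) / Real.Gamma β
      = 2 * (2 * Real.pi * ‖ξ‖) ^ (α - 1) := by
    rw [e3, rieszGradientConst, mul_assoc 2 Real.pi, Real.mul_rpow (x := 2) zero_le_two (by positivity),
      ← hβ, show -(n : ℝ) / 2 = -((n : ℝ) / 2) by ring, Real.rpow_neg Real.pi_pos.le,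
      Real.rpow_sub_one two_ne_zero]
    have : Real.pi ^ ((n : ℝ) / 2) ≠ 0 := by positivity
    field_simp
  have e5 := congrArg (fun x : ℝ => (x : ℂ)) e4
  simp only [Complex.ofReal_div, Complex.ofReal_mul, Complex.ofReal_ofNat] at e5
  rw [key]
  simp only [Complex.ofReal_mul]
  linear_combination (Real.pi * Complex.I * ((inner ℝ ξ e : ℝ) : ℂ)) * e5

end Symbols

/-! ### Fourier transforms of difference integrals -/

section FourierOfDifferences

open Set Filter

variable {n : ℕ}

open FourierTransform SchwartzMap in
/-- Injectivity of the Fourier transform on integrable functions. -/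
theorem ae_eq_zero_of_integral_planeWave_mul_eq_zero {f : Rn n → ℂ} (hf : Integrable f volume)
    (h : ∀ ξ, ∫ x, planeWave (-ξ) x * f x = 0) : ∀ᵐ x, f x = 0 := by
  have hF : ∀ ξ, 𝓕 f ξ = 0 := fun ξ => by
    rw [Real.fourier_eq', ← h ξ]
    refine integral_congr_ae (Eventually.of_forall fun x => ?_)
    simp only [planeWave, smul_eq_mul, inner_neg_left, real_inner_comm]
    congr 2
    push_cast
    ring
  refine ae_eq_zero_of_integral_contDiff_smul_eq_zero hf.locallyIntegrable fun g hg hgc => ?_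
  have hGs : HasCompactSupport (fun x => (g x : ℂ)) := hgc.comp_left (g := fun r : ℝ => (r : ℂ)) rfl
  have hGc : ContDiff ℝ ∞ (fun x => (g x : ℂ)) := Complex.ofRealCLM.contDiff.comp hg
  -- With H a Schwartz function whose transform is g, the multiplication formula gives ∫ f g = ∫ f̂
  -- H = 0.
  set G : 𝓢(Rn n, ℂ) := hGs.toSchwartzMap hGc with hG
  set H : 𝓢(Rn n, ℂ) := 𝓕⁻ G with hH
  have h1 : ∀ x, 𝓕 (H : Rn n → ℂ) x = (g x : ℂ) := fun x => by
    rw [← SchwartzMap.fourier_coe, hH, FourierTransform.fourier_fourierInv_eq]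
    rfl
  have h2 := VectorFourier.integral_fourierIntegral_smul_eq_flip (L := innerₗ (Rn n))
    (μ := volume) (ν := volume) (f := f) (g := (H : Rn n → ℂ)) Real.continuous_fourierChar
    continuous_inner hf H.integrable
  have h3 : ∀ x, VectorFourier.fourierIntegral Real.fourierChar volume (innerₗ (Rn n)) f x = 0 := hF
  have h4 : ∀ x, VectorFourier.fourierIntegral Real.fourierChar volume (innerₗ (Rn n)).flip
      (H : Rn n → ℂ) x = g x := by
    rw [flip_innerₗ]; exact h1
  simp only [h3, h4, smul_eq_mul, zero_mul, integral_zero] at h2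
  rw [h2]
  refine integral_congr_ae (Eventually.of_forall fun x => ?_)
  simp [mul_comm]

/-- Tonelli reduces integrability on the product to finiteness of the weighted `diffEnergy`. The
weight is constant in the Fourier argument and is the paired function in the symmetry argument. -/
theorem integrable_of_norm_le_diff {E F : Type*} [NormedAddCommGroup E] [NormedAddCommGroup F]
    {σ C : ℝ} {f : Rn n → E} {w : Rn n → ℝ} {G : Rn n × Rn n → F}
    (hG : AEStronglyMeasurable G (volume.prod volume))
    (hw : ∫⁻ x, ‖w x‖ₑ * diffEnergy σ f x ≠ ⊤)
    (hle : ∀ x h, ‖G (x, h)‖ ≤ C * (‖w x‖ * (‖f (x + h) - f x‖ * ‖h‖ ^ (-((n : ℝ) + σ))))) :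
    Integrable G (volume.prod volume) := by
  refine ⟨hG, ?_⟩
  rw [hasFiniteIntegral_iff_enorm, lintegral_prod _ hG.enorm]
  have hle' : ∀ x h, ‖G (x, h)‖ₑ ≤ ENNReal.ofReal C * (‖w x‖ₑ * (‖f (x + h) - f x‖ₑ *
      ENNReal.ofReal (‖h‖ ^ (-((n : ℝ) + σ))))) := fun x h => by
    have h1 := hle x h
    rw [← ofReal_norm, ← ofReal_norm (w x), ← ofReal_norm (f (x + h) - f x),
      ← ENNReal.ofReal_mul (norm_nonneg _), ← ENNReal.ofReal_mul (norm_nonneg _),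
      ← ENNReal.ofReal_mul' (by positivity)]
    exact ENNReal.ofReal_le_ofReal h1
  calc ∫⁻ x, ∫⁻ h, ‖G (x, h)‖ₑ
      ≤ ∫⁻ x, ∫⁻ h, ENNReal.ofReal C * (‖w x‖ₑ * (‖f (x + h) - f x‖ₑ *
        ENNReal.ofReal (‖h‖ ^ (-((n : ℝ) + σ))))) :=
        lintegral_mono fun x => lintegral_mono fun h => hle' x h
    _ = ENNReal.ofReal C * ∫⁻ x, ‖w x‖ₑ * diffEnergy σ f x := by
        rw [← lintegral_const_mul' _ _ ENNReal.ofReal_ne_top]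
        refine lintegral_congr fun x => ?_
        rw [lintegral_const_mul' _ _ ENNReal.ofReal_ne_top, lintegral_const_mul' _ _ enorm_ne_top,
          diffEnergy]
    _ < ⊤ := ENNReal.mul_lt_top ENNReal.ofReal_lt_top hw.lt_top

theorem planeWave_add (ξ x h : Rn n) : planeWave ξ (x + h) = planeWave ξ x * planeWave ξ h := by
  simp only [planeWave, inner_add_right]
  rw [← Complex.exp_add]
  congr 1
  push_cast
  ring

theorem planeWave_neg_neg (ξ h : Rn n) : planeWave (-ξ) (-h) = planeWave ξ h := by
  simp [planeWave]

theorem integrable_planeWave_mul {f : Rn n → ℂ} (hf : Integrable f volume) (ξ : Rn n) :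
    Integrable (fun x => planeWave ξ x * f x) volume :=
  hf.bdd_mul (c := 1) (continuous_planeWave ξ).aestronglyMeasurable
    (Eventually.of_forall fun x => (norm_planeWave ξ x).le)

theorem integral_planeWave_mul_translate {f : Rn n → ℂ} (ξ h : Rn n) :
    ∫ x, planeWave (-ξ) x * f (x + h) = planeWave ξ h * ∫ x, planeWave (-ξ) x * f x := by
  rw [← integral_const_mul,
    ← integral_add_right_eq_self (μ := volume) (fun x => planeWave ξ h * (planeWave (-ξ) x * f x)) h]
  refine integral_congr_ae (Eventually.of_forall fun x => ?_)
  simp only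
  rw [planeWave_add, ← planeWave_neg_neg ξ h]
  have : planeWave (-ξ) (-h) * planeWave (-ξ) h = 1 := by
    rw [← planeWave_add]; simp [planeWave]
  linear_combination (-(planeWave (-ξ) x * f (x + h))) * this

theorem integrable_diff_mul_kernel {σ C : ℝ} {f : Rn n → ℝ} {k : Rn n → ℝ}
    (hf : AEStronglyMeasurable f volume) (hE : ∫⁻ x, diffEnergy σ f x ≠ ⊤) (hk : Measurable k)
    (hkC : ∀ h, |k h| ≤ C * ‖h‖ ^ (-((n : ℝ) + σ))) :
    Integrable (fun z : Rn n × Rn n => (f (z.1 + z.2) - f z.1) * k z.2)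
      (volume.prod volume) := by
  refine integrable_of_norm_le_diff (σ := σ) (C := C) (f := f) (w := fun _ => 1) ?_
    (by simpa using hE) fun x h => ?_
  · exact (aestronglyMeasurable_translate_sub hf).mul
      (hk.comp measurable_snd).aestronglyMeasurable
  · rw [norm_mul, norm_one, one_mul, mul_left_comm]
    gcongr
    exact hkC h

/-- The Fourier transform of `x ↦ ∫ (f(x+h) - f(x)) k(h) dh`. -/
theorem integral_planeWave_mul_integral_diff {σ C : ℝ} {f : Rn n → ℝ} {k : Rn n → ℝ}
    (hf : Integrable f volume) (hE : ∫⁻ x, diffEnergy σ f x ≠ ⊤) (hk : Measurable k)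
    (hkC : ∀ h, |k h| ≤ C * ‖h‖ ^ (-((n : ℝ) + σ))) (ξ : Rn n) :
    ∫ x, planeWave (-ξ) x * ((∫ h, (f (x + h) - f x) * k h : ℝ) : ℂ)
      = (∫ h, (planeWave ξ h - 1) * (k h : ℂ)) * ∫ x, planeWave (-ξ) x * (f x : ℂ) := by
  have hint := (integrable_diff_mul_kernel hf.aestronglyMeasurable hE hk hkC).ofReal (𝕜 := ℂ)
  have hint2 : Integrable (fun z : Rn n × Rn n => planeWave (-ξ) z.1 *
      (((f (z.1 + z.2) - f z.1) * k z.2 : ℝ) : ℂ)) (volume.prod volume) :=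
    hint.bdd_mul (c := 1) ((continuous_planeWave _).comp continuous_fst).aestronglyMeasurable
      (Eventually.of_forall fun z => (norm_planeWave _ _).le)
  calc ∫ x, planeWave (-ξ) x * ((∫ h, (f (x + h) - f x) * k h : ℝ) : ℂ)
      = ∫ x, ∫ h, planeWave (-ξ) x * (((f (x + h) - f x) * k h : ℝ) : ℂ) := by
        refine integral_congr_ae (Eventually.of_forall fun x => ?_)
        simp only
        rw [integral_const_mul, integral_complex_ofReal]
    _ = ∫ h, ∫ x, planeWave (-ξ) x * (((f (x + h) - f x) * k h : ℝ) : ℂ) :=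
        integral_integral_swap hint2
    _ = ∫ h, ((planeWave ξ h - 1) * (k h : ℂ)) * ∫ x, planeWave (-ξ) x * (f x : ℂ) := by
        refine integral_congr_ae (Eventually.of_forall fun h => ?_)
        simp only
        have h1 : Integrable (fun x => planeWave (-ξ) x * (f (x + h) : ℂ)) volume :=
          integrable_planeWave_mul ((hf.comp_add_right h).ofReal) _
        have h2 : Integrable (fun x => planeWave (-ξ) x * (f x : ℂ)) volume :=
          integrable_planeWave_mul hf.ofReal _
        have h3 : ∀ x, planeWave (-ξ) x * (((f (x + h) - f x) * k h : ℝ) : ℂ)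
            = (k h : ℂ) * (planeWave (-ξ) x * (f (x + h) : ℂ) - planeWave (-ξ) x * (f x : ℂ)) :=
          fun x => by push_cast; ring
        simp_rw [h3]
        rw [integral_const_mul, integral_sub h1 h2,
          integral_planeWave_mul_translate (f := fun x => (f x : ℂ))]
        ring
    _ = _ := integral_mul_const _ _

theorem integral_planeWave_mul_fderiv {φ : Rn n → ℝ} (hφ : IsTestFunction φ) (ξ e : Rn n) :
    ∫ x, planeWave (-ξ) x * ((fderiv ℝ φ x e : ℝ) : ℂ)
      = 2 * Real.pi * Complex.I * (inner ℝ ξ e : ℝ) * ∫ x, planeWave (-ξ) x * (φ x : ℂ) := by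
  have hd : ∀ x, HasFDerivAt (fun x => (φ x : ℂ)) (Complex.ofRealCLM.comp (fderiv ℝ φ x)) x :=
    fun x => Complex.ofRealCLM.hasFDerivAt.comp x (hφ.differentiable x).hasFDerivAt
  have hd' : ∀ x, fderiv ℝ (fun x => (φ x : ℂ)) x e = ((fderiv ℝ φ x e : ℝ) : ℂ) := fun x => by
    rw [(hd x).fderiv]; simp
  have hφi : Integrable (fun x => (φ x : ℂ)) volume :=
    ((memLp_one_iff_integrable.1 (hφ.memLp 1))).ofReal
  have key := integral_mul_fderiv_eq_neg_fderiv_mul_of_integrable (μ := (volume : Measure (Rn n)))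
    (f := planeWave (-ξ)) (g := fun x => (φ x : ℂ)) (v := e) ?_ ?_
    (integrable_planeWave_mul hφi _) (fun x _ => (hasFDerivAt_planeWave _ x e).1)
    (fun x _ => (hd x).differentiableAt)
  · simp only [(hasFDerivAt_planeWave _ _ e).2, hd'] at key
    rw [key, ← integral_neg, ← integral_const_mul]
    refine integral_congr_ae (Eventually.of_forall fun x => ?_)
    simp only [inner_neg_left]
    push_cast
    ring
  · simp only [(hasFDerivAt_planeWave _ _ e).2, mul_assoc]
    have := (integrable_planeWave_mul hφi (-ξ)).const_mul
      (2 * (Real.pi * (Complex.I * ((inner ℝ (-ξ) e : ℝ) : ℂ))))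
    simpa only [mul_assoc] using this
  · simp only [hd']
    exact integrable_planeWave_mul
      ((memLp_one_iff_integrable.1 ((hφ.fderiv_apply e).memLp 1))).ofReal _

end FourierOfDifferences

/-! ### The Riesz fractional gradient of test functions -/

section RieszGradient

open Set Filter

variable {n : ℕ} {φ : Rn n → ℝ}

theorem eLpNorm_translate_sub_le_two_mul {E : Type*} [NormedAddCommGroup E] {f : Rn n → E}
    (hf : AEStronglyMeasurable f volume) {p : ℝ≥0∞} (hp : 1 ≤ p) (h : Rn n) :
    eLpNorm (fun x => f (x + h) - f x) p volume ≤ 2 * eLpNorm f p volume := by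
  have hfh : AEStronglyMeasurable (fun x => f (x + h)) volume :=
    hf.comp_measurePreserving (measurePreserving_add_right volume h)
  refine (eLpNorm_sub_le hfh hf hp).trans ?_
  rw [eLpNorm_comp_add_right hf, two_mul]

theorem eLpNorm_diffEnergy_le_of_eLpNorm_le (hn : 1 ≤ n) {E : Type*} [NormedAddCommGroup E] {σ : ℝ}
    (hσ0 : 0 < σ) (hσ1 : σ < 1) {f : Rn n → E} (hf : AEStronglyMeasurable f volume) {p : ℝ≥0∞}
    (hp : 1 ≤ p) {A B : ℝ} (hA : 0 ≤ A) (hB : 0 ≤ B)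
    (h1 : ∀ h, eLpNorm (fun x => f (x + h) - f x) p volume ≤ ENNReal.ofReal A * ‖h‖ₑ)
    (h2 : eLpNorm f p volume ≤ ENNReal.ofReal B) :
    eLpNorm (diffEnergy σ f) p volume
      ≤ ENNReal.ofReal (minKernelIntegral n σ * (A ^ σ * (2 * B) ^ (1 - σ))) := by
  refine eLpNorm_diffEnergy_le hn hσ0 hσ1 hf hp hA (by positivity) h1 fun h => ?_
  refine (eLpNorm_translate_sub_le_two_mul hf hp h).trans ?_
  rw [ENNReal.ofReal_mul zero_le_two, ENNReal.ofReal_ofNat]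
  gcongr

theorem IsTestFunction.exists_abs_sub_le (hφ : IsTestFunction φ) :
    ∃ C, 0 ≤ C ∧ ∀ x h, |φ (x + h) - φ x| ≤ C * min ‖h‖ 1 := by
  obtain ⟨L, hL⟩ := (hφ.compactSupport.fderiv ℝ).exists_bound_of_continuous
    hφ.contDiff_fderiv.continuous
  obtain ⟨M, hM⟩ := hφ.compactSupport.exists_bound_of_continuous hφ.continuous
  have hL0 : 0 ≤ L := (norm_nonneg _).trans (hL 0)
  have hM0 : 0 ≤ M := (norm_nonneg _).trans (hM 0)
  refine ⟨L + 2 * M, by positivity, fun x h => ?_⟩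
  have h1 : |φ (x + h) - φ x| ≤ L * ‖h‖ := by
    have := convex_univ.norm_image_sub_le_of_norm_fderiv_le (𝕜 := ℝ) (f := φ) (C := L)
      (fun x _ => hφ.differentiable x) (fun x _ => hL x) (mem_univ x) (mem_univ (x + h))
    simpa using this
  have h2 : |φ (x + h) - φ x| ≤ 2 * M := by
    refine (abs_sub _ _).trans ?_
    have h3 := hM (x + h)
    have h4 := hM x
    rw [Real.norm_eq_abs] at h3 h4
    linarith
  rcases le_total ‖h‖ 1 with hh | hh
  · rw [min_eq_left hh]
    nlinarith [norm_nonneg h]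
  · rw [min_eq_right hh, mul_one]
    linarith

theorem rieszGradient_eq_integral (α : ℝ) (φ : Rn n → ℝ) (x : Rn n) :
    rieszGradient α φ x = rieszGradientConst n α •
      ∫ h, ((φ (x + h) - φ x) * ‖h‖ ^ (-((n : ℝ) + 1 + α))) • h := by
  rw [rieszGradient, ← integral_add_left_eq_self (μ := volume) _ x]
  congr 1
  refine integral_congr_ae (Eventually.of_forall fun h => ?_)
  simp only [add_sub_cancel_left, smul_smul]
  rcases eq_or_ne h 0 with rfl | hh
  · simp
  have h0 : 0 < ‖h‖ := norm_pos_iff.2 hh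
  congr 1
  rw [div_eq_mul_inv, ← Real.rpow_neg h0.le, ← Real.rpow_neg_one ‖h‖, mul_assoc, ← Real.rpow_add h0]
  congr 2
  ring

theorem norm_smul_rieszKernel_le (α d : ℝ) (h : Rn n) :
    ‖(d * ‖h‖ ^ (-((n : ℝ) + 1 + α))) • h‖ ≤ |d| * ‖h‖ ^ (-((n : ℝ) + α)) := by
  rw [norm_smul, norm_mul, Real.norm_eq_abs, Real.norm_of_nonneg (by positivity), mul_assoc]
  gcongr
  rw [mul_comm]
  exact norm_mul_norm_rpow_le α h

theorem enorm_rieszGradient_le (α : ℝ) (φ : Rn n → ℝ) (x : Rn n) :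
    ‖rieszGradient α φ x‖ₑ ≤ ‖rieszGradientConst n α‖ₑ * diffEnergy α φ x := by
  rw [rieszGradient_eq_integral, enorm_smul]
  gcongr
  refine (enorm_integral_le_lintegral_enorm _).trans (lintegral_mono fun h => ?_)
  rw [← ofReal_norm, ← ofReal_norm, ← ENNReal.ofReal_mul (norm_nonneg _)]
  exact ENNReal.ofReal_le_ofReal (norm_smul_rieszKernel_le α _ h)

theorem IsTestFunction.integrable_rieszGradient_integrand (hφ : IsTestFunction φ) (hn : 1 ≤ n)
    {α : ℝ} (h0 : 0 < α) (h1 : α < 1) (x : Rn n) :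
    Integrable (fun h => ((φ (x + h) - φ x) * ‖h‖ ^ (-((n : ℝ) + 1 + α))) • h) volume := by
  obtain ⟨C, hC0, hC⟩ := hφ.exists_abs_sub_le
  refine integrable_of_norm_le_minKernel hn h0 h1 (C := C) ?_ fun h => ?_
  · have := hφ.continuous.measurable
    exact Measurable.aestronglyMeasurable (by fun_prop)
  · refine (norm_smul_rieszKernel_le α _ h).trans ?_
    rw [minKernel, ← mul_assoc]
    gcongr
    exact hC x h

theorem IsTestFunction.inner_rieszGradient (hφ : IsTestFunction φ) (hn : 1 ≤ n)
    {α : ℝ} (h0 : 0 < α) (h1 : α < 1) (x e : Rn n) :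
    inner ℝ (rieszGradient α φ x) e = rieszGradientConst n α *
      ∫ h, (φ (x + h) - φ x) * (inner ℝ h e * ‖h‖ ^ (-((n : ℝ) + 1 + α))) := by
  rw [rieszGradient_eq_integral, real_inner_smul_left, real_inner_comm,
    ← integral_inner (hφ.integrable_rieszGradient_integrand hn h0 h1 x)]
  congr 1
  refine integral_congr_ae (Eventually.of_forall fun h => ?_)
  simp only [real_inner_smul_right, real_inner_comm]
  ring

theorem IsTestFunction.aestronglyMeasurable_rieszGradient (hφ : IsTestFunction φ) (α : ℝ) :
    AEStronglyMeasurable (rieszGradient α φ) volume := by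
  have h1 : AEStronglyMeasurable (fun z : Rn n × Rn n =>
      ((φ (z.1 + z.2) - φ z.1) * ‖z.2‖ ^ (-((n : ℝ) + 1 + α))) • z.2) (volume.prod volume) := by
    have := hφ.continuous.measurable
    exact Measurable.aestronglyMeasurable (by fun_prop)
  refine (h1.integral_prod_right'.const_smul (rieszGradientConst n α)).congr ?_
  exact Eventually.of_forall fun x => (rieszGradient_eq_integral α φ x).symm

theorem IsTestFunction.eLpNorm_fderiv_lt_top (hφ : IsTestFunction φ) (p : ℝ≥0∞) :
    eLpNorm (fderiv ℝ φ) p volume < ⊤ :=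
  (hφ.contDiff_fderiv.continuous.memLp_of_hasCompactSupport (hφ.compactSupport.fderiv ℝ)).2

/-- Pointwise, the fractional gradient is dominated by `diffEnergy`. The hypotheses are increment
bounds with free constants so that, for φ(·+a) - φ, both constants can be taken proportional to ‖a‖.
-/
theorem eLpNorm_rieszGradient_le (hn : 1 ≤ n) {α : ℝ} (h0 : 0 < α) (h1 : α < 1) {p : ℝ≥0∞}
    (hp : 1 ≤ p) (hφ : AEStronglyMeasurable φ volume) {A B : ℝ} (hA : 0 ≤ A) (hB : 0 ≤ B)
    (hφ1 : ∀ h, eLpNorm (fun x => φ (x + h) - φ x) p volume ≤ ENNReal.ofReal A * ‖h‖ₑ)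
    (hφ2 : eLpNorm φ p volume ≤ ENNReal.ofReal B) :
    eLpNorm (rieszGradient α φ) p volume
      ≤ ENNReal.ofReal (|rieszGradientConst n α| *
        (minKernelIntegral n α * (A ^ α * (2 * B) ^ (1 - α)))) := by
  have h2 := eLpNorm_le_nnreal_smul_eLpNorm_of_ae_le_mul' (p := p) (μ := volume)
    (c := ‖rieszGradientConst n α‖₊) (f := rieszGradient α φ) (g := diffEnergy α φ)
    (Eventually.of_forall fun x => by
      simpa only [enorm_eq_self, enorm_eq_nnnorm] using enorm_rieszGradient_le α φ x)
  refine h2.trans ?_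
  rw [ENNReal.smul_def, smul_eq_mul, ENNReal.ofReal_mul (abs_nonneg _), ← Real.norm_eq_abs,
    ofReal_norm, enorm_eq_nnnorm]
  gcongr
  exact eLpNorm_diffEnergy_le_of_eLpNorm_le hn h0 h1 hφ hp hA hB hφ1 hφ2

theorem IsTestFunction.memLp_rieszGradient (hφ : IsTestFunction φ) (hn : 1 ≤ n)
    {α : ℝ} (h0 : 0 < α) (h1 : α < 1) {p : ℝ≥0∞} (hp : 1 ≤ p) :
    MemLp (rieszGradient α φ) p volume := by
  refine ⟨hφ.aestronglyMeasurable_rieszGradient α, ?_⟩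
  refine (eLpNorm_rieszGradient_le hn h0 h1 hp hφ.continuous.aestronglyMeasurable
    (A := (eLpNorm (fderiv ℝ φ) p volume).toReal) (B := (eLpNorm φ p volume).toReal)
    ENNReal.toReal_nonneg ENNReal.toReal_nonneg (fun h => ?_) ?_).trans_lt ENNReal.ofReal_lt_top
  · rw [ENNReal.ofReal_toReal (hφ.eLpNorm_fderiv_lt_top p).ne]
    exact eLpNorm_translate_sub_le_fderiv (hφ.smooth.of_le (by simp)) hp h
  · rw [ENNReal.ofReal_toReal (hφ.memLp p).2.ne]

theorem IsTestFunction.rieszGradient_translate_sub (hφ : IsTestFunction φ) (hn : 1 ≤ n)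
    {α : ℝ} (h0 : 0 < α) (h1 : α < 1) (x a : Rn n) :
    rieszGradient α φ (x + a) - rieszGradient α φ x
      = rieszGradient α (fun x => φ (x + a) - φ x) x := by
  rw [rieszGradient_eq_integral, rieszGradient_eq_integral, rieszGradient_eq_integral, ← smul_sub,
    ← integral_sub (hφ.integrable_rieszGradient_integrand hn h0 h1 _)
      (hφ.integrable_rieszGradient_integrand hn h0 h1 _)]
  congr 1
  refine integral_congr_ae (Eventually.of_forall fun h => ?_)
  simp only
  rw [← sub_smul, ← sub_mul, add_right_comm x a h]
  congr 2
  ring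

/-- The operator commutes with translations, so the increment is the fractional gradient of φ(·+a) -
φ. That function is of size M1‖a‖ and has Lipschitz constant M2‖a‖ in L^p; the interpolation bound
is homogeneous and returns ‖a‖^α ‖a‖^{1-α} = ‖a‖. -/
theorem IsTestFunction.exists_eLpNorm_rieszGradient_translate_sub_le (hφ : IsTestFunction φ)
    (hn : 1 ≤ n) {α : ℝ} (h0 : 0 < α) (h1 : α < 1) {p : ℝ≥0∞} (hp : 1 ≤ p) :
    ∃ M : ℝ, 0 ≤ M ∧ ∀ a, eLpNorm (fun x => rieszGradient α φ (x + a) - rieszGradient α φ x) p volume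
      ≤ ENNReal.ofReal M * ‖a‖ₑ := by
  have hD1 := hφ.eLpNorm_fderiv_lt_top p
  have hD2 : eLpNorm (fderiv ℝ (fderiv ℝ φ)) p volume < ⊤ :=
    ((hφ.contDiff_fderiv.continuous_fderiv (by simp)).memLp_of_hasCompactSupport
      ((hφ.compactSupport.fderiv ℝ).fderiv ℝ)).2
  set M1 := (eLpNorm (fderiv ℝ φ) p volume).toReal with hM1
  set M2 := (eLpNorm (fderiv ℝ (fderiv ℝ φ)) p volume).toReal with hM2
  have hM10 : 0 ≤ M1 := ENNReal.toReal_nonneg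
  have hM20 : 0 ≤ M2 := ENNReal.toReal_nonneg
  have hK := minKernelIntegral_nonneg n α
  refine ⟨|rieszGradientConst n α| * (minKernelIntegral n α * (M2 ^ α * (2 * M1) ^ (1 - α))),
    by positivity, fun a => ?_⟩
  simp_rw [hφ.rieszGradient_translate_sub hn h0 h1]
  have hχ : IsTestFunction fun x => φ (x + a) - φ x := (hφ.comp_add_right a).sub hφ
  have hχd : fderiv ℝ (fun x => φ (x + a) - φ x) = fun x => fderiv ℝ φ (x + a) - fderiv ℝ φ x := by
    ext1 x
    rw [fderiv_fun_sub ((hφ.comp_add_right a).differentiable x) (hφ.differentiable x),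
      fderiv_comp_add_right]
  have ha : ENNReal.ofReal ‖a‖ = ‖a‖ₑ := ofReal_norm a
  have key := eLpNorm_rieszGradient_le hn h0 h1 hp hχ.continuous.aestronglyMeasurable
    (A := M2 * ‖a‖) (B := M1 * ‖a‖) (by positivity) (by positivity) (fun h => ?_) ?_
  · refine key.trans (le_of_eq ?_)
    rw [← ha, ← ENNReal.ofReal_mul (by positivity)]
    congr 1
    rw [Real.mul_rpow hM20 (norm_nonneg _), ← mul_assoc 2, Real.mul_rpow (by positivity) (norm_nonneg _)]
    rcases (norm_nonneg a).eq_or_lt with h | h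
    · rw [← h]; simp [Real.zero_rpow h0.ne']
    · have : ‖a‖ ^ α * ‖a‖ ^ (1 - α) = ‖a‖ := by rw [← Real.rpow_add h]; simp
      linear_combination (|rieszGradientConst n α| * minKernelIntegral n α * M2 ^ α *
        (2 * M1) ^ (1 - α)) * this
  · refine (eLpNorm_translate_sub_le_fderiv (hχ.smooth.of_le (by simp)) hp h).trans ?_
    gcongr
    rw [hχd, ENNReal.ofReal_mul hM20, hM2, ENNReal.ofReal_toReal hD2.ne, ha]
    exact eLpNorm_translate_sub_le_fderiv (hφ.contDiff_fderiv.of_le (by simp)) hp a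
  · rw [ENNReal.ofReal_mul hM10, hM1, ENNReal.ofReal_toReal hD1.ne, ha]
    exact eLpNorm_translate_sub_le_fderiv (hφ.smooth.of_le (by simp)) hp a

theorem fracLaplacianKernel_eq (s : ℝ) (v : Rn n → ℝ) (x h : Rn n) :
    fracLaplacianKernel s v x h = (v (x + h) - v x) * ‖h‖ ^ (-((n : ℝ) + s)) := by
  rw [fracLaplacianKernel, div_eq_mul_inv, Real.rpow_neg (norm_nonneg _)]

theorem IsTestFunction.lintegral_diffEnergy_ne_top (hφ : IsTestFunction φ) (hn : 1 ≤ n)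
    {σ : ℝ} (h0 : 0 < σ) (h1 : σ < 1) : ∫⁻ x, diffEnergy σ φ x ≠ ⊤ := by
  have := eLpNorm_diffEnergy_le_of_eLpNorm_le hn h0 h1 hφ.continuous.aestronglyMeasurable le_rfl
    (A := (eLpNorm (fderiv ℝ φ) 1 volume).toReal) (B := (eLpNorm φ 1 volume).toReal)
    ENNReal.toReal_nonneg ENNReal.toReal_nonneg (fun h => by
      rw [ENNReal.ofReal_toReal (hφ.eLpNorm_fderiv_lt_top 1).ne]
      exact eLpNorm_translate_sub_le_fderiv (hφ.smooth.of_le (by simp)) le_rfl h)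
    (by rw [ENNReal.ofReal_toReal (hφ.memLp 1).2.ne])
  rw [eLpNorm_one_eq_lintegral_enorm] at this
  simpa using (this.trans_lt ENNReal.ofReal_lt_top).ne

/-- The components of ∇^α φ lie in L^p and have Lipschitz increments there, which is all the energy
bound requires. This allows a second singular operator to be applied to them. -/
theorem IsTestFunction.eLpNorm_diffEnergy_inner_rieszGradient_lt_top (hφ : IsTestFunction φ)
    (hn : 1 ≤ n) {α σ : ℝ} (hα0 : 0 < α) (hα1 : α < 1) (hσ0 : 0 < σ) (hσ1 : σ < 1) {p : ℝ≥0∞}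
    (hp : 1 ≤ p) (e : Rn n) :
    eLpNorm (diffEnergy σ fun x => inner ℝ (rieszGradient α φ x) e) p volume < ⊤ := by
  obtain ⟨M, hM0, hM⟩ := hφ.exists_eLpNorm_rieszGradient_translate_sub_le hn hα0 hα1 hp
  have hmem : MemLp (fun x => inner ℝ (rieszGradient α φ x) e) p volume :=
    (hφ.memLp_rieszGradient hn hα0 hα1 hp).inner_const e
  refine (eLpNorm_diffEnergy_le_of_eLpNorm_le hn hσ0 hσ1 hmem.1 hp (A := ‖e‖ * M)
    (B := (eLpNorm (fun x => inner ℝ (rieszGradient α φ x) e) p volume).toReal) (by positivity)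
    ENNReal.toReal_nonneg (fun h => ?_) ?_).trans_lt ENNReal.ofReal_lt_top
  · rw [ENNReal.ofReal_mul (norm_nonneg _), mul_assoc, ofReal_norm]
    have h2 := eLpNorm_le_nnreal_smul_eLpNorm_of_ae_le_mul (p := p) (μ := volume) (c := ‖e‖₊)
      (f := fun x => inner ℝ (rieszGradient α φ (x + h)) e - inner ℝ (rieszGradient α φ x) e)
      (g := fun x => rieszGradient α φ (x + h) - rieszGradient α φ x)
      (Eventually.of_forall fun x => by
        rw [← inner_sub_left, mul_comm]
        exact nnnorm_inner_le_nnnorm _ _)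
    refine h2.trans ?_
    rw [ENNReal.smul_def, smul_eq_mul, ← enorm_eq_nnnorm]
    gcongr
    exact hM h
  · rw [ENNReal.ofReal_toReal hmem.2.ne]

/-- `(-Δ)^{(1-α)/2} ∇^α φ = ∇φ`. -/
theorem IsTestFunction.fracLaplacian_rieszGradient_ae_eq (hφ : IsTestFunction φ) (hn : 1 ≤ n)
    {α : ℝ} (h0 : 0 < α) (h1 : α < 1) (e : Rn n) :
    ∀ᵐ x, fracLaplacian (1 - α) (fun x => inner ℝ (rieszGradient α φ x) e) x = fderiv ℝ φ x e := by
  set ψ : Rn n → ℝ := fun x => inner ℝ (rieszGradient α φ x) e with hψ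
  have hψi : Integrable ψ volume :=
    memLp_one_iff_integrable.1 ((hφ.memLp_rieszGradient hn h0 h1 le_rfl).inner_const e)
  have hψE : ∫⁻ x, diffEnergy (1 - α) ψ x ≠ ⊤ := by
    have := hφ.eLpNorm_diffEnergy_inner_rieszGradient_lt_top hn h0 h1 (σ := 1 - α) (by linarith)
      (by linarith) le_rfl e
    rw [eLpNorm_one_eq_lintegral_enorm] at this
    simpa using this.ne
  have hφi : Integrable φ volume := memLp_one_iff_integrable.1 (hφ.memLp 1)
  set k : Rn n → ℝ := fun h => ‖h‖ ^ (-((n : ℝ) + (1 - α))) with hk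
  have hkm : Measurable k := measurable_norm_rpow n _
  have hkC : ∀ h, |k h| ≤ 1 * ‖h‖ ^ (-((n : ℝ) + (1 - α))) := fun h => by
    rw [one_mul, abs_of_nonneg (by positivity)]
  set κ : Rn n → ℝ := fun h => inner ℝ h e * ‖h‖ ^ (-((n : ℝ) + 1 + α)) with hκ
  have hκm : Measurable κ := by fun_prop
  have hκC : ∀ h, |κ h| ≤ ‖e‖ * ‖h‖ ^ (-((n : ℝ) + α)) := fun h => abs_inner_mul_norm_rpow_le α h e
  have hlap : ∀ x, fracLaplacian (1 - α) ψ x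
      = fracLaplacianConst n (1 - α) * ∫ h, (ψ (x + h) - ψ x) * k h := fun x => by
    rw [fracLaplacian]; simp_rw [fracLaplacianKernel_eq]; rfl
  have hψeq : ∀ x, ψ x = rieszGradientConst n α * ∫ h, (φ (x + h) - φ x) * κ h :=
    fun x => hφ.inner_rieszGradient hn h0 h1 x e
  have hlapi : Integrable (fun x => ((fracLaplacian (1 - α) ψ x : ℝ) : ℂ)) volume := by
    simp_rw [hlap]
    exact ((integrable_diff_mul_kernel hψi.aestronglyMeasurable hψE hkm hkC).integral_prod_left.const_mul
      _).ofReal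
  have hgi : Integrable (fun x => ((fderiv ℝ φ x e : ℝ) : ℂ)) volume :=
    (memLp_one_iff_integrable.1 ((hφ.fderiv_apply e).memLp 1)).ofReal
  -- Both sides are integrable, so it is enough to compare Fourier transforms, that is, to multiply
  -- the two symbols.
  have key := ae_eq_zero_of_integral_planeWave_mul_eq_zero (hlapi.sub hgi) fun ξ => ?_
  · filter_upwards [key] with x hx
    have : ((fracLaplacian (1 - α) ψ x - fderiv ℝ φ x e : ℝ) : ℂ) = 0 := by
      push_cast; exact hx
    exact sub_eq_zero.1 (by exact_mod_cast this)
  · simp only [Pi.sub_apply, mul_sub]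
    rw [integral_sub (integrable_planeWave_mul hlapi _) (integrable_planeWave_mul hgi _),
      integral_planeWave_mul_fderiv hφ, sub_eq_zero]
    have e1 : ∫ x, planeWave (-ξ) x * ((fracLaplacian (1 - α) ψ x : ℝ) : ℂ)
        = (((2 * Real.pi * ‖ξ‖) ^ (1 - α) : ℝ) : ℂ) * ∫ x, planeWave (-ξ) x * (ψ x : ℂ) := by
      rw [← fracLaplacian_symbol hn (by linarith) (by linarith), mul_assoc,
        ← integral_planeWave_mul_integral_diff hψi hψE hkm hkC, ← integral_const_mul]
      refine integral_congr_ae (Eventually.of_forall fun x => ?_)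
      simp only [hlap x]
      push_cast
      ring
    have e2 : ∫ x, planeWave (-ξ) x * (ψ x : ℂ)
        = 2 * Real.pi * Complex.I * (inner ℝ ξ e : ℝ) * (((2 * Real.pi * ‖ξ‖) ^ (α - 1) : ℝ) : ℂ) *
          ∫ x, planeWave (-ξ) x * (φ x : ℂ) := by
      rw [← rieszGradient_symbol hn h0 h1, mul_assoc,
        ← integral_planeWave_mul_integral_diff hφi (hφ.lintegral_diffEnergy_ne_top hn h0 h1) hκm hκC,
        ← integral_const_mul]
      refine integral_congr_ae (Eventually.of_forall fun x => ?_)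
      simp only [hψeq x]
      push_cast
      ring
    rw [e1, e2]
    -- The powers of ‖ξ‖ cancel only for ξ ≠ 0; at the origin both sides carry the factor ⟨ξ,e⟩ = 0.
    rcases eq_or_ne ξ 0 with rfl | hξ
    · simp
    have hξ0 : 0 < ‖ξ‖ := norm_pos_iff.2 hξ
    have e3 : (2 * Real.pi * ‖ξ‖) ^ (1 - α) * (2 * Real.pi * ‖ξ‖) ^ (α - 1) = 1 := by
      rw [← Real.rpow_add (by positivity)]; simp
    have e4 : (((2 * Real.pi * ‖ξ‖) ^ (1 - α) : ℝ) : ℂ) * (((2 * Real.pi * ‖ξ‖) ^ (α - 1) : ℝ) : ℂ)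
        = 1 := by exact_mod_cast e3
    linear_combination (2 * Real.pi * Complex.I * ((inner ℝ ξ e : ℝ) : ℂ) *
      ∫ x, planeWave (-ξ) x * (φ x : ℂ)) * e4

end RieszGradient

/-! ### The fractional gradient as a Riesz potential of the gradient -/

section RieszPotential

open Set Filter Topology

variable {n : ℕ} {φ : Rn n → ℝ}

theorem hasFDerivAt_regularized_rpow {ε : ℝ} (hε : 0 < ε) (m : ℝ) (h e : Rn n) :
    DifferentiableAt ℝ (fun h : Rn n => (‖h‖ ^ 2 + ε ^ 2) ^ (-m / 2)) h ∧
    fderiv ℝ (fun h : Rn n => (‖h‖ ^ 2 + ε ^ 2) ^ (-m / 2)) h e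
      = -m * (inner ℝ h e * (‖h‖ ^ 2 + ε ^ 2) ^ (-m / 2 - 1)) := by
  have h1 : HasFDerivAt (fun h : Rn n => ‖h‖ ^ 2 + ε ^ 2) (2 • (innerSL ℝ h)) h :=
    (hasStrictFDerivAt_norm_sq h).hasFDerivAt.add_const _
  have h2 := h1.rpow_const (p := -m / 2) (Or.inl (by positivity))
  refine ⟨h2.differentiableAt, ?_⟩
  rw [h2.fderiv]
  simp
  ring

theorem integrable_inner_mul_regularized_rpow {ε p : ℝ} (hε : 0 < ε) (hε1 : ε ≤ 1)
    (hp : (n : ℝ) < p) (e : Rn n) :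
    Integrable (fun h : Rn n => inner ℝ h e * (‖h‖ ^ 2 + ε ^ 2) ^ (-p / 2 - 1 / 2)) volume := by
  have h1 : Integrable (fun h : Rn n => ((1 : ℝ) + ‖h‖ ^ 2) ^ (-p / 2)) volume :=
    integrable_rpow_neg_one_add_norm_sq (by simpa using hp)
  have hp0 : 0 < p := (Nat.cast_nonneg n).trans_lt hp
  refine (h1.const_mul (‖e‖ * (ε ^ 2) ^ (-p / 2))).mono' ?_ (Eventually.of_forall fun h => ?_)
  · exact Measurable.aestronglyMeasurable (by fun_prop)
  · have hb : 0 < ‖h‖ ^ 2 + ε ^ 2 := by positivity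
    rw [norm_mul, Real.norm_of_nonneg (Real.rpow_nonneg hb.le _)]
    have e1 : (‖h‖ ^ 2 + ε ^ 2) ^ (-p / 2 - 1 / 2)
        = (‖h‖ ^ 2 + ε ^ 2) ^ (-p / 2) * (Real.sqrt (‖h‖ ^ 2 + ε ^ 2))⁻¹ := by
      rw [Real.rpow_sub hb, Real.sqrt_eq_rpow, div_eq_mul_inv]
    have e2 : ‖h‖ * (Real.sqrt (‖h‖ ^ 2 + ε ^ 2))⁻¹ ≤ 1 := by
      rw [← div_eq_mul_inv, div_le_one (Real.sqrt_pos.2 hb)]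
      exact Real.le_sqrt_of_sq_le (by nlinarith [sq_nonneg ε])
    -- Since ε ≤ 1, one has ‖h‖² + ε² ≥ ε²(1 + ‖h‖²); the bound may depend on ε because only
    -- integrability is claimed.
    have e3 : (‖h‖ ^ 2 + ε ^ 2) ^ (-p / 2) ≤ (ε ^ 2 * (1 + ‖h‖ ^ 2)) ^ (-p / 2) := by
      refine Real.rpow_le_rpow_of_nonpos (by positivity) ?_ (by linarith)
      have : ε ^ 2 ≤ 1 := by nlinarith
      nlinarith [sq_nonneg ‖h‖]
    rw [Real.mul_rpow (by positivity) (by positivity)] at e3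
    have e4 : ‖(inner ℝ h e : ℝ)‖ ≤ ‖h‖ * ‖e‖ := norm_inner_le_norm h e
    calc ‖(inner ℝ h e : ℝ)‖ * (‖h‖ ^ 2 + ε ^ 2) ^ (-p / 2 - 1 / 2)
        ≤ (‖h‖ * ‖e‖) * (‖h‖ ^ 2 + ε ^ 2) ^ (-p / 2 - 1 / 2) := by gcongr
      _ = ‖e‖ * (‖h‖ ^ 2 + ε ^ 2) ^ (-p / 2) * (‖h‖ * (Real.sqrt (‖h‖ ^ 2 + ε ^ 2))⁻¹) := by
          rw [e1]; ring
      _ ≤ ‖e‖ * ((ε ^ 2) ^ (-p / 2) * (1 + ‖h‖ ^ 2) ^ (-p / 2)) * 1 := by gcongr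
      _ = _ := by ring

theorem integrable_norm_rpow_mul (hn : 1 ≤ n) {m : ℝ} (hm : m < n) {f : Rn n → ℝ}
    (hf : Continuous f) (hfc : HasCompactSupport f) :
    Integrable (fun h : Rn n => ‖h‖ ^ (-m) * f h) volume := by
  have h1 : LocallyIntegrable (fun h : Rn n => ‖h‖ ^ (-m)) volume := by
    refine locallyIntegrable_of_norm_le_rpow (by simp; omega) (C := 1) (α := m) (by simpa using hm)
      (Eventually.of_forall fun h => ?_) (measurable_norm_rpow n _).aestronglyMeasurable
    rw [one_mul, Real.norm_of_nonneg (by positivity)]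
  exact h1.integrable_smul_right_of_hasCompactSupport hf hfc

theorem regularized_rpow_le {ε p : ℝ} (hp : p ≤ 0) {h : Rn n} (hh : h ≠ 0) :
    (‖h‖ ^ 2 + ε ^ 2) ^ (p / 2) ≤ ‖h‖ ^ p := by
  have h0 : 0 < ‖h‖ := norm_pos_iff.2 hh
  calc (‖h‖ ^ 2 + ε ^ 2) ^ (p / 2) ≤ (‖h‖ ^ 2) ^ (p / 2) :=
        Real.rpow_le_rpow_of_nonpos (by positivity) (by nlinarith [sq_nonneg ε]) (by linarith)
    _ = ‖h‖ ^ p := by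
        rw [← Real.rpow_natCast, ← Real.rpow_mul h0.le]; congr 1; push_cast; ring

theorem tendsto_regularized_rpow (p : ℝ) {h : Rn n} (hh : h ≠ 0) :
    Tendsto (fun ε : ℝ => (‖h‖ ^ 2 + ε ^ 2) ^ (p / 2)) (𝓝[>] 0) (𝓝 (‖h‖ ^ p)) := by
  have h0 : 0 < ‖h‖ := norm_pos_iff.2 hh
  have h1 : ContinuousAt (fun ε : ℝ => (‖h‖ ^ 2 + ε ^ 2) ^ (p / 2)) 0 :=
    ContinuousAt.rpow_const (by fun_prop) (Or.inl (by positivity))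
  have h2 := h1.tendsto.mono_left (nhdsWithin_le_nhds (s := Ioi (0 : ℝ)))
  have e1 : (‖h‖ ^ 2 + (0 : ℝ) ^ 2) ^ (p / 2) = ‖h‖ ^ p := by
    rw [zero_pow two_ne_zero, add_zero, ← Real.rpow_natCast, ← Real.rpow_mul h0.le]
    congr 1; push_cast; ring
  rwa [e1] at h2

/-- Smoothing the kernel at the origin makes integration by parts legitimate. The differentiated
kernel is odd and integrable, so φ(y) can be subtracted at no cost; that subtraction is what
survives the limit ε → 0. -/
theorem IsTestFunction.integral_regularized_mul_fderiv (hφ : IsTestFunction φ) {α : ℝ}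
    (h0 : 0 < α) {ε : ℝ} (hε : 0 < ε) (hε1 : ε ≤ 1) (y e : Rn n) :
    ∫ h : Rn n, (‖h‖ ^ 2 + ε ^ 2) ^ (-((n : ℝ) + α - 1) / 2) * fderiv ℝ φ (y + h) e
      = ((n : ℝ) + α - 1) * ∫ h : Rn n, inner ℝ h e *
        (‖h‖ ^ 2 + ε ^ 2) ^ (-((n : ℝ) + 1 + α) / 2) * (φ (y + h) - φ y) := by
  set m : ℝ := (n : ℝ) + α - 1 with hm
  have hexp : -m / 2 - 1 = -((n : ℝ) + 1 + α) / 2 := by rw [hm]; ring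
  have hψ : IsTestFunction fun h => φ (y + h) := by
    simpa [add_comm] using hφ.comp_add_right y
  have hψd : ∀ h, fderiv ℝ (fun h => φ (y + h)) h = fderiv ℝ φ (y + h) :=
    fun h => fderiv_comp_add_left y
  have hKc : Continuous fun h : Rn n => (‖h‖ ^ 2 + ε ^ 2) ^ (-m / 2) :=
    Continuous.rpow_const (by fun_prop) fun h => Or.inl (by positivity)
  have hK'c : Continuous fun h : Rn n => (‖h‖ ^ 2 + ε ^ 2) ^ (-((n : ℝ) + 1 + α) / 2) :=
    Continuous.rpow_const (by fun_prop) fun h => Or.inl (by positivity)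
  have hgi : Integrable (fun h : Rn n => inner ℝ h e *
      (‖h‖ ^ 2 + ε ^ 2) ^ (-((n : ℝ) + 1 + α) / 2)) volume := by
    have := integrable_inner_mul_regularized_rpow (n := n) hε hε1 (p := (n : ℝ) + α) (by linarith) e
    rwa [show -((n : ℝ) + α) / 2 - 1 / 2 = -((n : ℝ) + 1 + α) / 2 by ring] at this
  have hodd : ∫ h : Rn n, inner ℝ h e * (‖h‖ ^ 2 + ε ^ 2) ^ (-((n : ℝ) + 1 + α) / 2) = 0 := by
    have := integral_neg_eq_self (fun h : Rn n => inner ℝ h e *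
      (‖h‖ ^ 2 + ε ^ 2) ^ (-((n : ℝ) + 1 + α) / 2)) volume
    simp only [inner_neg_left, norm_neg, neg_mul, integral_neg] at this
    linarith
  have hgf : Integrable (fun h : Rn n => inner ℝ h e *
      (‖h‖ ^ 2 + ε ^ 2) ^ (-((n : ℝ) + 1 + α) / 2) * φ (y + h)) volume :=
    (Continuous.integrable_of_hasCompactSupport
      (((by fun_prop : Continuous fun h : Rn n => (inner ℝ h e : ℝ)).mul hK'c).mul hψ.continuous)
      hψ.compactSupport.mul_left)
  have key := integral_mul_fderiv_eq_neg_fderiv_mul_of_integrable (μ := (volume : Measure (Rn n)))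
    (f := fun h : Rn n => (‖h‖ ^ 2 + ε ^ 2) ^ (-m / 2)) (g := fun h => φ (y + h)) (v := e) ?_ ?_ ?_
    (fun x _ => (hasFDerivAt_regularized_rpow hε m x e).1) (fun x _ => hψ.differentiable x)
  · simp only [(hasFDerivAt_regularized_rpow hε m _ e).2, hψd, hexp] at key
    rw [key]
    have e1 : ∀ h : Rn n, inner ℝ h e * (‖h‖ ^ 2 + ε ^ 2) ^ (-((n : ℝ) + 1 + α) / 2) *
        (φ (y + h) - φ y) = inner ℝ h e * (‖h‖ ^ 2 + ε ^ 2) ^ (-((n : ℝ) + 1 + α) / 2) * φ (y + h)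
        - inner ℝ h e * (‖h‖ ^ 2 + ε ^ 2) ^ (-((n : ℝ) + 1 + α) / 2) * φ y := fun h => by ring
    simp_rw [e1]
    rw [integral_sub hgf (hgi.mul_const _), integral_mul_const (φ y), hodd, zero_mul, sub_zero,
      ← integral_neg, ← integral_const_mul]
    refine integral_congr_ae (Eventually.of_forall fun h => ?_)
    simp only
    ring
  · simp only [(hasFDerivAt_regularized_rpow hε m _ e).2, hexp]
    refine (hgf.const_mul (-m)).congr (Eventually.of_forall fun h => ?_)
    simp only
    ring
  · exact Continuous.integrable_of_hasCompactSupport (hKc.mul (hψ.fderiv_apply e).continuous)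
      (hψ.fderiv_apply e).compactSupport.mul_left
  · exact Continuous.integrable_of_hasCompactSupport (hKc.mul hψ.continuous)
      hψ.compactSupport.mul_left

/-- The Riesz fractional gradient as the Riesz potential of the gradient. -/
theorem IsTestFunction.inner_rieszGradient_eq_potential (hφ : IsTestFunction φ) (hn : 1 ≤ n)
    {α : ℝ} (h0 : 0 < α) (h1 : α < 1) (y e : Rn n) :
    inner ℝ (rieszGradient α φ y) e = rieszGradientConst n α / ((n : ℝ) + α - 1) *
      ∫ h, ‖h‖ ^ (-((n : ℝ) + α - 1)) * fderiv ℝ φ (y + h) e := by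
  have hn' : (1 : ℝ) ≤ n := by exact_mod_cast hn
  set m : ℝ := (n : ℝ) + α - 1 with hm
  -- Since n ≥ 1, m ≥ α > 0, so dimension one needs no separate logarithmic kernel.
  have hm0 : 0 < m := by rw [hm]; linarith
  have hψ : IsTestFunction fun h => fderiv ℝ φ (y + h) e := by
    simpa [add_comm] using (hφ.fderiv_apply e).comp_add_right y
  obtain ⟨C, hC0, hC⟩ := hφ.exists_abs_sub_le
  -- The regularized kernel stays below its value at ε = 0, and |h|^{-m} is locally integrable
  -- because m < n.
  have hL : Tendsto (fun ε : ℝ => ∫ h : Rn n, (‖h‖ ^ 2 + ε ^ 2) ^ (-m / 2) *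
      fderiv ℝ φ (y + h) e) (𝓝[>] 0) (𝓝 (∫ h, ‖h‖ ^ (-m) * fderiv ℝ φ (y + h) e)) := by
    refine tendsto_integral_filter_of_dominated_convergence
      (fun h => ‖‖h‖ ^ (-m) * fderiv ℝ φ (y + h) e‖) ?_ ?_
      (integrable_norm_rpow_mul hn (by rw [hm]; linarith) hψ.continuous hψ.compactSupport).norm ?_
    · refine Eventually.of_forall fun ε => ?_
      have := hψ.continuous.measurable
      exact Measurable.aestronglyMeasurable (by fun_prop)
    · refine Eventually.of_forall fun ε => ?_
      filter_upwards [ae_ne_zero_Rn hn] with h hh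
      have e1 : 0 ≤ (‖h‖ ^ 2 + ε ^ 2) ^ (-m / 2) := by positivity
      have e2 : 0 ≤ ‖h‖ ^ (-m) := by positivity
      rw [norm_mul, norm_mul, Real.norm_of_nonneg e1, Real.norm_of_nonneg e2]
      gcongr
      exact regularized_rpow_le (by linarith) hh
    · filter_upwards [ae_ne_zero_Rn hn] with h hh
      exact (tendsto_regularized_rpow _ hh).mul_const _
  -- Here the limiting kernel is not integrable near the origin; the increment of φ supplies the
  -- factor min(‖h‖, 1) that makes `minKernel` a majorant.
  have hR : Tendsto (fun ε : ℝ => ∫ h : Rn n, inner ℝ h e *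
      (‖h‖ ^ 2 + ε ^ 2) ^ (-((n : ℝ) + 1 + α) / 2) * (φ (y + h) - φ y)) (𝓝[>] 0)
      (𝓝 (∫ h : Rn n, inner ℝ h e * ‖h‖ ^ (-((n : ℝ) + 1 + α)) * (φ (y + h) - φ y))) := by
    refine tendsto_integral_filter_of_dominated_convergence
      (fun h => (‖e‖ * C) * minKernel n α h) ?_ ?_ ((integrable_minKernel hn h0 h1).const_mul _) ?_
    · refine Eventually.of_forall fun ε => ?_
      have := hφ.continuous.measurable
      exact Measurable.aestronglyMeasurable (by fun_prop)
    · refine Eventually.of_forall fun ε => ?_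
      filter_upwards [ae_ne_zero_Rn hn] with h hh
      have e1 : 0 ≤ (‖h‖ ^ 2 + ε ^ 2) ^ (-((n : ℝ) + 1 + α) / 2) := by positivity
      calc ‖inner ℝ h e * (‖h‖ ^ 2 + ε ^ 2) ^ (-((n : ℝ) + 1 + α) / 2) * (φ (y + h) - φ y)‖
          = |inner ℝ h e| * (‖h‖ ^ 2 + ε ^ 2) ^ (-((n : ℝ) + 1 + α) / 2) * |φ (y + h) - φ y| := by
            rw [norm_mul, norm_mul, Real.norm_of_nonneg e1]
            rfl
        _ ≤ |inner ℝ h e| * ‖h‖ ^ (-((n : ℝ) + 1 + α)) * (C * min ‖h‖ 1) := by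
            gcongr
            · exact regularized_rpow_le (by linarith) hh
            · exact hC y h
        _ = |inner ℝ h e * ‖h‖ ^ (-((n : ℝ) + 1 + α))| * (C * min ‖h‖ 1) := by
            rw [abs_mul, abs_of_nonneg (a := ‖h‖ ^ (-((n : ℝ) + 1 + α))) (by positivity)]
        _ ≤ (‖e‖ * ‖h‖ ^ (-((n : ℝ) + α))) * (C * min ‖h‖ 1) := by
            gcongr
            exact abs_inner_mul_norm_rpow_le α h e
        _ = _ := by rw [minKernel]; ring
    · filter_upwards [ae_ne_zero_Rn hn] with h hh
      exact ((tendsto_regularized_rpow _ hh).const_mul _).mul_const _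
  have hlim := hR.const_mul m
  have heq : (fun ε : ℝ => ∫ h : Rn n, (‖h‖ ^ 2 + ε ^ 2) ^ (-m / 2) * fderiv ℝ φ (y + h) e)
      =ᶠ[𝓝[>] 0] fun ε : ℝ => m * ∫ h : Rn n, inner ℝ h e *
      (‖h‖ ^ 2 + ε ^ 2) ^ (-((n : ℝ) + 1 + α) / 2) * (φ (y + h) - φ y) := by
    filter_upwards [Ioc_mem_nhdsGT zero_lt_one] with ε hε
    exact hφ.integral_regularized_mul_fderiv h0 hε.1 hε.2 y e
  have huniq := tendsto_nhds_unique (hL.congr' heq) hlim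
  rw [huniq, hφ.inner_rieszGradient hn h0 h1, div_mul_eq_mul_div, eq_div_iff hm0.ne', mul_assoc,
    mul_comm _ m]
  congr 2
  refine integral_congr_ae (Eventually.of_forall fun h => ?_)
  simp only
  ring

end RieszPotential

/-! ### The normalized potential of an L^p function on balls -/

section LocalPotential

open Set Filter Topology

variable {n : ℕ}

theorem abs_rpow_neg_sub_rpow_neg_le {m t a b : ℝ} (hm : 0 < m) (ht : 0 < t) (ha : t ≤ a)
    (hb : t ≤ b) : |a ^ (-m) - b ^ (-m)| ≤ m * t ^ (-m - 1) * |a - b| := by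
  have := (convex_Ici t).norm_image_sub_le_of_norm_deriv_le (f := fun x : ℝ => x ^ (-m))
    (C := m * t ^ (-m - 1)) (x := b) (y := a) (fun x hx => ?_) (fun x hx => ?_) hb ha
  · simpa using this
  · exact Real.differentiableAt_rpow_const_of_ne _ (ht.trans_le hx).ne'
  · have hx0 : 0 < x := ht.trans_le hx
    have e1 : 0 ≤ x ^ (-m - 1) := by positivity
    rw [Real.deriv_rpow_const, norm_mul, norm_neg, Real.norm_of_nonneg hm.le, Real.norm_of_nonneg e1]
    exact mul_le_mul_of_nonneg_left (Real.rpow_le_rpow_of_nonpos ht hx (by linarith)) hm.le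

/-- The normalized Riesz kernel `|x - y|^{-m} - |y|^{-m} 1_{|y| > 1}`. -/
def normalizedRieszKernel (m : ℝ) (x y : Rn n) : ℝ :=
  ‖x - y‖ ^ (-m) - if 1 < ‖y‖ then ‖y‖ ^ (-m) else 0

theorem measurable_normalizedRieszKernel (m : ℝ) :
    Measurable fun z : Rn n × Rn n => normalizedRieszKernel m z.1 z.2 := by
  unfold normalizedRieszKernel
  refine Measurable.sub (by fun_prop) (Measurable.ite ?_ (by fun_prop) measurable_const)
  exact measurableSet_lt measurable_const (by fun_prop)

/-- For ‖y‖ ≥ 2R the mean value theorem applied to t^{-m} gains one power of decay from the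
cancellation. For ‖y‖ < 2R the singularity is kept inside ‖x - y‖ < 3R, and the subtracted term is
at most 1. The two summands of the constant serve these two regimes. -/
theorem abs_normalizedRieszKernel_le {m R : ℝ} (hm : 0 < m) (hR : 1 ≤ R) :
    ∃ C, 0 ≤ C ∧ ∀ x y : Rn n, ‖x‖ ≤ R → |normalizedRieszKernel m x y|
      ≤ (if ‖x - y‖ < 3 * R then ‖x - y‖ ^ (-m) else 0) + C * (1 + ‖y‖) ^ (-(m + 1)) := by
  refine ⟨(1 + 2 * R) ^ (m + 1) + m * 2 ^ (m + 1) * R * 2 ^ (m + 1), by positivity,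
    fun x y hx => ?_⟩
  have hw : 0 < 1 + ‖y‖ := by positivity
  have hite : 0 ≤ if ‖x - y‖ < 3 * R then ‖x - y‖ ^ (-m) else 0 := by split_ifs <;> positivity
  rcases lt_or_ge ‖y‖ (2 * R) with hy | hy
  · have h1 : ‖x - y‖ < 3 * R := (norm_sub_le x y).trans_lt (by linarith)
    have h2 : 0 ≤ (if 1 < ‖y‖ then ‖y‖ ^ (-m) else 0) := by split_ifs <;> positivity
    have h3 : (if 1 < ‖y‖ then ‖y‖ ^ (-m) else 0) ≤ 1 := by
      split_ifs with h
      · exact Real.rpow_le_one_of_one_le_of_nonpos h.le (by linarith)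
      · exact zero_le_one
    have h4 : 1 ≤ (1 + 2 * R) ^ (m + 1) * (1 + ‖y‖) ^ (-(m + 1)) := by
      rw [Real.rpow_neg hw.le, ← div_eq_mul_inv, one_le_div (by positivity)]
      gcongr
    have h5 : 0 ≤ m * 2 ^ (m + 1) * R * 2 ^ (m + 1) * (1 + ‖y‖) ^ (-(m + 1)) := by positivity
    rw [if_pos h1, normalizedRieszKernel]
    have h6 : 0 ≤ ‖x - y‖ ^ (-m) := by positivity
    rw [add_mul]
    refine (abs_sub _ _).trans ?_
    rw [abs_of_nonneg h6, abs_of_nonneg h2]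
    linarith
  · have hy1 : 1 < ‖y‖ := by linarith
    have hy0 : 0 < ‖y‖ := by linarith
    have h1 : ‖y‖ / 2 ≤ ‖x - y‖ := by
      have := norm_sub_norm_le y x
      rw [norm_sub_rev] at this
      linarith
    have h2 := abs_rpow_neg_sub_rpow_neg_le hm (half_pos hy0) h1 (by linarith : ‖y‖ / 2 ≤ ‖y‖)
    have h3 : |‖x - y‖ - ‖y‖| ≤ R := by
      rw [norm_sub_rev]
      refine (abs_norm_sub_norm_le (y - x) y).trans ?_
      simpa using hx
    have h4 : (‖y‖ / 2) ^ (-m - 1) ≤ 2 ^ (m + 1) * (2 ^ (m + 1) * (1 + ‖y‖) ^ (-(m + 1))) := by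
      rw [show -m - 1 = -(m + 1) by ring, Real.div_rpow hy0.le zero_le_two,
        Real.rpow_neg zero_le_two, div_inv_eq_mul, mul_comm]
      gcongr
      have h5 : ((1 + ‖y‖) / 2) ^ (-(m + 1)) = 2 ^ (m + 1) * (1 + ‖y‖) ^ (-(m + 1)) := by
        rw [Real.div_rpow hw.le zero_le_two, Real.rpow_neg zero_le_two (m + 1), div_inv_eq_mul,
          mul_comm]
      rw [← h5]
      exact Real.rpow_le_rpow_of_nonpos (by positivity) (by linarith) (by linarith)
    rw [normalizedRieszKernel, if_pos hy1]
    have h6 : 0 ≤ (1 + 2 * R) ^ (m + 1) * (1 + ‖y‖) ^ (-(m + 1)) := by positivity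
    calc |‖x - y‖ ^ (-m) - ‖y‖ ^ (-m)| ≤ m * (‖y‖ / 2) ^ (-m - 1) * |‖x - y‖ - ‖y‖| := h2
      _ ≤ m * (2 ^ (m + 1) * (2 ^ (m + 1) * (1 + ‖y‖) ^ (-(m + 1)))) * R := by gcongr
      _ ≤ _ := by rw [add_mul]; linarith

theorem memLp_one_add_norm_rpow {r : ℝ} (hr : (n : ℝ) < r) {q : ℝ≥0∞} (hq : 1 ≤ q) :
    MemLp (fun y : Rn n => (1 + ‖y‖) ^ (-r)) q volume := by
  have hm : AEStronglyMeasurable (fun y : Rn n => (1 + ‖y‖) ^ (-r)) volume :=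
    Measurable.aestronglyMeasurable (by fun_prop)
  have hr0 : 0 < r := (Nat.cast_nonneg n).trans_lt hr
  rcases eq_or_ne q ⊤ with rfl | hq1
  · refine memLp_top_of_bound hm 1 (Eventually.of_forall fun y => ?_)
    rw [Real.norm_of_nonneg (by positivity)]
    exact Real.rpow_le_one_of_one_le_of_nonpos (by linarith [norm_nonneg y]) (by linarith)
  · refine (integrable_norm_rpow_iff hm (zero_lt_one.trans_le hq).ne' hq1).1 ?_
    have hq2 : 1 ≤ q.toReal := by
      rw [← ENNReal.toReal_one]
      exact ENNReal.toReal_mono hq1 hq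
    have := integrable_one_add_norm (E := Rn n) (μ := volume) (r := r * q.toReal) (by
      rw [finrank_euclideanSpace, Fintype.card_fin]
      nlinarith)
    refine this.congr (Eventually.of_forall fun y => ?_)
    simp only
    rw [Real.norm_of_nonneg (by positivity), ← Real.rpow_mul (by positivity), neg_mul]

/-- Hölder with the conjugate exponent; asking for F in every L^q treats all p at once. -/
theorem MemLp.integrable_smul_of_forall_memLp {E : Type*} [NormedAddCommGroup E] [NormedSpace ℝ E]
    {p : ℝ≥0∞} (hp : 1 ≤ p) {u : Rn n → ℝ} {F : Rn n → E} (hu : MemLp u p volume)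
    (hF : ∀ q, 1 ≤ q → MemLp F q volume) : Integrable (fun x => u x • F x) volume := by
  have := ENNReal.HolderConjugate.conjExponent hp
  exact memLp_one_iff_integrable.1
    ((hF (ENNReal.conjExponent p) (by simp [ENNReal.conjExponent])).smul hu)

theorem quasiMeasurePreserving_sub_Rn (n : ℕ) :
    Measure.QuasiMeasurePreserving (fun z : Rn n × Rn n => z.1 + -z.2)
      ((volume : Measure (Rn n)).prod volume) volume := by
  have h1 := (quasiMeasurePreserving_add (volume : Measure (Rn n)) volume).comp
    ((MeasurePreserving.id (volume : Measure (Rn n))).prod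
      (Measure.measurePreserving_neg (volume : Measure (Rn n)))).quasiMeasurePreserving
  exact h1

/-- `∫ |k(x, y)| |u(y)| dy` for the normalized Riesz kernel. -/
def absPotential (m : ℝ) (u : Rn n → ℝ) (x : Rn n) : ℝ≥0∞ :=
  ∫⁻ y, ‖normalizedRieszKernel m x y * u y‖ₑ

theorem aestronglyMeasurable_potential_integrand (m : ℝ) {u : Rn n → ℝ}
    (hu : AEStronglyMeasurable u volume) :
    AEStronglyMeasurable (fun z : Rn n × Rn n => normalizedRieszKernel m z.1 z.2 * u z.2)
      (volume.prod volume) :=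
  (measurable_normalizedRieszKernel m).aestronglyMeasurable.mul hu.comp_snd

/-- The near part is a convolution of |u| with an integrable kernel, bounded on L^p by Minkowski.
The tail is at most a constant on the ball, finite by Hölder since (1+‖y‖)^{-(m+1)} lies in every
L^q when m + 1 > n. -/
theorem eLpNorm_absPotential_ball_lt_top (hn : 1 ≤ n) {m : ℝ} (hm0 : 0 < m) (hmn : m < n)
    (hmn1 : (n : ℝ) < m + 1) {p : ℝ≥0∞} (hp : 1 ≤ p) {u : Rn n → ℝ} (hu : MemLp u p volume) {R : ℝ}
    (hR : 1 ≤ R) :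
    eLpNorm (absPotential m u) p (volume.restrict (Metric.closedBall 0 R)) < ⊤ := by
  obtain ⟨C, hC0, hC⟩ := abs_normalizedRieszKernel_le (n := n) hm0 hR
  set k : Rn n → ℝ := fun z => if ‖z‖ < 3 * R then ‖z‖ ^ (-m) else 0 with hk
  have hkm : Measurable k := by
    refine Measurable.ite ?_ (by fun_prop) measurable_const
    exact measurableSet_lt (by fun_prop) measurable_const
  have hki : Integrable k volume := by
    have : IntegrableOn (fun z : Rn n => ‖z‖ ^ (-m)) (Metric.ball 0 (3 * R)) volume := by
      refine integrableOn_ball_of_norm_le_rpow (by simp; omega) (C := 1) (α := m) (by simpa using hmn)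
        (Eventually.of_forall fun h => ?_) (measurable_norm_rpow n _).aestronglyMeasurable
      rw [one_mul, Real.norm_of_nonneg (by positivity)]
    refine (this.integrable_indicator measurableSet_ball).congr (Eventually.of_forall fun z => ?_)
    simp [k, indicator]
  set V : Rn n → ℝ≥0∞ := fun x => ∫⁻ z, ‖u (x + -z)‖ₑ * ‖k z‖ₑ with hV
  have hum : AEMeasurable (fun z : Rn n × Rn n => ‖u (z.1 + -z.2)‖ₑ * ‖k z.2‖ₑ)
      (volume.prod volume) := by
    refine AEMeasurable.mul ?_ (hkm.comp measurable_snd).enorm.aemeasurable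
    have h1 := hu.1.comp_quasiMeasurePreserving
      (quasiMeasurePreserving_sub_Rn n)
    exact h1.enorm
  have hVp : eLpNorm V p volume < ⊤ := by
    refine (eLpNorm_lintegral_le hp hum
      (w := fun z => eLpNorm u p volume * ‖k z‖ₑ) (hkm.enorm.const_mul _) fun z => ?_).trans_lt ?_
    · have := eLpNorm_le_nnreal_smul_eLpNorm_of_ae_le_mul' (p := p) (μ := volume) (c := ‖k z‖₊)
        (f := fun x => ‖u (x + -z)‖ₑ * ‖k z‖ₑ) (g := fun x => u (x + -z))
        (Eventually.of_forall fun x => by rw [enorm_eq_self, mul_comm, enorm_eq_nnnorm (k z)])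
      rw [eLpNorm_comp_add_right hu.1, ENNReal.smul_def, smul_eq_mul, mul_comm] at this
      exact this
    · rw [lintegral_const_mul _ hkm.enorm]
      exact ENNReal.mul_lt_top hu.2 hki.2
  set D : ℝ≥0∞ := ∫⁻ y, ‖(C * (1 + ‖y‖) ^ (-(m + 1))) * u y‖ₑ with hD
  have hDtop : D ≠ ⊤ := by
    have h1 := MemLp.integrable_smul_of_forall_memLp hp hu
      fun q hq => (memLp_one_add_norm_rpow hmn1 hq).const_mul C
    refine (lt_of_le_of_lt (le_of_eq ?_) h1.2).ne
    refine lintegral_congr fun y => ?_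
    simp only [smul_eq_mul]
    rw [mul_comm]
  have hle : ∀ x ∈ Metric.closedBall (0 : Rn n) R, absPotential m u x ≤ V x + D := by
    intro x hx
    have hVx : V x = ∫⁻ y, ‖u y‖ₑ * ‖k (x - y)‖ₑ := by
      rw [hV, ← lintegral_sub_left_eq_self (μ := volume) (fun y => ‖u y‖ₑ * ‖k (x - y)‖ₑ) x]
      simp [sub_eq_add_neg]
    have hDm : AEMeasurable (fun y : Rn n => ‖(C * (1 + ‖y‖) ^ (-(m + 1))) * u y‖ₑ) volume :=
      (AEStronglyMeasurable.mul (Measurable.aestronglyMeasurable (by fun_prop)) hu.1).enorm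
    rw [hVx, hD, ← lintegral_add_right' _ hDm]
    refine lintegral_mono fun y => ?_
    have hkn : 0 ≤ k (x - y) := by simp only [hk]; split_ifs <;> positivity
    have h1 := hC x y (by simpa using hx)
    rw [← ofReal_norm, ← ofReal_norm, ← ofReal_norm, ← ofReal_norm,
      ← ENNReal.ofReal_mul (norm_nonneg _), ← ENNReal.ofReal_add (by positivity) (by positivity)]
    refine ENNReal.ofReal_le_ofReal ?_
    rw [norm_mul, norm_mul, Real.norm_of_nonneg hkn,
      Real.norm_of_nonneg (by positivity : 0 ≤ C * (1 + ‖y‖) ^ (-(m + 1))), mul_comm ‖u y‖, ← add_mul]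
    gcongr
    exact h1
  have hVm : AEMeasurable V volume := hum.lintegral_prod_right'
  calc eLpNorm (absPotential m u) p (volume.restrict (Metric.closedBall 0 R))
      ≤ eLpNorm (V + fun _ => D) p (volume.restrict (Metric.closedBall 0 R)) := by
        refine eLpNorm_mono_enorm_ae ?_
        filter_upwards [ae_restrict_mem Metric.isClosed_closedBall.measurableSet] with x hx
        simpa using hle x hx
    _ ≤ eLpNorm V p (volume.restrict (Metric.closedBall 0 R))
        + eLpNorm (fun _ => D) p (volume.restrict (Metric.closedBall 0 R)) :=
        eLpNorm_add_le hVm.restrict.aestronglyMeasurable aestronglyMeasurable_const hp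
    _ < ⊤ := by
        refine ENNReal.add_lt_top.2 ⟨(eLpNorm_mono_measure _ Measure.restrict_le_self).trans_lt hVp, ?_⟩
        have : IsFiniteMeasure (volume.restrict (Metric.closedBall (0 : Rn n) R)) :=
          ⟨by rw [Measure.restrict_apply_univ]; exact measure_closedBall_lt_top⟩
        exact (memLp_const_enorm (by simpa using hDtop)).2

theorem IsTestFunction.integral_fderiv_eq_zero {φ : Rn n → ℝ} (hφ : IsTestFunction φ) (e : Rn n) :
    ∫ x, fderiv ℝ φ x e = 0 := by
  have hi : Integrable (fun x => fderiv ℝ φ x e) volume :=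
    memLp_one_iff_integrable.1 ((hφ.fderiv_apply e).memLp 1)
  have := integral_mul_fderiv_eq_neg_fderiv_mul_of_integrable (μ := (volume : Measure (Rn n)))
    (f := fun _ => (1 : ℝ)) (g := φ) (v := e) (by simp) (by simpa using hi)
    (by simpa using memLp_one_iff_integrable.1 (hφ.memLp 1))
    (fun x _ => differentiableAt_const _) (fun x _ => hφ.differentiable x)
  simpa using this

end LocalPotential

/-! ### From the fractional gradient to a classical primitive -/

section FractionalToClassical

open Set Filter Topology

variable {n : ℕ}

theorem integral_vector_eq_of_inner {F G : Rn n → Rn n} (hF : Integrable F volume)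
    (hG : Integrable G volume) (h : ∀ e, ∫ x, inner ℝ (F x) e = ∫ x, inner ℝ (G x) e) :
    ∫ x, F x = ∫ x, G x := by
  refine ext_inner_left ℝ fun e => ?_
  rw [← integral_inner hF, ← integral_inner hG]
  simpa only [real_inner_comm e] using h e

/-- A function whose gradient is the fractional gradient of `u`. -/
def fracPrimitive (α : ℝ) (u : Rn n → ℝ) (x : Rn n) : ℝ :=
  rieszGradientConst n α / ((n : ℝ) + α - 1) *
    ∫ y, normalizedRieszKernel ((n : ℝ) + α - 1) x y * u y

theorem aestronglyMeasurable_fracPrimitive (α : ℝ) {u : Rn n → ℝ}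
    (hu : AEStronglyMeasurable u volume) : AEStronglyMeasurable (fracPrimitive α u) volume :=
  (aestronglyMeasurable_potential_integrand _ hu).integral_prod_right'.const_mul _

theorem enorm_fracPrimitive_le (α : ℝ) (u : Rn n → ℝ) (x : Rn n) :
    ‖fracPrimitive α u x‖ₑ ≤ ‖rieszGradientConst n α / ((n : ℝ) + α - 1)‖ₑ *
      absPotential ((n : ℝ) + α - 1) u x := by
  rw [fracPrimitive, enorm_mul]
  gcongr
  exact enorm_integral_le_lintegral_enorm _

theorem memLp_fracPrimitive_restrict (hn : 1 ≤ n) {α : ℝ} (h0 : 0 < α) (h1 : α < 1) {p : ℝ≥0∞}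
    (hp : 1 ≤ p) {u : Rn n → ℝ} (hu : MemLp u p volume) {K : Set (Rn n)} (hK : IsCompact K) :
    MemLp (fracPrimitive α u) p (volume.restrict K) := by
  have hn' : (1 : ℝ) ≤ n := by exact_mod_cast hn
  obtain ⟨R, hR⟩ := hK.isBounded.exists_norm_le
  have hsub : K ⊆ Metric.closedBall 0 (max R 1) := fun x hx => by
    simpa using Or.inl (hR x hx)
  have hlt := eLpNorm_absPotential_ball_lt_top hn (m := (n : ℝ) + α - 1) (by linarith) (by linarith)
    (by linarith) hp hu (le_max_right R 1)
  refine MemLp.mono_measure (Measure.restrict_mono hsub le_rfl)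
    ⟨(aestronglyMeasurable_fracPrimitive α hu.1).restrict, ?_⟩
  have h2 := eLpNorm_le_nnreal_smul_eLpNorm_of_ae_le_mul' (p := p)
    (μ := volume.restrict (Metric.closedBall (0 : Rn n) (max R 1)))
    (c := ‖rieszGradientConst n α / ((n : ℝ) + α - 1)‖₊) (f := fracPrimitive α u)
    (g := absPotential ((n : ℝ) + α - 1) u)
    (Eventually.of_forall fun x => by
      simpa only [enorm_eq_self, enorm_eq_nnnorm] using enorm_fracPrimitive_le α u x)
  refine h2.trans_lt ?_
  rw [ENNReal.smul_def, smul_eq_mul]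
  exact ENNReal.mul_lt_top ENNReal.coe_lt_top hlt

theorem locallyIntegrable_of_memLp_restrict {E : Type*} [NormedAddCommGroup E] {p : ℝ≥0∞}
    (hp : 1 ≤ p) {f : Rn n → E} (hf : ∀ K, IsCompact K → MemLp f p (volume.restrict K)) :
    LocallyIntegrable f volume := by
  rw [locallyIntegrable_iff]
  intro K hK
  have : IsFiniteMeasure (volume.restrict K) :=
    ⟨by rw [Measure.restrict_apply_univ]; exact hK.measure_lt_top⟩
  exact memLp_one_iff_integrable.1 ((hf K hK).mono_exponent hp)

/-- By Fubini the potential can be transferred from u to ∂φ, and the potential of ∂φ is the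
fractional gradient of φ. -/
theorem integral_fracPrimitive_mul_fderiv (hn : 1 ≤ n) {α : ℝ} (h0 : 0 < α) (h1 : α < 1) {p : ℝ≥0∞}
    (hp : 1 ≤ p) {u : Rn n → ℝ} (hu : MemLp u p volume) {φ : Rn n → ℝ} (hφ : IsTestFunction φ)
    (e : Rn n) :
    ∫ x, fracPrimitive α u x * fderiv ℝ φ x e = ∫ y, u y * inner ℝ (rieszGradient α φ y) e := by
  have hn' : (1 : ℝ) ≤ n := by exact_mod_cast hn
  set m : ℝ := (n : ℝ) + α - 1 with hm
  set f : Rn n → ℝ := fun x => fderiv ℝ φ x e with hf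
  have hft : IsTestFunction f := hφ.fderiv_apply e
  have hfi : Integrable f volume := memLp_one_iff_integrable.1 (hft.memLp 1)
  obtain ⟨M, hM⟩ := hft.compactSupport.exists_bound_of_continuous hft.continuous
  obtain ⟨R, hR⟩ := hft.compactSupport.isCompact.isBounded.exists_norm_le
  have hm2 := aestronglyMeasurable_potential_integrand m hu.1
  have hAm : AEMeasurable (absPotential m u) volume := hm2.enorm.lintegral_prod_right'
  set B := Metric.closedBall (0 : Rn n) (max R 1) with hB
  have hA1 : ∫⁻ x in B, absPotential m u x < ⊤ := by
    have h2 := eLpNorm_absPotential_ball_lt_top hn (m := m) (by linarith) (by linarith)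
      (by linarith) hp hu (le_max_right R 1)
    have : IsFiniteMeasure (volume.restrict B) :=
      ⟨by rw [Measure.restrict_apply_univ]; exact measure_closedBall_lt_top⟩
    have h3 := (MemLp.mono_exponent (⟨hAm.restrict.aestronglyMeasurable, h2⟩ :
      MemLp (absPotential m u) p (volume.restrict B)) hp).2
    rw [eLpNorm_one_eq_lintegral_enorm] at h3
    simpa using h3
  -- ∂φ is bounded and supported in the ball B, over which the absolute potential is integrable.
  have hint : Integrable (fun z : Rn n × Rn n => f z.1 * (normalizedRieszKernel m z.1 z.2 * u z.2))
      (volume.prod volume) := by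
    have hmeas : AEStronglyMeasurable (fun z : Rn n × Rn n =>
        f z.1 * (normalizedRieszKernel m z.1 z.2 * u z.2)) (volume.prod volume) :=
      (hft.continuous.comp continuous_fst).aestronglyMeasurable.mul hm2
    refine ⟨hmeas, ?_⟩
    rw [hasFiniteIntegral_iff_enorm, lintegral_prod _ hmeas.enorm]
    have h2 : ∀ x, ∫⁻ y, ‖f x * (normalizedRieszKernel m x y * u y)‖ₑ
        = ‖f x‖ₑ * absPotential m u x := fun x => by
      rw [absPotential, ← lintegral_const_mul' _ _ enorm_ne_top]
      simp only [enorm_mul]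
    simp only [h2]
    have h3 : ∀ x, ‖f x‖ₑ * absPotential m u x
        ≤ B.indicator (fun x => ENNReal.ofReal M * absPotential m u x) x := fun x => by
      by_cases hx : x ∈ B
      · rw [indicator_of_mem hx, ← ofReal_norm]
        gcongr
        exact hM x
      · have : f x = 0 := by
          by_contra hne
          exact hx (by simpa [hB] using Or.inl (hR x (subset_tsupport _ hne)))
        simp [this]
    refine (lintegral_mono h3).trans_lt ?_
    rw [lintegral_indicator Metric.isClosed_closedBall.measurableSet,
      lintegral_const_mul' _ _ ENNReal.ofReal_ne_top]
    exact ENNReal.mul_lt_top ENNReal.ofReal_lt_top hA1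
  -- The normalizing term is constant in x, so it contributes a multiple of ∫ ∂φ = 0.
  have hslice : ∀ y, ∫ x, f x * normalizedRieszKernel m x y
      = ∫ h, ‖h‖ ^ (-m) * fderiv ℝ φ (y + h) e := fun y => by
    have hshift : IsTestFunction fun h => f (y + h) := by
      simpa [add_comm] using hft.comp_add_right y
    have h2 : Integrable (fun x => f x * ‖x - y‖ ^ (-m)) volume := by
      have := (integrable_norm_rpow_mul hn (by linarith : m < n) hshift.continuous
        hshift.compactSupport).comp_sub_right y
      refine this.congr (Eventually.of_forall fun x => ?_)
      simp only [add_sub_cancel, mul_comm]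
    simp only [normalizedRieszKernel, mul_sub]
    rw [integral_sub h2 (hfi.mul_const _), integral_mul_const, hφ.integral_fderiv_eq_zero e, zero_mul,
      sub_zero, ← integral_add_left_eq_self (μ := volume) _ y]
    refine integral_congr_ae (Eventually.of_forall fun x => ?_)
    simp only [add_sub_cancel_left, mul_comm, hf]
  calc ∫ x, fracPrimitive α u x * f x
      = rieszGradientConst n α / m * ∫ x, ∫ y, f x * (normalizedRieszKernel m x y * u y) := by
        rw [← integral_const_mul]
        refine integral_congr_ae (Eventually.of_forall fun x => ?_)
        simp only [fracPrimitive]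
        rw [integral_const_mul]
        ring
    _ = rieszGradientConst n α / m * ∫ y, ∫ x, f x * (normalizedRieszKernel m x y * u y) := by
        rw [integral_integral_swap hint]
    _ = ∫ y, u y * inner ℝ (rieszGradient α φ y) e := by
        rw [← integral_const_mul]
        refine integral_congr_ae (Eventually.of_forall fun y => ?_)
        simp only [← mul_assoc]
        rw [integral_mul_const, hslice, hφ.inner_rieszGradient_eq_potential hn h0 h1]
        ring

theorem HasWeakFracGradient.hasWeakGradient_fracPrimitive (hn : 1 ≤ n) {α : ℝ} (h0 : 0 < α)
    (h1 : α < 1) {p : ℝ≥0∞} (hp : 1 ≤ p) {u : Rn n → ℝ} (hu : MemLp u p volume) {g : Rn n → Rn n}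
    (hg : HasWeakFracGradient α u g) : HasWeakGradient (fracPrimitive α u) g := by
  have hloc : LocallyIntegrable (fracPrimitive α u) volume :=
    locallyIntegrable_of_memLp_restrict hp fun K hK => memLp_fracPrimitive_restrict hn h0 h1 hp hu hK
  refine ⟨hloc, hg.locallyIntegrable_grad, fun φ hφ => ?_⟩
  rw [hg.integral_eq φ hφ]
  congr 1
  refine integral_vector_eq_of_inner
    (MemLp.integrable_smul_of_forall_memLp hp hu fun q hq => hφ.memLp_rieszGradient hn h0 h1 hq)
    (hloc.integrable_smul_right_of_hasCompactSupport hφ.continuous_gradient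
      hφ.hasCompactSupport_gradient) fun e => ?_
  simp only [real_inner_smul_left, inner_gradient_eq_fderiv]
  exact (integral_fracPrimitive_mul_fderiv hn h0 h1 hp hu hφ e).symm

end FractionalToClassical

/-! ### From the classical gradient to the fractional gradient -/

section ClassicalToFractional

open Set Filter Topology

variable {n : ℕ}

theorem HasWeakGradient.ae_eq {v : Rn n → ℝ} {g g' : Rn n → Rn n} (hg : HasWeakGradient v g)
    (hg' : HasWeakGradient v g') : g =ᵐ[volume] g' :=
  ae_eq_of_integral_contDiff_smul_eq hg.locallyIntegrable_grad hg'.locallyIntegrable_grad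
    fun φ h1 h2 => (hg.integral_eq φ ⟨h1, h2⟩).trans (hg'.integral_eq φ ⟨h1, h2⟩).symm

theorem ae_lt_top_of_eLpNorm_lt_top {X : Type*} [MeasurableSpace X] {μ : Measure X} {p : ℝ≥0∞}
    (hp : 1 ≤ p) {E : X → ℝ≥0∞} (hE : AEMeasurable E μ) (hEp : eLpNorm E p μ < ⊤) :
    ∀ᵐ x ∂μ, E x < ⊤ := by
  rcases eq_or_ne p ⊤ with rfl | hp1
  · rw [eLpNorm_exponent_top] at hEp
    filter_upwards [enorm_ae_le_eLpNormEssSup E μ] with x hx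
    exact (by simpa using hx : E x ≤ _).trans_lt hEp
  · have hp0 : p ≠ 0 := (zero_lt_one.trans_le hp).ne'
    have hr : 0 < p.toReal := ENNReal.toReal_pos hp0 hp1
    rw [eLpNorm_lt_top_iff_lintegral_rpow_enorm_lt_top hp0 hp1] at hEp
    filter_upwards [ae_lt_top' (hE.enorm.pow_const _) hEp.ne] with x hx
    simpa [ENNReal.rpow_lt_top_iff_of_pos hr] using hx

theorem lintegral_enorm_mul_ne_top {p q : ℝ≥0∞} [p.HolderConjugate q] (hp : 1 ≤ p)
    {E : Rn n → ℝ≥0∞} {w : Rn n → ℝ} (hE : AEMeasurable E volume) (hEp : eLpNorm E p volume < ⊤)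
    (hw : MemLp w q volume) : ∫⁻ x, ‖w x‖ₑ * E x ≠ ⊤ := by
  have hfin := ae_lt_top_of_eLpNorm_lt_top hp hE hEp
  have hmem : MemLp (fun x => (E x).toReal) p volume := by
    refine ⟨hE.ennreal_toReal.aestronglyMeasurable, (eLpNorm_mono_enorm fun x => ?_).trans_lt hEp⟩
    rw [enorm_eq_self, Real.enorm_eq_ofReal ENNReal.toReal_nonneg]
    exact ENNReal.ofReal_toReal_le
  have hprod : Integrable (fun x => (E x).toReal * w x) volume := hmem.integrable_mul hw
  refine (lt_of_le_of_lt (le_of_eq ?_) hprod.2).ne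
  refine lintegral_congr_ae ?_
  filter_upwards [hfin] with x hx
  rw [enorm_mul, Real.enorm_eq_ofReal ENNReal.toReal_nonneg, ENNReal.ofReal_toReal hx.ne, mul_comm]

/-- The kernel is even, so after h ↦ -h a translation in x exchanges the two functions. The
increments are split only at fixed h, where Hölder makes each product integrable; the finite
energies justify the two uses of Fubini. -/
theorem integral_integral_diff_symm {p q : ℝ≥0∞} [p.HolderConjugate q] (hp : 1 ≤ p) (hq : 1 ≤ q)
    {s : ℝ} {v ψ : Rn n → ℝ} (hv : MemLp v p volume) (hψ : MemLp ψ q volume)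
    (hvE : eLpNorm (diffEnergy s v) p volume < ⊤) (hψE : eLpNorm (diffEnergy s ψ) q volume < ⊤) :
    ∫ x, ψ x * ∫ h, (v (x + h) - v x) * ‖h‖ ^ (-((n : ℝ) + s))
      = ∫ x, v x * ∫ h, (ψ (x + h) - ψ x) * ‖h‖ ^ (-((n : ℝ) + s)) := by
  have hswap : q.HolderConjugate p := ENNReal.HolderConjugate.symm
  set k : Rn n → ℝ := fun h => ‖h‖ ^ (-((n : ℝ) + s)) with hk
  have hkm : Measurable k := measurable_norm_rpow n _
  have hk0 : ∀ h, 0 ≤ k h := fun h => by simp only [hk]; positivity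
  have hint : ∀ {f w : Rn n → ℝ}, AEStronglyMeasurable f volume → AEStronglyMeasurable w volume →
      ∫⁻ x, ‖w x‖ₑ * diffEnergy s f x ≠ ⊤ →
      Integrable (fun z : Rn n × Rn n => w z.1 * ((f (z.1 + z.2) - f z.1) * k z.2))
        (volume.prod volume) := by
    intro f w hf hw hfin
    refine integrable_of_norm_le_diff (C := 1)
      (hw.comp_fst.mul ((aestronglyMeasurable_translate_sub hf).mul
        (hkm.comp measurable_snd).aestronglyMeasurable)) hfin fun x h => ?_
    rw [norm_mul, norm_mul, Real.norm_of_nonneg (hk0 h), one_mul]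
  have hi1 := hint hv.1 hψ.1
    (lintegral_enorm_mul_ne_top hp (aemeasurable_diffEnergy hv.1 s) hvE hψ)
  have hi2 := hint hψ.1 hv.1
    (lintegral_enorm_mul_ne_top (p := q) (q := p) hq (aemeasurable_diffEnergy hψ.1 s) hψE hv)
  have htr : ∀ {r : ℝ≥0∞} {f : Rn n → ℝ}, MemLp f r volume → ∀ h, MemLp (fun x => f (x + h)) r volume :=
    fun hf h => hf.comp_measurePreserving (measurePreserving_add_right volume h)
  have hslice : ∀ h : Rn n, ∫ x, ψ x * ((v (x + -h) - v x) * k (-h))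
      = ∫ x, v x * ((ψ (x + h) - ψ x) * k h) := by
    intro h
    have hkh : k (-h) = k h := by simp [hk]
    have e1 : Integrable (fun x => v (x + -h) * ψ x) volume := (htr hv (-h)).integrable_mul hψ
    have e2 : Integrable (fun x => v x * ψ (x + h)) volume := hv.integrable_mul (htr hψ h)
    have e3 : Integrable (fun x => v x * ψ x) volume := hv.integrable_mul hψ
    have e4 : ∫ x, v (x + -h) * ψ x = ∫ x, v x * ψ (x + h) := by
      rw [← integral_add_right_eq_self (μ := volume) (fun x => v (x + -h) * ψ x) h]
      simp
    have e5 : ∀ x, ψ x * ((v (x + -h) - v x) * k (-h)) = k h * (v (x + -h) * ψ x - v x * ψ x) :=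
      fun x => by rw [hkh]; ring
    have e6 : ∀ x, v x * ((ψ (x + h) - ψ x) * k h) = k h * (v x * ψ (x + h) - v x * ψ x) :=
      fun x => by ring
    simp_rw [e5, e6]
    rw [integral_const_mul, integral_const_mul, integral_sub e1 e3, integral_sub e2 e3, e4]
  calc ∫ x, ψ x * ∫ h, (v (x + h) - v x) * k h
      = ∫ x, ∫ h, ψ x * ((v (x + h) - v x) * k h) := by simp only [integral_const_mul]
    _ = ∫ h, ∫ x, ψ x * ((v (x + h) - v x) * k h) := integral_integral_swap hi1
    _ = ∫ h, ∫ x, ψ x * ((v (x + -h) - v x) * k (-h)) :=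
        (integral_neg_eq_self (fun h => ∫ x, ψ x * ((v (x + h) - v x) * k h)) volume).symm
    _ = ∫ h, ∫ x, v x * ((ψ (x + h) - ψ x) * k h) := by simp only [hslice]
    _ = ∫ x, ∫ h, v x * ((ψ (x + h) - ψ x) * k h) := (integral_integral_swap hi2).symm
    _ = ∫ x, v x * ∫ h, (ψ (x + h) - ψ x) * k h := by simp only [integral_const_mul]

theorem fracLaplacian_eq (s : ℝ) (v : Rn n → ℝ) (x : Rn n) :
    fracLaplacian s v x
      = fracLaplacianConst n s * ∫ h, (v (x + h) - v x) * ‖h‖ ^ (-((n : ℝ) + s)) := by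
  rw [fracLaplacian]
  simp_rw [fracLaplacianKernel_eq]

theorem enorm_fracLaplacianKernel (s : ℝ) (v : Rn n → ℝ) (x h : Rn n) :
    ‖fracLaplacianKernel s v x h‖ₑ
      = ‖v (x + h) - v x‖ₑ * ENNReal.ofReal (‖h‖ ^ (-((n : ℝ) + s))) := by
  have hk : 0 ≤ ‖h‖ ^ (-((n : ℝ) + s)) := by positivity
  rw [fracLaplacianKernel_eq, enorm_mul, Real.enorm_eq_ofReal hk]

theorem integrable_fracLaplacianKernel {s : ℝ} {v : Rn n → ℝ} (hv : AEStronglyMeasurable v volume)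
    {x : Rn n} (hx : diffEnergy s v x < ⊤) : Integrable (fracLaplacianKernel s v x) volume := by
  constructor
  · have h1 : AEStronglyMeasurable (fun h => v (x + h)) volume :=
      hv.comp_measurePreserving (measurePreserving_add_left volume x)
    refine ((h1.sub (aestronglyMeasurable_const (b := v x))).mul
      (measurable_norm_rpow n (-((n : ℝ) + s))).aestronglyMeasurable).congr
      (Eventually.of_forall fun h => ?_)
    exact (fracLaplacianKernel_eq s v x h).symm
  · rw [hasFiniteIntegral_iff_enorm]
    simpa only [enorm_fracLaplacianKernel, diffEnergy] using hx

theorem enorm_fracLaplacian_le (s : ℝ) (v : Rn n → ℝ) (x : Rn n) :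
    ‖fracLaplacian s v x‖ₑ ≤ ‖fracLaplacianConst n s‖ₑ * diffEnergy s v x := by
  rw [fracLaplacian, enorm_mul]
  gcongr
  refine (enorm_integral_le_lintegral_enorm _).trans (le_of_eq ?_)
  simp only [enorm_fracLaplacianKernel]
  rfl

theorem aestronglyMeasurable_fracLaplacian (s : ℝ) {v : Rn n → ℝ}
    (hv : AEStronglyMeasurable v volume) : AEStronglyMeasurable (fracLaplacian s v) volume := by
  have h1 := ((aestronglyMeasurable_translate_sub hv).mul
    ((measurable_norm_rpow n (-((n : ℝ) + s))).comp
      measurable_snd).aestronglyMeasurable).integral_prod_right'.const_mul (fracLaplacianConst n s)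
  exact h1.congr (Eventually.of_forall fun x => (fracLaplacian_eq s v x).symm)

theorem HasWeakGradient.eLpNorm_diffEnergy_le {v : Rn n → ℝ} {g : Rn n → Rn n}
    (hvg : HasWeakGradient v g) (hn : 1 ≤ n) {s : ℝ} (h0 : 0 < s) (h1 : s < 1) {p : ℝ≥0∞}
    (hp : 1 ≤ p) (hv : MemLp v p volume) (hg : MemLp g p volume) :
    eLpNorm (diffEnergy s v) p volume ≤ ENNReal.ofReal (minKernelIntegral n s *
      ((eLpNorm g p volume).toReal ^ s * (2 * (eLpNorm v p volume).toReal) ^ (1 - s))) := by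
  refine eLpNorm_diffEnergy_le_of_eLpNorm_le hn h0 h1 hv.1 hp ENNReal.toReal_nonneg
    ENNReal.toReal_nonneg (fun h => ?_) ?_
  · rw [ENNReal.ofReal_toReal hg.2.ne]
    exact hvg.eLpNorm_translate_sub_le hp h
  · rw [ENNReal.ofReal_toReal hv.2.ne]

theorem HasWeakGradient.eLpNorm_fracLaplacian_le {v : Rn n → ℝ} {g : Rn n → Rn n}
    (hvg : HasWeakGradient v g) (hn : 1 ≤ n) {s : ℝ} (h0 : 0 < s) (h1 : s < 1) {p : ℝ≥0∞}
    (hp : 1 ≤ p) (hv : MemLp v p volume) (hg : MemLp g p volume) :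
    eLpNorm (fracLaplacian s v) p volume
      ≤ ENNReal.ofReal (|fracLaplacianConst n s| * minKernelIntegral n s * 2 ^ (1 - s)) *
        eLpNorm v p volume ^ (1 - s) * eLpNorm g p volume ^ s := by
  have h2 := eLpNorm_le_nnreal_smul_eLpNorm_of_ae_le_mul' (p := p) (μ := volume)
    (c := ‖fracLaplacianConst n s‖₊) (f := fracLaplacian s v) (g := diffEnergy s v)
    (Eventually.of_forall fun x => by
      simpa only [enorm_eq_self, enorm_eq_nnnorm] using enorm_fracLaplacian_le s v x)
  refine h2.trans ?_
  rw [ENNReal.smul_def, smul_eq_mul, ← enorm_eq_nnnorm, ← ofReal_norm]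
  refine (mul_le_mul_right (hvg.eLpNorm_diffEnergy_le hn h0 h1 hp hv hg) _).trans (le_of_eq ?_)
  have hK := minKernelIntegral_nonneg n s
  have e1 : eLpNorm v p volume ^ (1 - s) = ENNReal.ofReal ((eLpNorm v p volume).toReal ^ (1 - s)) := by
    rw [← ENNReal.ofReal_rpow_of_nonneg ENNReal.toReal_nonneg (by linarith),
      ENNReal.ofReal_toReal hv.2.ne]
  have e2 : eLpNorm g p volume ^ s = ENNReal.ofReal ((eLpNorm g p volume).toReal ^ s) := by
    rw [← ENNReal.ofReal_rpow_of_nonneg ENNReal.toReal_nonneg h0.le, ENNReal.ofReal_toReal hg.2.ne]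
  rw [e1, e2, ← ENNReal.ofReal_mul (norm_nonneg _), ← ENNReal.ofReal_mul (by positivity),
    ← ENNReal.ofReal_mul (by positivity), Real.mul_rpow zero_le_two ENNReal.toReal_nonneg,
    Real.norm_eq_abs]
  congr 1
  ring

theorem HasWeakGradient.memLp_fracLaplacian {v : Rn n → ℝ} {g : Rn n → Rn n}
    (hvg : HasWeakGradient v g) (hn : 1 ≤ n) {s : ℝ} (h0 : 0 < s) (h1 : s < 1) {p : ℝ≥0∞}
    (hp : 1 ≤ p) (hv : MemLp v p volume) (hg : MemLp g p volume) :
    MemLp (fracLaplacian s v) p volume := by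
  refine ⟨aestronglyMeasurable_fracLaplacian s hv.1,
    (hvg.eLpNorm_fracLaplacian_le hn h0 h1 hp hv hg).trans_lt ?_⟩
  exact ENNReal.mul_lt_top (ENNReal.mul_lt_top ENNReal.ofReal_lt_top
    (ENNReal.rpow_lt_top_of_nonneg (by linarith) hv.2.ne))
    (ENNReal.rpow_lt_top_of_nonneg h0.le hg.2.ne)

/-- With ψ a component of ∇^α φ, the derivative ∂_e φ equals the fractional Laplacian of ψ almost
everywhere, and symmetry passes that operator to v. This uses ψ and its energy in the dual exponent.
-/
theorem HasWeakGradient.hasWeakFracGradient_fracLaplacian {v : Rn n → ℝ} {g : Rn n → Rn n}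
    (hvg : HasWeakGradient v g) (hn : 1 ≤ n) {α : ℝ} (h0 : 0 < α) (h1 : α < 1) {p : ℝ≥0∞}
    (hp : 1 ≤ p) (hv : MemLp v p volume) (hg : MemLp g p volume) :
    HasWeakFracGradient α (fracLaplacian (1 - α) v) g := by
  refine ⟨hvg.locallyIntegrable_grad, fun φ hφ => ?_⟩
  rw [hvg.integral_eq φ hφ]
  congr 1
  have hs0 : 0 < 1 - α := by linarith
  have hs1 : 1 - α < 1 := by linarith
  refine integral_vector_eq_of_inner
    (hvg.locallyIntegrable.integrable_smul_right_of_hasCompactSupport hφ.continuous_gradient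
      hφ.hasCompactSupport_gradient)
    (MemLp.integrable_smul_of_forall_memLp hp (hvg.memLp_fracLaplacian hn hs0 hs1 hp hv hg)
      fun q hq => hφ.memLp_rieszGradient hn h0 h1 hq) fun e => ?_
  simp only [real_inner_smul_left, inner_gradient_eq_fderiv]
  have := ENNReal.HolderConjugate.conjExponent hp
  have hq : 1 ≤ ENNReal.conjExponent p := by simp [ENNReal.conjExponent]
  set ψ : Rn n → ℝ := fun x => inner ℝ (rieszGradient α φ x) e with hψ
  have key := integral_integral_diff_symm (q := ENNReal.conjExponent p) hp hq hv
    ((hφ.memLp_rieszGradient hn h0 h1 hq).inner_const e)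
    ((hvg.eLpNorm_diffEnergy_le hn hs0 hs1 hp hv hg).trans_lt ENNReal.ofReal_lt_top)
    (hφ.eLpNorm_diffEnergy_inner_rieszGradient_lt_top hn h0 h1 hs0 hs1 hq e)
  calc ∫ x, v x * fderiv ℝ φ x e = ∫ x, v x * fracLaplacian (1 - α) ψ x := by
        refine integral_congr_ae ?_
        filter_upwards [hφ.fracLaplacian_rieszGradient_ae_eq hn h0 h1 e] with x hx
        rw [hx]
    _ = fracLaplacianConst n (1 - α) *
          ∫ x, v x * ∫ h, (ψ (x + h) - ψ x) * ‖h‖ ^ (-((n : ℝ) + (1 - α))) := by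
        rw [← integral_const_mul]
        simp only [fracLaplacian_eq, mul_left_comm]
    _ = fracLaplacianConst n (1 - α) *
          ∫ x, ψ x * ∫ h, (v (x + h) - v x) * ‖h‖ ^ (-((n : ℝ) + (1 - α))) := by
        rw [← key]
    _ = ∫ x, fracLaplacian (1 - α) v x * ψ x := by
        rw [← integral_const_mul]
        simp only [fracLaplacian_eq, mul_left_comm, mul_comm]

end ClassicalToFractional

end

/-! ### Assembly of the two statements -/

theorem proposition3p1 (n : ℕ) (hn : 1 ≤ n) (α : ℝ) (hα0 : 0 < α) (hα1 : α < 1) :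
    (∀ p : ℝ≥0∞, 1 ≤ p → ∀ u : Rn n → ℝ, MemFracSobolev α p u →
      ∃ v : Rn n → ℝ, MemSobolevLoc p v ∧
        ∀ g : Rn n → Rn n, HasWeakFracGradient α u g → HasWeakGradient v g) ∧
    (∃ C : ℝ≥0, ∀ p : ℝ≥0∞, 1 ≤ p → ∀ v : Rn n → ℝ, MemSobolev p v →
      (∀ᵐ x : Rn n, Integrable (fracLaplacianKernel (1 - α) v x) volume) ∧
      MemFracSobolev α p (fracLaplacian (1 - α) v) ∧
      ∀ g : Rn n → Rn n, HasWeakGradient v g →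
        HasWeakFracGradient α (fracLaplacian (1 - α) v) g ∧
        eLpNorm (fracLaplacian (1 - α) v) p volume
          ≤ C * eLpNorm v p volume ^ α * eLpNorm g p volume ^ (1 - α)) := by
  have hs0 : 0 < 1 - α := by linarith
  have hs1 : 1 - α < 1 := by linarith
  constructor
  · rintro p hp u ⟨hu, g, hg, hgp⟩
    refine ⟨fracPrimitive α u, ⟨fun K hK => memLp_fracPrimitive_restrict hn hα0 hα1 hp hu hK, g,
      hg.hasWeakGradient_fracPrimitive hn hα0 hα1 hp hu, fun K _ => hgp.restrict K⟩,
      fun g' hg' => hg'.hasWeakGradient_fracPrimitive hn hα0 hα1 hp hu⟩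
  -- With s = 1 - α, the factor 2^{1-s} = 2^α comes from ‖v(·+h) - v‖_p ≤ 2‖v‖_p.
  · refine ⟨(|fracLaplacianConst n (1 - α)| * minKernelIntegral n (1 - α) *
      2 ^ α).toNNReal, ?_⟩
    rintro p hp v ⟨hv, g, hvg, hg⟩
    refine ⟨?_, ⟨hvg.memLp_fracLaplacian hn hs0 hs1 hp hv hg, g,
      hvg.hasWeakFracGradient_fracLaplacian hn hα0 hα1 hp hv hg, hg⟩, fun g' hvg' => ?_⟩
    · have := ae_lt_top_of_eLpNorm_lt_top hp (aemeasurable_diffEnergy hv.1 (1 - α))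
        ((hvg.eLpNorm_diffEnergy_le hn hs0 hs1 hp hv hg).trans_lt ENNReal.ofReal_lt_top)
      filter_upwards [this] with x hx
      exact integrable_fracLaplacianKernel hv.1 hx
    -- Weak gradients agree almost everywhere, so an arbitrary one inherits membership in L^p.
    · have hg' : MemLp g' p volume := hg.ae_eq (hvg.ae_eq hvg')
      refine ⟨hvg'.hasWeakFracGradient_fracLaplacian hn hα0 hα1 hp hv hg', ?_⟩
      have := hvg'.eLpNorm_fracLaplacian_le hn hs0 hs1 hp hv hg'
      rw [sub_sub_cancel] at this
      exact this
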